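/- A skew-symmetric graph is a finite digraph $G=(V,E)$ (parallel arcs allowed, no loops) with a symmetry $\sigma$ consisting of fixed-point-free involutions of $V$ and of $E$ such that for each arc $e$ from $u$ to $v$, $\sigma(e)$ is an arc from $\sigma(v)$ to $\sigma(u)$. For $h:E\to\mathbb Z$ its symmetric function $h'$ is defined by $h'(\sigma(e))=h(e)$, and ${\rm div}_h(v)$ is the sum of $h$ over the arcs leaving $v$ minus the sum of $h$ over the arcs entering $v$. An integer flow from a node $s$ to a node $t\neq s$ is a function $h:E\to\mathbb Z_{\ge 0}$ with ${\rm div}_h(s)\ge 0$, ${\rm div}_h(t)\le 0$ and ${\rm div}_h(v)=0$ for all other $v$. For a set $S$ of nodes disjoint from $S'=\sigma(S)$, an integer symmetric flow from $S$ to $S'$ is a function $f:E\to\mathbb Z_{\ge 0}$ with $f=f'$, ${\rm div}_f(s)\ge 0$ for $s\in S$, and ${\rm div}_f(v)=0$ for $v\notin S\cup S'$. Theorem 5. Fix $k\ge 1$. Let $S=\{s_1,\dots,s_k\}$ be a set of $k$ nodes of a skew-symmetric graph $G=(V,E)$ with $S\cap\sigma(S)=\emptyset$, and let $f$ be an integer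 symmetric flow from $S$ to $\sigma(S)$. Then there are integer flows $f_{ij}$ from $s_i$ to $\sigma(s_j)$, $1\le i\le j\le k$, such that $$f=\sum_{1\le i\le j\le k}(f_{ij}+f'_{ij}),$$ where $f'_{ij}$ is symmetric to $f_{ij}$. Moreover, there is an algorithm (depending only on $k$) that, for every such $G$ with $|E|\ge 1$, given by arrays of the tails, heads and mates of its arcs and of the mates of its nodes, and for all such $s_1,\dots,s_k$ and $f$, finds such flows $f_{ij}$ in $O(|E|\log(2+|V|^2/|E|))$ time, where the constant depends only on $k$ and time is counted on a random access machine, with all memory outside the input initially zero, that performs addition, subtraction, halving (rounded down) and comparison of integers and reading and writing of memory cells at unit cost. -/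

import Mathlib

/-- A skew-symmetric graph on the node type `V` with arc type `E`: a digraph (parallel arcs allowed,
loops not) with fixed-point-free involutions on nodes and on arcs such that the mate of an arc
from `u` to `v` is an arc from the mate of `v` to the mate of `u`. -/
structure SkewGraph (V : Type*) (E : Type*) where
  tail : E → V
  head : E → V
  tail_ne_head : ∀ e, tail e ≠ head e
  mateV : V → V
  mateV_ne : ∀ v, mateV v ≠ v
  mateV_mateV : ∀ v, mateV (mateV v) = v
  mateE : E → E
  mateE_ne : ∀ e, mateE e ≠ e
  mateE_mateE : ∀ e, mateE (mateE e) = e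
  tail_mateE : ∀ e, tail (mateE e) = mateV (head e)
  head_mateE : ∀ e, head (mateE e) = mateV (tail e)

namespace SkewGraph

variable {V : Type*} {E : Type*} (G : SkewGraph V E)

/-- The function `h'` symmetric to `h`, given by `h' (mate of e) = h e`; since taking mates is an
involution, `h' e = h (mate of e)`. -/
def symm (h : E → ℤ) : E → ℤ := fun e => h (G.mateE e)

/-- The divergency at `v`: total value on arcs leaving `v` minus total value on arcs entering `v`. -/
def div [Fintype E] [DecidableEq V] (h : E → ℤ) (v : V) : ℤ :=
  (∑ e with G.tail e = v, h e) - ∑ e with G.head e = v, h e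

/-- `h` is an integer flow from the node `a` to the node `b` (used for `a ≠ b`). -/
structure IsFlow [Fintype E] [DecidableEq V] (a b : V) (h : E → ℤ) : Prop where
  nonneg : ∀ e, 0 ≤ h e
  div_source : 0 ≤ G.div h a
  div_sink : G.div h b ≤ 0
  div_inner : ∀ v, v ≠ a → v ≠ b → G.div h v = 0

/-- The nodes `s 0, …, s (k-1)` are distinct, and the set `S` of them is disjoint from the set
`S'` of their mates. -/
structure IsTerminals {k : ℕ} (s : Fin k → V) : Prop where
  injective : Function.Injective s
  ne_mate : ∀ i j, s i ≠ G.mateV (s j)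

/-- `f` is an integer symmetric flow from `S = {s 0, …, s (k-1)}` to the set `S'` of the mates. -/
structure IsSymmFlow [Fintype E] [DecidableEq V] {k : ℕ} (s : Fin k → V) (f : E → ℤ) : Prop where
  nonneg : ∀ e, 0 ≤ f e
  symmetric : G.symm f = f
  div_source : ∀ i, 0 ≤ G.div f (s i)
  div_inner : ∀ v, (∀ i, v ≠ s i) → (∀ i, v ≠ G.mateV (s i)) → G.div f v = 0

/-- The functions `F i j`, `i ≤ j`, are integer flows from `s i` to the mate of `s j`, and
`f` is the sum of all `F i j + (F i j)'` over `i ≤ j`. -/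
structure IsSymmDecomposition [Fintype E] [DecidableEq V] {k : ℕ} (s : Fin k → V) (f : E → ℤ)
    (F : Fin k → Fin k → E → ℤ) : Prop where
  isFlow : ∀ i j, i ≤ j → G.IsFlow (s i) (G.mateV (s j)) (F i j)
  sum_eq : f = ∑ i, ∑ j ∈ Finset.Ici i, (F i j + G.symm (F i j))

end SkewGraph

/-! A unit-cost random access machine, presented through structured programs. A program uses
finitely many integer registers and finitely many integer arrays with random access; the operations
are constants, addition, subtraction, halving (rounded down), indirect reading and writing,
comparison, branching and looping. There is no multiplication. Every evaluation of a node of an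
expression or test and every execution of a command costs one step. -/
namespace RAM

/-- The memory: registers and arrays. -/
structure Memory where
  reg : ℕ → ℤ
  arr : ℕ → ℤ → ℤ

/-- Integer expressions; `read a i` is the cell of the array number `a` with index `i`. -/
inductive Term where
  | const (z : ℤ)
  | reg (x : ℕ)
  | read (a : ℕ) (i : Term)
  | plus (p q : Term)
  | minus (p q : Term)
  | half (p : Term)

/-- The value of an expression; `half` rounds down. -/
def Term.eval (M : Memory) : Term → ℤ
  | const z => z
  | reg x => M.reg x
  | read a i => M.arr a (i.eval M)
  | plus p q => p.eval M + q.eval M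
  | minus p q => p.eval M - q.eval M
  | half p => p.eval M / 2

/-- The number of steps needed to evaluate an expression. -/
def Term.cost : Term → ℕ
  | const _ => 1
  | reg _ => 1
  | read _ i => i.cost + 1
  | plus p q => p.cost + q.cost + 1
  | minus p q => p.cost + q.cost + 1
  | half p => p.cost + 1

/-- Tests. -/
inductive Test where
  | le (p q : Term)
  | eq (p q : Term)
  | neg (b : Test)
  | both (b c : Test)

/-- The meaning of a test. -/
def Test.Holds (M : Memory) : Test → Prop
  | le p q => p.eval M ≤ q.eval M
  | eq p q => p.eval M = q.eval M
  | neg b => ¬ b.Holds M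
  | both b c => b.Holds M ∧ c.Holds M

/-- The number of steps needed to evaluate a test. -/
def Test.cost : Test → ℕ
  | le p q => p.cost + q.cost + 1
  | eq p q => p.cost + q.cost + 1
  | neg b => b.cost + 1
  | both b c => b.cost + c.cost + 1

/-- Programs. -/
inductive Program where
  | skip
  | assign (x : ℕ) (p : Term)
  | write (a : ℕ) (i p : Term)
  | seq (P Q : Program)
  | branch (b : Test) (P Q : Program)
  | loop (b : Test) (P : Program)

/-- The memory after the value `z` is put into the register `x`. -/
def Memory.setReg (M : Memory) (x : ℕ) (z : ℤ) : Memory where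
  reg := Function.update M.reg x z
  arr := M.arr

/-- The memory after the value `z` is put into the cell with index `i` of the array `a`. -/
def Memory.setArr (M : Memory) (a : ℕ) (i z : ℤ) : Memory where
  reg := M.reg
  arr := Function.update M.arr a (Function.update (M.arr a) i z)

/-- `Runs P M t N`: started in the memory `M`, the program `P` halts after exactly `t` steps,
leaving the memory `N`. The rules are deterministic. -/
inductive Runs : Program → Memory → ℕ → Memory → Prop
  | skip (M : Memory) : Runs .skip M 1 M
  | assign (M : Memory) (x : ℕ) (p : Term) :
      Runs (.assign x p) M (p.cost + 1) (M.setReg x (p.eval M))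
  | write (M : Memory) (a : ℕ) (i p : Term) :
      Runs (.write a i p) M (i.cost + p.cost + 1) (M.setArr a (i.eval M) (p.eval M))
  | seq {P Q : Program} {M N K : Memory} {t u : ℕ} :
      Runs P M t N → Runs Q N u K → Runs (.seq P Q) M (t + u) K
  | branch_true {b : Test} {P Q : Program} {M N : Memory} {t : ℕ} :
      b.Holds M → Runs P M t N → Runs (.branch b P Q) M (b.cost + 1 + t) N
  | branch_false {b : Test} {P Q : Program} {M N : Memory} {t : ℕ} :
      ¬ b.Holds M → Runs Q M t N → Runs (.branch b P Q) M (b.cost + 1 + t) N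
  | loop_true {b : Test} {P : Program} {M N K : Memory} {t u : ℕ} :
      b.Holds M → Runs P M t N → Runs (.loop b P) N u K →
        Runs (.loop b P) M (b.cost + 1 + t + u) K
  | loop_false {b : Test} {P : Program} {M : Memory} :
      ¬ b.Holds M → Runs (.loop b P) M (b.cost + 1) M

/-- The array holding `g 0, …, g (n-1)` in the cells `0, …, n-1`, and zero in all other cells. -/
def table {n : ℕ} (g : Fin n → ℤ) (z : ℤ) : ℤ :=
  ∑ i : Fin n, if z = ((i : ℕ) : ℤ) then g i else 0

/-- The initial memory for a skew-symmetric graph with nodes `0, …, n-1` and arcs `0, …, m-1`,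
terminals `s` and a function `f` on the arcs. Registers 0 and 1 hold `n` and `m`, and arrays 0 to 5
hold the tails, heads and mates of the arcs, the mates of the nodes, the values of `f`, and the
terminals. All other registers and cells are zero. -/
def input {n m k : ℕ} (G : SkewGraph (Fin n) (Fin m)) (s : Fin k → Fin n) (f : Fin m → ℤ) :
    Memory where
  reg := fun x => match x with
    | 0 => (n : ℤ)
    | 1 => (m : ℤ)
    | _ => 0
  arr := fun a => match a with
    | 0 => table fun e => ((G.tail e : ℕ) : ℤ)
    | 1 => table fun e => ((G.head e : ℕ) : ℤ)
    | 2 => table fun e => ((G.mateE e : ℕ) : ℤ)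
    | 3 => table fun v => ((G.mateV v : ℕ) : ℤ)
    | 4 => table f
    | 5 => table fun i => ((s i : ℕ) : ℤ)
    | _ => fun _ => 0

/-- The functions read off from the final memory: the value of the `(i,j)`-th one at the arc `e`
stands in the cell `e` of the array number `6 + (i * k + j)`. -/
def output {m k : ℕ} (M : Memory) (i j : Fin k) (e : Fin m) : ℤ :=
  M.arr (6 + ((i : ℕ) * k + (j : ℕ))) ((e : ℕ) : ℤ)

end RAM

/-! Write `v'` for the mate of `v`. Mated arcs carry equal amounts, so a symmetric flow amounts to a
symmetric matrix `A` of nonnegative integers: the cell `(a, b)` collects the arcs from `a` to `b'`,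
whose mates run from `b` to `a'`. An arc from `a` to `a'` shares its cell with its mate, hence the
diagonal is even. The divergency at `p` is the row sum at `p` minus the row sum at `p'`
(`row_arcMatrix`).

If the cells `(v, a)` and `(v', b)` are nonzero, the walk `a → v' → b'` and its mate `b → v → a'`
can be short-cut: an amount is taken from both cells and put into `(a, b)`, or dropped if `a = b'`,
the walk being closed (`splitOff`). Differences of row sums at mated nodes do not change
(`row_splitOff`). With the largest possible amount one of the two cells vanishes and at most one
cell is born, so the number of nonzero cells never grows (`splitOff_deg`). When one of the rows `v`,
`v'` has become empty, the signs of the divergencies force the row of every nonterminal among `v`,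
`v'` to be empty (`Core.finish`). After all pairs have been treated, only cells between terminals
are left, and these are the desired flows in a complete graph: the whole cell for `i < j`, half of
it for `i = j` (`routing_settled`).

The operations are then undone in reverse order. Each commodity keeps directed amounts `X c a b`
sent from `a` to `b'`; the amount of the record is taken from `(a, b)` and `(b, a)` and led back
through `v'` and `v`, a closed walk being first given to one fixed commodity (`Routing.undo`).
Finally the amounts in the cells are placed on arcs (`Routing.unmerge`). All these changes preserve
the excess of each commodity at each node, so the commodities stay flows between their terminals.

Running time: the cost of eliminating a pair is proportional to its degree `d`, apart from the
clearing of obsolete list entries, which is paid when they are made. When `i` nodes remain,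
averaging gives a pair with `d = O(m / i)`, and `d = O(i)` holds since live cells meet only
remaining nodes and the `k` terminals. Such a pair is found with a threshold that is doubled only
when every remaining pair exceeds it (`Core.threshold_mul_card_le`); nodes whose degree changes go
on a stack to be looked at again. The costs telescope against `m * log (m + i ^ 2)`
(`le_mul_log_sub_log`), which gives `m * log (1 + n ^ 2 / m)`. The passes through the queue cost
`log m` per node, which `mul_log_le` absorbs. Each record costs elimination time, so undoing is no
slower up to a constant. Only terminals, ends of arcs and their mates are ever touched, and rows of
the matrix are laid out by repeated addition, as there is no multiplication and no need to clear
memory.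

The existence statement is obtained by running the algorithm on a renumbered graph. -/

set_option linter.unusedSectionVars false

/-! ### Loop-free programs and amortized running time -/

namespace RAM

/-- The memory after running a program without loops. -/
noncomputable def exec : Program → Memory → Memory
  | .skip, M => M
  | .assign x p, M => M.setReg x (p.eval M)
  | .write a i p, M => M.setArr a (i.eval M) (p.eval M)
  | .seq P Q, M => exec Q (exec P M)
  | .branch b P Q, M => open Classical in if b.Holds M then exec P M else exec Q M
  | .loop _ _, M => M

/-- The program contains no loops. -/
def LoopFree : Program → Prop
  | .skip => True
  | .assign _ _ => True
  | .write _ _ _ => True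
  | .seq P Q => LoopFree P ∧ LoopFree Q
  | .branch _ P Q => LoopFree P ∧ LoopFree Q
  | .loop _ _ => False

/-- A bound on the running time of a program without loops. -/
def bound : Program → ℕ
  | .skip => 1
  | .assign _ p => p.cost + 1
  | .write _ i p => i.cost + p.cost + 1
  | .seq P Q => bound P + bound Q
  | .branch b P Q => b.cost + 1 + (bound P + bound Q)
  | .loop _ _ => 0

theorem exists_runs_exec {P : Program} (h : LoopFree P) (M : Memory) :
    ∃ t ≤ bound P, Runs P M t (exec P M) := by
  induction P generalizing M with
  | skip => exact ⟨1, le_rfl, Runs.skip M⟩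
  | assign x p => exact ⟨_, le_rfl, Runs.assign M x p⟩
  | write a i p => exact ⟨_, le_rfl, Runs.write M a i p⟩
  | seq P Q hP hQ =>
    obtain ⟨t, ht, h1⟩ := hP h.1 M
    obtain ⟨u, hu, h2⟩ := hQ h.2 (exec P M)
    exact ⟨t + u, Nat.add_le_add ht hu, Runs.seq h1 h2⟩
  | branch b P Q hP hQ =>
    by_cases hb : b.Holds M
    · obtain ⟨t, ht, h1⟩ := hP h.1 M
      refine ⟨b.cost + 1 + t, by simp only [bound]; omega, ?_⟩
      simp only [exec, if_pos hb]
      exact Runs.branch_true hb h1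
    · obtain ⟨t, ht, h1⟩ := hQ h.2 M
      refine ⟨b.cost + 1 + t, by simp only [bound]; omega, ?_⟩
      simp only [exec, if_neg hb]
      exact Runs.branch_false hb h1
  | loop b P _ => exact h.elim

/-- The registers that a program may change. -/
def regs : Program → Set ℕ
  | .skip => ∅
  | .assign x _ => {x}
  | .write _ _ _ => ∅
  | .seq P Q => regs P ∪ regs Q
  | .branch _ P Q => regs P ∪ regs Q
  | .loop _ P => regs P

/-- The arrays that a program may change. -/
def arrs : Program → Set ℕ
  | .skip => ∅
  | .assign _ _ => ∅
  | .write a _ _ => {a}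
  | .seq P Q => arrs P ∪ arrs Q
  | .branch _ P Q => arrs P ∪ arrs Q
  | .loop _ P => arrs P

theorem exec_reg {P : Program} {x : ℕ} (h : x ∉ regs P) (M : Memory) :
    (exec P M).reg x = M.reg x := by
  induction P generalizing M with
  | skip => rfl
  | assign y p =>
    have : x ≠ y := h
    simp [exec, Memory.setReg, this]
  | write a i p => rfl
  | seq P Q hP hQ =>
    simp only [regs, Set.mem_union, not_or] at h
    simp [exec, hP h.1, hQ h.2]
  | branch b P Q hP hQ =>
    simp only [regs, Set.mem_union, not_or] at h
    simp only [exec]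
    split_ifs
    · exact hP h.1 M
    · exact hQ h.2 M
  | loop b P _ => rfl

theorem exec_arr {P : Program} {a : ℕ} (h : a ∉ arrs P) (M : Memory) :
    (exec P M).arr a = M.arr a := by
  induction P generalizing M with
  | skip => rfl
  | assign y p => rfl
  | write c i p =>
    have : a ≠ c := h
    simp [exec, Memory.setArr, this]
  | seq P Q hP hQ =>
    simp only [arrs, Set.mem_union, not_or] at h
    simp [exec, hP h.1, hQ h.2]
  | branch b P Q hP hQ =>
    simp only [arrs, Set.mem_union, not_or] at h
    simp only [exec]
    split_ifs
    · exact hP h.1 M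
    · exact hQ h.2 M
  | loop b P _ => rfl

/-- Started in `M` with the credit `x`, the program halts in a memory `N` such that `N` and the
remaining credit, the time being paid, satisfy `R`. -/
def Halts (P : Program) (M : Memory) (x : ℝ) (R : Memory → ℝ → Prop) : Prop :=
  ∃ (t : ℕ) (N : Memory), Runs P M t N ∧ R N (x - t)

/-- The postcondition of the first program is itself a `Halts` statement with the credit that is
left, so running times need never be added up explicitly. -/
theorem Halts.seq {P Q : Program} {M : Memory} {x : ℝ} {R : Memory → ℝ → Prop}
    (h : Halts P M x fun N y => Halts Q N y R) : Halts (.seq P Q) M x R := by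
  obtain ⟨t, N, h1, u, K, h2, h3⟩ := h
  refine ⟨t + u, K, Runs.seq h1 h2, ?_⟩
  push_cast
  rwa [← sub_sub]

theorem Halts.mono {P : Program} {M : Memory} {x : ℝ} {R S : Memory → ℝ → Prop}
    (h : Halts P M x R) (hRS : ∀ N y, R N y → S N y) : Halts P M x S := by
  obtain ⟨t, N, h1, h2⟩ := h
  exact ⟨t, N, h1, hRS _ _ h2⟩

theorem Halts.of_loopFree {P : Program} {M : Memory} {x : ℝ} {R : Memory → ℝ → Prop}
    (hP : LoopFree P) (h : ∀ y, x - bound P ≤ y → R (exec P M) y) : Halts P M x R := by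
  obtain ⟨t, ht, h1⟩ := exists_runs_exec hP M
  refine ⟨t, _, h1, h _ ?_⟩
  have : (t : ℝ) ≤ bound P := by exact_mod_cast ht
  linarith

theorem Halts.branch {b : Test} {P Q : Program} {M : Memory} {x : ℝ} {R : Memory → ℝ → Prop}
    (h1 : b.Holds M → Halts P M (x - (b.cost + 1)) R)
    (h2 : ¬ b.Holds M → Halts Q M (x - (b.cost + 1)) R) : Halts (.branch b P Q) M x R := by
  by_cases hb : b.Holds M
  · obtain ⟨t, N, h3, h4⟩ := h1 hb
    refine ⟨_, N, Runs.branch_true hb h3, ?_⟩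
    push_cast
    rwa [← sub_sub]
  · obtain ⟨t, N, h3, h4⟩ := h2 hb
    refine ⟨_, N, Runs.branch_false hb h3, ?_⟩
    push_cast
    rwa [← sub_sub]

/-- A loop with an invariant on the memory and the credit. The credit bounds the number of
rounds. -/
theorem Halts.loop {b : Test} {P : Program} {M : Memory} {x : ℝ} {R I : Memory → ℝ → Prop}
    (h0 : ∀ N y, I N y → 0 ≤ y)
    (h1 : ∀ N y, I N y → b.Holds N → Halts P N (y - (b.cost + 1)) I)
    (h2 : ∀ N y, I N y → ¬ b.Holds N → R N (y - (b.cost + 1))) (h : I M x) :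
    Halts (.loop b P) M x R := by
  -- Every round costs at least one unit for the test, so the credit drops below the next smaller
  -- integer bound, and a negative credit contradicts `h0`.
  obtain ⟨l, hl⟩ := exists_nat_gt x
  induction l generalizing M x with
  | zero => exact absurd (h0 _ _ h) (by simpa using hl)
  | succ l ih =>
    by_cases hb : b.Holds M
    · obtain ⟨t, N, h3, h4⟩ := h1 _ _ h hb
      have : x - (b.cost + 1) - t < l := by
        push_cast at hl
        have h5 : (0 : ℝ) ≤ b.cost := Nat.cast_nonneg _
        have h6 : (0 : ℝ) ≤ t := Nat.cast_nonneg _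
        linarith
      obtain ⟨u, K, h5, h6⟩ := ih h4 this
      refine ⟨_, K, Runs.loop_true hb h3 h5, ?_⟩
      push_cast
      rwa [← sub_sub, ← sub_sub]
    · refine ⟨_, M, Runs.loop_false hb, ?_⟩
      push_cast
      exact h2 _ _ h hb

theorem table_apply {n : ℕ} (g : Fin n → ℤ) (i : Fin n) : table g ((i : ℕ) : ℤ) = g i := by
  unfold table
  rw [Finset.sum_eq_single i]
  · simp
  · intro b _ hb
    rw [if_neg]
    intro h
    exact hb (Fin.ext (by exact_mod_cast h.symm))
  · simp

end RAM

/-! ### Symmetric matrices of mated arcs and the splitting-off operation -/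

namespace SymMatrix

variable {V : Type*}

/-- Matrices of the amounts of pairs of mated arcs between the nodes of `U`: the cell `(a, b)`
belongs to the arcs from `a` to the mate of `b`. -/
structure IsWeight (mate : V → V) (U : Finset V) (A : V → V → ℤ) : Prop where
  nonneg : ∀ x y, 0 ≤ A x y
  symm : ∀ x y, A x y = A y x
  even : ∀ x, Even (A x x)
  loopless : ∀ x, A x (mate x) = 0
  mem : ∀ x y, A x y ≠ 0 → x ∈ U

theorem IsWeight.mem_right {mate : V → V} {U : Finset V} {A : V → V → ℤ} (h : IsWeight mate U A)
    {x y : V} (hxy : A x y ≠ 0) : y ∈ U :=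
  h.mem y x (by rwa [h.symm])

theorem IsWeight.ne_mate {mate : V → V} {U : Finset V} {A : V → V → ℤ} {v a : V}
    (h : IsWeight mate U A) (ha : A v a ≠ 0) : a ≠ mate v := by
  rintro rfl; exact ha (h.loopless v)

theorem IsWeight.ne_of_mate {mate : V → V} {U : Finset V} {A : V → V → ℤ} {v b : V}
    (h : IsWeight mate U A) (hm : ∀ x, mate (mate x) = x)
    (hb : A (mate v) b ≠ 0) : b ≠ v := by
  rintro rfl; exact hb (by have := h.loopless (mate b); rwa [hm] at this)

variable [DecidableEq V]

/-- The matrix with a one in the cell `(a, b)`. -/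
def cell (a b : V) : V → V → ℤ := fun x y => if x = a ∧ y = b then 1 else 0

/-- The symmetric matrix with a one in the cells `(a, b)` and `(b, a)`, or a two if `a = b`. -/
def pair (a b : V) : V → V → ℤ := fun x y => cell a b x y + cell b a x y

/-- The matrix `A` with `δ` added to the cells `(a, b)` and `(b, a)`, twice if `a = b`. -/
def bump (A : V → V → ℤ) (a b : V) (δ : ℤ) : V → V → ℤ := fun x y => A x y + δ * pair a b x y

/-- The largest amount that can be subtracted from the cells `(x, y)` and `(y, x)`. -/
def cap (A : V → V → ℤ) (x y : V) : ℤ := if x = y then A x y / 2 else A x y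

theorem pair_comm (a b : V) : pair a b = pair b a := by
  ext x y; simp only [pair]; ring

theorem pair_symm (a b x y : V) : pair a b x y = pair a b y x := by
  simp only [pair, cell, and_comm, add_comm]

theorem pair_self (a b : V) : pair a b a b = if a = b then 2 else 1 := by
  by_cases h : a = b <;> simp [pair, cell, h]

theorem pair_nonneg (a b x y : V) : 0 ≤ pair a b x y := by
  simp only [pair, cell]; split_ifs <;> norm_num

theorem pair_eq_zero {a b x y : V} (h1 : ¬ (x = a ∧ y = b)) (h2 : ¬ (x = b ∧ y = a)) :
    pair a b x y = 0 := by
  simp [pair, cell, h1, h2]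

theorem pair_diag (a b x : V) : pair a b x x = if x = a ∧ x = b then 2 else 0 := by
  simp only [pair, cell]
  by_cases h : x = a
  · by_cases h' : x = b
    · simp [← h, ← h']
    · have : a ≠ b := fun e => h' (h.trans e)
      simp [h, this]
  · simp [h]

theorem bump_neg_bump (A : V → V → ℤ) (a b : V) (δ : ℤ) : bump (bump A a b (-δ)) a b δ = A := by
  ext x y; simp only [bump]; ring

section Sums

variable [Fintype V]

theorem sum_cell_right (a b x : V) : ∑ y, cell a b x y = if x = a then 1 else 0 := by
  by_cases h : x = a <;> simp [cell, h]

theorem sum_cell_left (a b y : V) : ∑ x, cell a b x y = if y = b then 1 else 0 := by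
  by_cases h : y = b <;> simp [cell, h]

theorem sum_pair (a b x : V) :
    ∑ y, pair a b x y = (if x = a then 1 else 0) + (if x = b then 1 else 0) := by
  simp only [pair, Finset.sum_add_distrib, sum_cell_right]

/-- The number of nonzero cells in the row `x`, the diagonal cell counted twice. -/
def deg (A : V → V → ℤ) (x : V) : ℤ := ∑ y, if A x y = 0 then 0 else if x = y then 2 else 1

theorem deg_nonneg (A : V → V → ℤ) (x : V) : 0 ≤ deg A x :=
  Finset.sum_nonneg fun y _ => by split_ifs <;> norm_num

/-- The sum of the row `x`. -/
def row (A : V → V → ℤ) (x : V) : ℤ := ∑ y, A x y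

theorem row_bump (A : V → V → ℤ) (a b : V) (δ : ℤ) (x : V) :
    row (bump A a b δ) x =
      row A x + δ * ((if x = a then 1 else 0) + (if x = b then 1 else 0)) := by
  simp only [row, bump, Finset.sum_add_distrib, ← Finset.mul_sum, sum_pair]

/-- A positive addition to a nonnegative matrix cannot cancel, so degrees change only if the cell
was zero. Counting diagonal cells twice makes the formula the same for `a = b`. -/
theorem deg_bump {A : V → V → ℤ} (h0 : ∀ x y, 0 ≤ A x y) (hs : ∀ x y, A x y = A y x) {a b : V}
    {δ : ℤ} (hδ : 0 < δ) (x : V) :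
    deg (bump A a b δ) x = deg A x +
      if A a b = 0 then (if x = a then 1 else 0) + (if x = b then 1 else 0) else 0 := by
  have key : ∀ y, (if bump A a b δ x y = 0 then 0 else if x = y then 2 else (1 : ℤ)) =
      (if A x y = 0 then 0 else if x = y then 2 else 1) +
        if A a b = 0 then pair a b x y else 0 := by
    intro y
    have hp := pair_nonneg a b x y
    have hA := h0 x y
    have hz : bump A a b δ x y = 0 ↔ A x y = 0 ∧ pair a b x y = 0 := by
      simp only [bump]
      constructor
      · intro h
        have h1 : 0 ≤ δ * pair a b x y := by positivity
        have h2 : A x y = 0 := by omega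
        have h3 : δ * pair a b x y = 0 := by omega
        rcases mul_eq_zero.1 h3 with h4 | h4
        · omega
        · exact ⟨h2, h4⟩
      · rintro ⟨h1, h2⟩; simp [h1, h2]
    by_cases h1 : x = a ∧ y = b
    · obtain ⟨rfl, rfl⟩ := h1
      by_cases hxy : x = y
      · subst hxy; by_cases h : A x x = 0 <;> simp [hz, h, pair_self]
      · by_cases h : A x y = 0 <;> simp [hz, h, pair_self, hxy]
    · by_cases h2 : x = b ∧ y = a
      · obtain ⟨rfl, rfl⟩ := h2
        have e := hs x y
        have hyx : ¬ x = y := fun h => h1 ⟨h, h.symm⟩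
        have hyx' : ¬ y = x := fun h => hyx h.symm
        rw [pair_comm] at hz ⊢
        by_cases h : A x y = 0
        · rw [e] at h; simp [hz, h, pair_self, hyx, e]
        · have h' := h
          rw [e] at h; simp [hz, h, e]
      · simp [hz, pair_eq_zero h1 h2]
  simp only [deg, key, Finset.sum_add_distrib]
  congr 1
  by_cases h : A a b = 0
  · simp only [h, if_true]; exact sum_pair a b x
  · simp [h]

/-- Total number of nonzero cells, the diagonal ones counted twice. -/
def size (A : V → V → ℤ) : ℤ := ∑ x, deg A x

theorem size_bump {A : V → V → ℤ} (h0 : ∀ x y, 0 ≤ A x y) (hs : ∀ x y, A x y = A y x) {a b : V}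
    {δ : ℤ} (hδ : 0 < δ) :
    size (bump A a b δ) = size A + if A a b = 0 then 2 else 0 := by
  simp only [size, deg_bump h0 hs hδ, Finset.sum_add_distrib]
  congr 1
  split_ifs
  · simp [Finset.sum_add_distrib]
  · simp

end Sums

variable {mate : V → V} {U : Finset V} {A : V → V → ℤ}

theorem IsWeight.bump_add (h : IsWeight mate U A) (hm : ∀ x, mate (mate x) = x) {a b : V} {δ : ℤ}
    (ha : a ∈ U) (hb : b ∈ U) (hab : a ≠ mate b) (hδ : 0 ≤ δ) :
    IsWeight mate U (bump A a b δ) where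
  nonneg x y := by
    have := h.nonneg x y
    have := pair_nonneg a b x y
    simp only [bump]; positivity
  symm x y := by simp only [bump]; rw [h.symm x y, pair_symm]
  even x := by
    simp only [bump, pair_diag]
    refine (h.even x).add ?_
    split_ifs <;> simp
  loopless x := by
    simp only [bump, h.loopless]
    rw [pair_eq_zero, mul_zero, add_zero]
    · rintro ⟨rfl, rfl⟩; exact hab (hm _).symm
    · rintro ⟨rfl, rfl⟩; exact hab rfl
  mem x y hxy := by
    by_contra hx
    have h1 : A x y = 0 := by by_contra h2; exact hx (h.mem x y h2)
    apply hxy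
    simp only [bump, h1]
    rw [pair_eq_zero]
    · simp
    · rintro ⟨rfl, rfl⟩; exact hx ha
    · rintro ⟨rfl, rfl⟩; exact hx hb

/-- Evenness of the diagonal makes the halving in `cap` exact. -/
theorem IsWeight.two_mul_cap (h : IsWeight mate U A) (x y : V) :
    cap A x y * (if x = y then 2 else 1) = A x y := by
  by_cases hxy : x = y
  · subst hxy
    obtain ⟨c, hc⟩ := h.even x
    simp only [cap, if_true]; omega
  · simp [cap, hxy]

theorem IsWeight.bump_sub (h : IsWeight mate U A) {a b : V} {δ : ℤ} (hδ : 0 ≤ δ)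
    (hc : δ ≤ cap A a b) : IsWeight mate U (bump A a b (-δ)) := by
  have hab := h.two_mul_cap a b
  have key : δ * pair a b a b ≤ A a b := by
    rw [pair_self, ← hab]
    exact mul_le_mul_of_nonneg_right hc (by split_ifs <;> norm_num)
  have nn : ∀ x y, 0 ≤ bump A a b (-δ) x y := by
    intro x y
    simp only [bump]
    by_cases h1 : x = a ∧ y = b
    · obtain ⟨rfl, rfl⟩ := h1; linarith
    · by_cases h2 : x = b ∧ y = a
      · obtain ⟨rfl, rfl⟩ := h2
        rw [h.symm, pair_symm]; linarith
      · rw [pair_eq_zero h1 h2]; simpa using h.nonneg x y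
  have le : ∀ x y, bump A a b (-δ) x y ≤ A x y := by
    intro x y
    have := pair_nonneg a b x y
    have : 0 ≤ δ * pair a b x y := by positivity
    simp only [bump]; linarith
  refine ⟨nn, fun x y => ?_, fun x => ?_, fun x => ?_, fun x y hxy => ?_⟩
  · simp only [bump]; rw [h.symm x y, pair_symm]
  · simp only [bump, pair_diag]
    refine (h.even x).add ?_
    split_ifs <;> simp
  · have := le x (mate x); have := nn x (mate x); rw [h.loopless] at *; omega
  · apply h.mem x y
    have := le x y; have := nn x y; omega

theorem IsWeight.bump_cap (h : IsWeight mate U A) (a b : V) :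
    bump A a b (-cap A a b) a b = 0 := by
  have hab := h.two_mul_cap a b
  simp only [bump, pair_self]
  linarith

theorem IsWeight.cap_pos (h : IsWeight mate U A) {a b : V} (hab : A a b ≠ 0) : 0 < cap A a b := by
  have h1 := h.two_mul_cap a b
  have h2 := h.nonneg a b
  split_ifs at h1 <;> omega

/-- Part of the amount `δ` is taken from the cells `(v, a)` and `(mate v, b)` and, unless this
closes a cycle, put into the cell `(a, b)`. -/
def splitOff (mate : V → V) (A : V → V → ℤ) (v a b : V) (δ : ℤ) : V → V → ℤ :=
  if a = mate b then bump (bump A v a (-δ)) (mate v) b (-δ)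
  else bump (bump (bump A v a (-δ)) (mate v) b (-δ)) a b δ

/-- The largest amount for which `splitOff` is possible. -/
def slack (mate : V → V) (A : V → V → ℤ) (v a b : V) : ℤ :=
  min (cap A v a) (cap A (mate v) b)

section SplitOff

variable {v a b : V}

theorem IsWeight.slack_pos (h : IsWeight mate U A) (ha : A v a ≠ 0) (hb : A (mate v) b ≠ 0) :
    0 < slack mate A v a b :=
  lt_min (h.cap_pos ha) (h.cap_pos hb)

/-- The cells `(v, a)` and `(mate v, b)` differ even up to transposition: coincidence would need `v
= mate v` or a loop `a = mate v`. Hence the two subtractions of a splitting do not interfere. -/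
theorem IsWeight.bump_mate (h : IsWeight mate U A) (hne : ∀ x, mate x ≠ x) (ha : A v a ≠ 0)
    (b : V) (δ : ℤ) :
    bump A v a δ (mate v) b = A (mate v) b := by
  have h1 := h.ne_mate ha
  simp only [bump]
  rw [pair_eq_zero, mul_zero, add_zero]
  · exact fun h2 => hne v h2.1
  · exact fun h2 => h1 h2.1.symm

theorem IsWeight.splitOff_aux (h : IsWeight mate U A) (hne : ∀ x, mate x ≠ x)
    (ha : A v a ≠ 0) (hb : A (mate v) b ≠ 0) :
    IsWeight mate U (bump A v a (-slack mate A v a b)) ∧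
    IsWeight mate U (bump (bump A v a (-slack mate A v a b)) (mate v) b (-slack mate A v a b)) := by
  have h0 := (h.slack_pos ha hb).le
  have h1 := h.bump_sub h0 (min_le_left _ _)
  refine ⟨h1, h1.bump_sub h0 ?_⟩
  have : cap (bump A v a (-slack mate A v a b)) (mate v) b = cap A (mate v) b := by
    simp only [cap, h.bump_mate hne ha]
  rw [this]
  exact min_le_right _ _

theorem IsWeight.splitOff (h : IsWeight mate U A) (hm : ∀ x, mate (mate x) = x)
    (hne : ∀ x, mate x ≠ x) (ha : A v a ≠ 0) (hb : A (mate v) b ≠ 0) :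
    IsWeight mate U (splitOff mate A v a b (slack mate A v a b)) := by
  have h2 := (h.splitOff_aux hne ha hb).2
  unfold SymMatrix.splitOff
  split_ifs with hab
  · exact h2
  · exact h2.bump_add hm (h.mem_right ha) (h.mem_right hb) hab (h.slack_pos ha hb).le

/-- Both `v` and `mate v` lose `δ`, and the losses at `a` and `b` are made good by the new cell. For
a closed walk `a` and `b` are mates, so their losses cancel in the difference. -/
theorem row_splitOff [Fintype V] (hm : ∀ x, mate (mate x) = x) (A : V → V → ℤ) (v a b : V) (δ : ℤ)
    (p : V) :
    row (splitOff mate A v a b δ) p - row (splitOff mate A v a b δ) (mate p) =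
      row A p - row A (mate p) := by
  have e : ∀ x y, mate x = y ↔ x = mate y :=
    fun x y => ⟨fun h => by rw [← h, hm], fun h => by rw [h, hm]⟩
  unfold splitOff
  split_ifs with hab
  · simp only [row_bump, e, hm, hab]; ring
  · simp only [row_bump, e, hm]; ring

/-- Rows that have been emptied stay empty, because all four nodes of a splitting have nonzero rows.
-/
theorem splitOff_row_eq_zero (ha : ∀ x y, A x y = A y x) {p : V} (hp : ∀ y, A p y = 0)
    (h1 : A v a ≠ 0) (h2 : A (mate v) b ≠ 0) (δ : ℤ) (y : V) : splitOff mate A v a b δ p y = 0 := by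
  have e1 : p ≠ v := by rintro rfl; exact h1 (hp _)
  have e2 : p ≠ a := by rintro rfl; rw [ha] at h1; exact h1 (hp _)
  have e3 : p ≠ mate v := by rintro rfl; exact h2 (hp _)
  have e4 : p ≠ b := by rintro rfl; rw [ha] at h2; exact h2 (hp _)
  unfold splitOff
  split_ifs <;> simp [bump, pair, cell, e1, e2, e3, e4, hp]

/-- The slack is the smaller of two capacities, and the cell attaining it is exhausted. -/
theorem IsWeight.splitOff_kill (h : IsWeight mate U A) (hne : ∀ x, mate x ≠ x)
    (ha : A v a ≠ 0) (b : V) :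
    bump A v a (-slack mate A v a b) v a = 0 ∨
    bump (bump A v a (-slack mate A v a b)) (mate v) b (-slack mate A v a b) (mate v) b = 0 := by
  rcases min_choice (cap A v a) (cap A (mate v) b) with h1 | h1
  · left; unfold slack; rw [h1]; exact h.bump_cap v a
  · right
    have h2 : slack mate A v a b = cap A (mate v) b := h1
    have h3 := h.bump_mate hne ha b (-slack mate A v a b)
    have h4 := h.bump_cap (mate v) b
    rw [h2] at h3 ⊢
    unfold bump at h3 h4 ⊢
    rw [h3]; exact h4

/-- The numbers `α` and `β` indicate that the cells `(v, a)` and `(mate v, b)` vanish, and `γ` that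
the cell `(a, b)` is born. Later degree estimates are linear arithmetic in these three. -/
theorem IsWeight.splitOff_deg [Fintype V] (h : IsWeight mate U A) (hne : ∀ x, mate x ≠ x)
    (ha : A v a ≠ 0) (hb : A (mate v) b ≠ 0) :
    ∃ α β γ : ℤ, (0 ≤ α ∧ α ≤ 1) ∧ (0 ≤ β ∧ β ≤ 1) ∧ (0 ≤ γ ∧ γ ≤ 1) ∧ 1 ≤ α + β ∧
      (a = mate b → γ = 0) ∧
      size (SymMatrix.splitOff mate A v a b (slack mate A v a b)) =
        size A - 2 * α - 2 * β + 2 * γ ∧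
      ∀ p, deg (SymMatrix.splitOff mate A v a b (slack mate A v a b)) p = deg A p
        - α * ((if p = v then 1 else 0) + if p = a then 1 else 0)
        - β * ((if p = mate v then 1 else 0) + if p = b then 1 else 0)
        + γ * ((if p = a then 1 else 0) + if p = b then 1 else 0) := by
  have h0 := h.slack_pos ha hb
  have hk := h.splitOff_kill hne ha b
  obtain ⟨h1, h2⟩ := h.splitOff_aux hne ha hb
  unfold SymMatrix.splitOff
  set s := slack mate A v a b
  -- Subtractions are read backwards as additions, since `deg_bump` and `size_bump` need a positive
  -- amount.
  have e1 : bump (bump A v a (-s)) v a s = A := bump_neg_bump A v a s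
  have e2 := bump_neg_bump (bump A v a (-s)) (mate v) b s
  set A1 := bump A v a (-s)
  set A2 := bump A1 (mate v) b (-s)
  have d1 := deg_bump h1.nonneg h1.symm h0 (a := v) (b := a)
  have d2 := deg_bump h2.nonneg h2.symm h0 (a := mate v) (b := b)
  have d3 := deg_bump h2.nonneg h2.symm h0 (a := a) (b := b)
  have s1 := size_bump h1.nonneg h1.symm h0 (a := v) (b := a)
  have s2 := size_bump h2.nonneg h2.symm h0 (a := mate v) (b := b)
  have s3 := size_bump h2.nonneg h2.symm h0 (a := a) (b := b)
  rw [e1] at d1 s1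
  rw [e2] at d2 s2
  refine ⟨if A1 v a = 0 then 1 else 0, if A2 (mate v) b = 0 then 1 else 0,
    if a ≠ mate b ∧ A2 a b = 0 then 1 else 0, by split_ifs <;> simp, by split_ifs <;> simp,
    by split_ifs <;> simp, ?_, fun hab => by simp [hab], ?_, fun p => ?_⟩
  · rcases hk with hk | hk <;> simp only [hk, if_true] <;> split_ifs <;> norm_num
  · by_cases hab : a = mate b
    · have c : ¬ (a ≠ mate b ∧ A2 a b = 0) := fun e => e.1 hab
      rw [if_pos hab, if_neg c, s1, s2]; split_ifs <;> ring
    · simp only [hab, ne_eq, not_false_eq_true, true_and, if_false]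
      rw [s3, s1, s2]; split_ifs <;> ring
  · have d1 := d1 p
    have d2 := d2 p
    have d3 := d3 p
    by_cases hab : a = mate b
    · have c : ¬ (a ≠ mate b ∧ A2 a b = 0) := fun e => e.1 hab
      rw [if_pos hab, if_neg c, d1, d2]
      by_cases c1 : A1 v a = 0 <;> by_cases c2 : A2 (mate v) b = 0 <;>
        simp only [c1, c2, if_true, if_false] <;> ring
    · simp only [hab, ne_eq, not_false_eq_true, true_and, if_false]
      rw [d3, d1, d2]
      by_cases c1 : A1 v a = 0 <;> by_cases c2 : A2 (mate v) b = 0 <;>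
        by_cases c3 : A2 a b = 0 <;> simp only [c1, c2, c3, if_true, if_false] <;> ring

theorem IsWeight.size_splitOff_le [Fintype V] (h : IsWeight mate U A) (hne : ∀ x, mate x ≠ x)
    (ha : A v a ≠ 0) (hb : A (mate v) b ≠ 0) :
    size (SymMatrix.splitOff mate A v a b (slack mate A v a b)) ≤ size A := by
  obtain ⟨α, β, γ, h1, h2, h3, h4, -, h5, -⟩ := h.splitOff_deg hne ha hb
  omega

theorem IsWeight.deg_splitOff_of_ne [Fintype V] (h : IsWeight mate U A) (hne : ∀ x, mate x ≠ x)
    (ha : A v a ≠ 0) (hb : A (mate v) b ≠ 0) {p : V} (h1 : p ≠ v) (h2 : p ≠ mate v) (h3 : p ≠ a)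
    (h4 : p ≠ b) :
    deg (SymMatrix.splitOff mate A v a b (slack mate A v a b)) p = deg A p := by
  obtain ⟨α, β, γ, -, -, -, -, -, -, h6⟩ := h.splitOff_deg hne ha hb
  simp [h6, h1, h2, h3, h4]

/-- A new diagonal entry at `v` or `mate v` would require `a = b` to be that node, hence `b = v` or
`a = mate v`, a loop. So the hypothesis of `splitOff_progress` persists during an elimination. -/
theorem IsWeight.splitOff_diag (h : IsWeight mate U A) (hm : ∀ x, mate (mate x) = x)
    (hne : ∀ x, mate x ≠ x) (ha : A v a ≠ 0) (hb : A (mate v) b ≠ 0) {p : V}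
    (hp : p = v ∨ p = mate v) (h0 : A p p = 0) :
    SymMatrix.splitOff mate A v a b (slack mate A v a b) p p = 0 := by
  have h3 := h.splitOff hm hne ha hb
  have h4 := h3.nonneg p p
  have hs := (h.slack_pos ha hb).le
  have h5 : pair a b p p = 0 := by
    apply pair_eq_zero
    · rintro ⟨rfl, rfl⟩
      rcases hp with rfl | rfl
      · exact h.ne_of_mate hm hb rfl
      · exact h.ne_mate ha rfl
    · rintro ⟨rfl, rfl⟩
      rcases hp with rfl | rfl
      · exact h.ne_of_mate hm hb rfl
      · exact h.ne_mate ha rfl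
  have h6 := mul_nonneg hs (pair_nonneg v a p p)
  have h7 := mul_nonneg hs (pair_nonneg (mate v) b p p)
  revert h4
  unfold SymMatrix.splitOff
  split_ifs <;> simp only [bump, h0, h5] <;> intro h4 <;> linarith

/-- As long as the mate of `v` has no diagonal entry, splitting off at `v` makes progress. -/
theorem IsWeight.splitOff_progress [Fintype V] (h : IsWeight mate U A)
    (hm : ∀ x, mate (mate x) = x) (hne : ∀ x, mate x ≠ x) (ha : A v a ≠ 0)
    (hb : A (mate v) b ≠ 0) :
    (A (mate v) (mate v) = 0 →
      deg (SymMatrix.splitOff mate A v a b (slack mate A v a b)) v +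
      2 * deg (SymMatrix.splitOff mate A v a b (slack mate A v a b)) (mate v) + 1 ≤
        deg A v + 2 * deg A (mate v)) ∧
    (A v v = 0 →
      2 * deg (SymMatrix.splitOff mate A v a b (slack mate A v a b)) v +
      deg (SymMatrix.splitOff mate A v a b (slack mate A v a b)) (mate v) + 1 ≤
        2 * deg A v + deg A (mate v)) := by
  obtain ⟨α, β, γ, h1, h2, h3, h4, h5, -, h6⟩ := h.splitOff_deg hne ha hb
  have e1 : mate v ≠ v := hne v
  have e2 : v ≠ mate v := e1.symm
  have e3 := (h.ne_mate ha).symm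
  have e4 := (h.ne_of_mate hm hb).symm
  rw [h6, h6]
  -- The weight 2 is needed for `a = v` in the first case: then the new cell `(a, b)` belongs to the
  -- row of `v`, whose degree falls by `2 * α - γ` only. As the degree of `mate v` falls by `β`, the
  -- weighted sum falls by `2 * α - γ + 2 * β ≥ 1`. The second case is the mirror image.
  simp only [e1, e2, e3, e4, if_true, if_false]
  constructor <;> intro h0
  · have e5 : mate v ≠ b := by rintro rfl; exact hb h0
    simp only [e5, if_false]
    split_ifs <;> omega
  · have e5 : v ≠ a := by rintro rfl; exact ha h0
    simp only [e5, if_false]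
    split_ifs <;> omega

/-- If both `v` and its mate have diagonal entries, these can be played off against each other. -/
theorem IsWeight.splitOff_both_diag [Fintype V] (h : IsWeight mate U A)
    (hm : ∀ x, mate (mate x) = x) (hne : ∀ x, mate x ≠ x) (ha : A v v ≠ 0)
    (hb : A (mate v) (mate v) ≠ 0) :
    (SymMatrix.splitOff mate A v v (mate v) (slack mate A v v (mate v)) v v = 0 ∨
      SymMatrix.splitOff mate A v v (mate v) (slack mate A v v (mate v)) (mate v) (mate v) = 0) ∧
    deg (SymMatrix.splitOff mate A v v (mate v) (slack mate A v v (mate v))) v ≤ deg A v ∧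
    deg (SymMatrix.splitOff mate A v v (mate v) (slack mate A v v (mate v))) (mate v) ≤
      deg A (mate v) := by
  have e2 : v ≠ mate v := (hne v).symm
  refine ⟨?_, ?_⟩
  · have h1 := h.splitOff_kill hne ha (mate v)
    unfold SymMatrix.splitOff
    -- Here `a = v` and `b = mate v` are mates: the walk is closed and nothing is put back.
    rw [if_pos (hm v).symm]
    rcases h1 with h1 | h1
    · left
      have h2 := pair_eq_zero (a := mate v) (b := mate v) (x := v) (y := v)
        (fun h => e2 h.1) (fun h => e2 h.1)
      rw [bump, h1, h2]; ring
    · right; exact h1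
  · obtain ⟨α, β, γ, h1, h2, h3, h4, h5, -, h6⟩ := h.splitOff_deg hne ha hb
    have h5 := h5 (hm v).symm
    subst h5
    rw [h6, h6]
    simp only [hne v, e2, if_true, if_false]
    constructor <;> omega

end SplitOff

end SymMatrix

/-! ### Sequences of splitting operations -/

namespace SymMatrix

variable {V : Type*} [DecidableEq V] [Fintype V]

/-- The additional one is for the diagonal cell, which counts twice. -/
theorem deg_le_card {A : V → V → ℤ} {x : V} {T : Finset V} (h : ∀ y, A x y ≠ 0 → y ∈ T) :
    deg A x ≤ T.card + 1 := by
  have h1 : deg A x ≤ ∑ y, ((if y ∈ T then 1 else 0) + if x = y then 1 else 0) := by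
    refine Finset.sum_le_sum fun y _ => ?_
    by_cases h0 : A x y = 0
    · simp only [h0, if_true]; split_ifs <;> norm_num
    · simp only [h0, h y h0, if_true, if_false]; split_ifs <;> norm_num
  refine h1.trans (le_of_eq ?_)
  simp [Finset.sum_add_distrib]

/-- Record of a splitting operation. -/
structure Record (V : Type*) where
  v : V
  a : V
  b : V
  amount : ℤ

/-- The list of splitting operations, latest first, turns `A` into the last argument, and they can
be undone. -/
inductive Reduces (mate : V → V) (U : Finset V) (A : V → V → ℤ) :
    List (Record V) → (V → V → ℤ) → Prop
  | nil : Reduces mate U A [] A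
  | cons {l : List (Record V)} {B : V → V → ℤ} {r : Record V} :
      Reduces mate U A l B → r.v ∈ U → r.a ∈ U → r.b ∈ U → 0 ≤ r.amount →
      (r.a = mate r.b → splitOff mate B r.v r.a r.b r.amount r.a r.b = 0) →
      (r.a ≠ mate r.b → r.amount * pair r.a r.b r.a r.b ≤
        splitOff mate B r.v r.a r.b r.amount r.a r.b) →
      Reduces mate U A (r :: l) (splitOff mate B r.v r.a r.b r.amount)

/-- The two conditions of `Reduces.cons` guarantee that undoing finds the amount it must move:
either the cell `(a, b)` contains what was just added to it, or it is a loop cell and empty. -/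
theorem Reduces.splitOff {mate : V → V} {U : Finset V} {A B : V → V → ℤ} {l : List (Record V)}
    (h : Reduces mate U A l B) (hB : IsWeight mate U B) (hm : ∀ x, mate (mate x) = x)
    (hne : ∀ x, mate x ≠ x) {v a b : V} (ha : B v a ≠ 0)
    (hb : B (mate v) b ≠ 0) :
    Reduces mate U A (⟨v, a, b, slack mate B v a b⟩ :: l)
      (splitOff mate B v a b (slack mate B v a b)) := by
  refine .cons h (hB.mem _ _ ha) (hB.mem_right ha) (hB.mem_right hb) (hB.slack_pos ha hb).le
    (fun h0 => ?_) (fun h0 => ?_)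
  · have h1 := hB.splitOff hm hne ha hb
    change a = mate b at h0
    change SymMatrix.splitOff mate B v a b (slack mate B v a b) a b = 0
    rw [h1.symm, h0]
    have := h1.loopless b
    rwa [h0] at this
  · change a ≠ mate b at h0
    change slack mate B v a b * pair a b a b ≤
      SymMatrix.splitOff mate B v a b (slack mate B v a b) a b
    have h1 := (hB.splitOff_aux hne ha hb).2.nonneg a b
    rw [SymMatrix.splitOff, if_neg h0]
    rw [bump]
    linarith

end SymMatrix

/-! ### Commodities routed in the matrix, and undoing a splitting -/

namespace SkewGraph

open SymMatrix

variable {V E : Type*} [DecidableEq V] [Fintype V] [Fintype E] (G : SkewGraph V E)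

theorem mateV_eq_iff (x y : V) : G.mateV x = y ↔ x = G.mateV y :=
  ⟨fun h => by rw [← h, G.mateV_mateV], fun h => by rw [h, G.mateV_mateV]⟩

theorem div_add (Y Z : E → ℤ) (p : V) :
    G.div (fun e => Y e + Z e) p = G.div Y p + G.div Z p := by
  simp only [div, Finset.sum_add_distrib]; ring

theorem div_single [DecidableEq E] (e : E) (y : ℤ) (p : V) :
    G.div (fun e' => if e' = e then y else 0) p =
      (if G.tail e = p then y else 0) - if G.head e = p then y else 0 := by
  simp [div, Finset.sum_ite_eq']

/-- The divergency of the flow given by the amounts `Y` on arcs and the amounts `X a b` sent from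
`a` to the mate of `b`. -/
def excess (X : V → V → ℤ) (Y : E → ℤ) (p : V) : ℤ :=
  G.div Y p + (∑ b, X p b - ∑ a, X a (G.mateV p))

theorem excess_add (X X' : V → V → ℤ) (Y : E → ℤ) (p : V) :
    G.excess (fun x y => X x y + X' x y) Y p =
      G.excess X Y p + (∑ b, X' p b - ∑ a, X' a (G.mateV p)) := by
  simp only [excess, Finset.sum_add_distrib]; ring

theorem sum_cell_sub (a b p : V) (y : ℤ) :
    (∑ q, y * cell a b p q - ∑ q, y * cell a b q (G.mateV p)) =
      y * ((if p = a then 1 else 0) - if p = G.mateV b then 1 else 0) := by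
  rw [← Finset.mul_sum, ← Finset.mul_sum, sum_cell_right, sum_cell_left, mul_sub]
  simp only [G.mateV_eq_iff]

/-- The flow of amount `y` from `a` to the mate of `b` is led through the mate of `v`. -/
def reroute (X : V → V → ℤ) (v a b : V) (y : ℤ) : V → V → ℤ :=
  fun p q => X p q + y * (cell a v p q + cell (G.mateV v) b p q - cell a b p q)

/-- The walk from `a` through the mate of `v` to the mate of `b` has the same ends as the direct
arc. -/
theorem excess_reroute (X : V → V → ℤ) (Y : E → ℤ) (v a b : V) (y : ℤ) (p : V) :
    G.excess (G.reroute X v a b y) Y p = G.excess X Y p := by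
  have : G.reroute X v a b y = fun p q => (X p q + (y * cell a v p q)) +
      (y * cell (G.mateV v) b p q) + (-y) * cell a b p q := by
    ext p q; simp only [reroute]; ring
  rw [this, excess_add, excess_add, excess_add, sum_cell_sub, sum_cell_sub, sum_cell_sub]
  ring

/-- The cell `(mate of b, b)` stands for a loop at the mate of `b`, which contributes nothing to any
excess. -/
theorem excess_cycle (X : V → V → ℤ) (Y : E → ℤ) (b : V) (y : ℤ) (p : V) :
    G.excess (fun p q => X p q + y * cell (G.mateV b) b p q) Y p = G.excess X Y p := by
  rw [excess_add, sum_cell_sub]; ring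

variable {ι : Type*}

/-- The amounts `X` and `Y` of the commodities in `S` add up to `A`, apart from arcs, and form
flows between the prescribed terminals. -/
structure Routing (S : Finset ι) (src snk : ι → V) (A : V → V → ℤ) (X : ι → V → V → ℤ)
    (Y : ι → E → ℤ) : Prop where
  nonneg : ∀ c ∈ S, ∀ a b, 0 ≤ X c a b
  sum_eq : ∀ a b, ∑ c ∈ S, (X c a b + X c b a) = A a b
  source : ∀ c ∈ S, 0 ≤ G.excess (X c) (Y c) (src c)
  sink : ∀ c ∈ S, G.excess (X c) (Y c) (snk c) ≤ 0
  inner : ∀ c ∈ S, ∀ p, p ≠ src c → p ≠ snk c → G.excess (X c) (Y c) p = 0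

variable {G}

/-- The conditions at terminals and inner nodes mention the excess only, so every change that
preserves it preserves the flows. -/
theorem Routing.congr_excess {S : Finset ι} {src snk : ι → V} {A A' : V → V → ℤ}
    {X X' : ι → V → V → ℤ} {Y Y' : ι → E → ℤ} (h : G.Routing S src snk A X Y)
    (h0 : ∀ c ∈ S, ∀ a b, 0 ≤ X' c a b) (h1 : ∀ a b, ∑ c ∈ S, (X' c a b + X' c b a) = A' a b)
    (h2 : ∀ c ∈ S, ∀ p, G.excess (X' c) (Y' c) p = G.excess (X c) (Y c) p) :
    G.Routing S src snk A' X' Y' where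
  nonneg := h0
  sum_eq := h1
  source c hc := by rw [h2 c hc]; exact h.source c hc
  sink c hc := by rw [h2 c hc]; exact h.sink c hc
  inner c hc p := by rw [h2 c hc]; exact h.inner c hc p

theorem reroute_nonneg {X : V → V → ℤ} {v a b : V} {y : ℤ} (h : ∀ a b, 0 ≤ X a b) (h0 : 0 ≤ y)
    (h1 : y ≤ X a b) (p q : V) : 0 ≤ G.reroute X v a b y p q := by
  have := h p q
  simp only [reroute, cell]
  by_cases c : p = a ∧ q = b
  · obtain ⟨rfl, rfl⟩ := c
    split_ifs <;> nlinarith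
  · rw [if_neg c]
    split_ifs <;> nlinarith

/-- Taking greedily from `(a, b)` and then the remainder from `(b, a)` moves exactly `δ`. For `a ≠
b` the second cell is unaffected by the first transfer, and both together hold at least `δ`. For `a
= b` the assumption is doubled on both sides, so the first transfer already takes everything. -/
theorem sum_min_add_sum_min {S : Finset ι} {X : ι → V → V → ℤ} {a b : V} {δ : ℤ}
    (h0 : ∀ c ∈ S, ∀ a b, 0 ≤ X c a b)
    (h : δ * pair a b a b ≤ ∑ c ∈ S, (X c a b + X c b a)) {y z : ι → ℤ}
    (hy : ∑ c ∈ S, y c = min δ (∑ c ∈ S, X c a b))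
    {X' : ι → V → V → ℤ} (hX : a ≠ b → ∀ c ∈ S, X' c b a = X c b a)
    (h0' : ∀ c ∈ S, ∀ a b, 0 ≤ X' c a b)
    (hz : ∑ c ∈ S, z c = min (δ - ∑ c ∈ S, y c) (∑ c ∈ S, X' c b a)) :
    ∑ c ∈ S, y c + ∑ c ∈ S, z c = δ := by
  rw [Finset.sum_add_distrib, pair_self] at h
  have h1 : 0 ≤ ∑ c ∈ S, X' c b a := Finset.sum_nonneg fun c hc => h0' c hc b a
  by_cases hab : a = b
  · subst hab
    simp only [if_true] at h
    omega
  · rw [if_neg hab] at h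
    have h2 : 0 ≤ ∑ c ∈ S, X c b a := Finset.sum_nonneg fun c hc => h0 c hc b a
    rw [Finset.sum_congr rfl (hX hab)] at hz
    omega

/-- Undoing a splitting operation. -/
theorem Routing.undo [DecidableEq ι] {S : Finset ι} {src snk : ι → V} {A : V → V → ℤ}
    {v a b : V} {δ : ℤ} {X X1 : ι → V → V → ℤ} {Y : ι → E → ℤ}
    (h : G.Routing S src snk (splitOff G.mateV A v a b δ) X Y) {c0 : ι} (hc0 : c0 ∈ S)
    (hδ : 0 ≤ δ)
    (hloop : a = G.mateV b → splitOff G.mateV A v a b δ a b = 0)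
    (hle : a ≠ G.mateV b → δ * pair a b a b ≤ splitOff G.mateV A v a b δ a b)
    (hX1 : ∀ c p q, X1 c p q = X c p q + if a = G.mateV b ∧ c = c0 then δ * cell a b p q else 0)
    {y z : ι → ℤ} (hy0 : ∀ c ∈ S, 0 ≤ y c ∧ y c ≤ X1 c a b)
    (hy : ∑ c ∈ S, y c = min δ (∑ c ∈ S, X1 c a b))
    (hz0 : ∀ c ∈ S, 0 ≤ z c ∧ z c ≤ G.reroute (X1 c) v a b (y c) b a)
    (hz : ∑ c ∈ S, z c =
      min (δ - ∑ c ∈ S, y c) (∑ c ∈ S, G.reroute (X1 c) v a b (y c) b a)) :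
    G.Routing S src snk A
      (fun c => G.reroute (G.reroute (X1 c) v a b (y c)) (G.mateV v) b a (z c)) Y := by
  have hcell : ∀ p q, 0 ≤ cell a b p q := fun p q => by simp only [cell]; split_ifs <;> norm_num
  have n1 : ∀ c ∈ S, ∀ p q, 0 ≤ X1 c p q := by
    intro c hc p q
    have := h.nonneg c hc p q
    have := mul_nonneg hδ (hcell p q)
    rw [hX1]; split_ifs <;> omega
  have n2 : ∀ c ∈ S, ∀ p q, 0 ≤ G.reroute (X1 c) v a b (y c) p q := fun c hc =>
    reroute_nonneg (n1 c hc) (hy0 c hc).1 (hy0 c hc).2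
  have n3 : ∀ c ∈ S, ∀ p q,
      0 ≤ G.reroute (G.reroute (X1 c) v a b (y c)) (G.mateV v) b a (z c) p q := fun c hc =>
    reroute_nonneg (n2 c hc) (hz0 c hc).1 (hz0 c hc).2
  have s1 : ∀ p q, ∑ c ∈ S, (X1 c p q + X1 c q p) = splitOff G.mateV A v a b δ p q +
      if a = G.mateV b then δ * pair a b p q else 0 := by
    intro p q
    rw [← h.sum_eq p q]
    have : ∀ c, X1 c p q + X1 c q p = (X c p q + X c q p) +
        if c = c0 then (if a = G.mateV b then δ * pair a b p q else 0) else 0 := by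
      intro c
      have e : cell b a p q = cell a b q p := by simp only [cell, and_comm]
      rw [hX1, hX1, pair, e]
      by_cases h1 : a = G.mateV b <;> by_cases h2 : c = c0 <;> simp [h1, h2] <;> ring
    simp only [this, Finset.sum_add_distrib (f := fun c => X c p q + X c q p)]
    simp [hc0]
  -- For a closed walk the cell was empty and now holds just the inserted amount; otherwise the
  -- bound is the hypothesis `hle`.
  have tot : ∑ c ∈ S, y c + ∑ c ∈ S, z c = δ := by
    refine sum_min_add_sum_min n1 ?_ hy (fun hab c _ => ?_) n2 hz
    · rw [s1]
      by_cases hl : a = G.mateV b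
      · rw [if_pos hl, hloop hl]; omega
      · rw [if_neg hl]; have := hle hl; omega
    · have hab' : b ≠ a := fun e => hab e.symm
      simp only [reroute, cell]
      have e3 : ¬ (b = G.mateV v ∧ a = b) := fun e => hab e.2
      simp [hab', hab]
  refine h.congr_excess n3 (fun p q => ?_) (fun c _ p => ?_)
  -- Rerouting `(b, a)` through `v` fills the transposes of the cells filled by rerouting `(a, b)`
  -- through the mate of `v`. After symmetrization both changes look alike, so only the total `y c +
  -- z c` matters.
  · have key : ∀ c, G.reroute (G.reroute (X1 c) v a b (y c)) (G.mateV v) b a (z c) p q +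
        G.reroute (G.reroute (X1 c) v a b (y c)) (G.mateV v) b a (z c) q p =
        (X1 c p q + X1 c q p) +
          (y c + z c) * (pair v a p q + pair (G.mateV v) b p q - pair a b p q) := by
      intro c
      have e : ∀ a b, cell a b q p = cell b a p q := fun a b => by simp only [cell, and_comm]
      simp only [reroute, pair, e, G.mateV_mateV]
      ring
    simp only [key, Finset.sum_add_distrib (f := fun c => X1 c p q + X1 c q p), s1,
      ← Finset.sum_mul]
    rw [Finset.sum_add_distrib, tot]
    unfold splitOff
    split_ifs <;> (simp only [bump]; ring)
  · rw [excess_reroute, excess_reroute]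
    by_cases h1 : a = G.mateV b ∧ c = c0
    · have : X1 c = fun p q => X c p q + δ * cell (G.mateV b) b p q := by
        ext p q; rw [hX1, if_pos h1, ← h1.1]
      rw [this, excess_cycle]
    · have : X1 c = X c := by ext p q; rw [hX1, if_neg h1, add_zero]
      rw [this]

/-- Leading the amounts belonging to a pair of mated arcs through these arcs. -/
theorem Routing.unmerge [DecidableEq E] {S : Finset ι} {src snk : ι → V} {A : V → V → ℤ} {e : E}
    {δ : ℤ} {X : ι → V → V → ℤ} {Y : ι → E → ℤ} {a b : V} (ha : a = G.tail e)
    (hb : b = G.tail (G.mateE e))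
    (h : G.Routing S src snk (bump A a b δ) X Y)
    (hA : 0 ≤ A a b)
    {y z : ι → ℤ} (hy0 : ∀ c ∈ S, 0 ≤ y c ∧ y c ≤ X c a b)
    (hy : ∑ c ∈ S, y c = min δ (∑ c ∈ S, X c a b))
    (hz0 : ∀ c ∈ S, 0 ≤ z c ∧ z c ≤ X c b a - y c * cell a b b a)
    (hz : ∑ c ∈ S, z c = min (δ - ∑ c ∈ S, y c) (∑ c ∈ S, (X c b a - y c * cell a b b a))) :
    G.Routing S src snk A (fun c p q => X c p q - y c * cell a b p q - z c * cell b a p q)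
      (fun c e' => Y c e' + (if e' = e then y c else 0) + if e' = G.mateE e then z c else 0) ∧
    ∑ c ∈ S, y c + ∑ c ∈ S, z c = δ := by
  have n2 : ∀ c ∈ S, ∀ p q, 0 ≤ X c p q - y c * cell a b p q := by
    intro c hc p q
    simp only [cell]
    split_ifs with h1
    · obtain ⟨rfl, rfl⟩ := h1; have := (hy0 c hc).2; omega
    · have := h.nonneg c hc p q; omega
  have tot : ∑ c ∈ S, y c + ∑ c ∈ S, z c = δ := by
    refine sum_min_add_sum_min h.nonneg ?_ hy (fun hab c _ => ?_)
      (X' := fun c p q => X c p q - y c * cell a b p q) n2 hz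
    · rw [h.sum_eq, bump]; omega
    · have hab' : b ≠ a := fun e => hab e.symm
      simp [cell, hab']
  refine ⟨h.congr_excess ?_ (fun p q => ?_) (fun c _ p => ?_), tot⟩
  · intro c hc p q
    have := n2 c hc p q
    have e : cell b a p q = if p = b ∧ q = a then 1 else 0 := rfl
    rw [e]
    split_ifs with h1
    · obtain ⟨rfl, rfl⟩ := h1; have := (hz0 c hc).2; omega
    · omega
  · have e : ∀ a b, cell a b q p = cell b a p q := fun a b => by simp only [cell, and_comm]
    have key : ∀ c, (X c p q - y c * cell a b p q - z c * cell b a p q) +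
        (X c q p - y c * cell a b q p - z c * cell b a q p) =
        (X c p q + X c q p) - (y c + z c) * pair a b p q := by
      intro c; simp only [e, pair]; ring
    simp only [key, Finset.sum_sub_distrib, h.sum_eq, ← Finset.sum_mul]
    rw [Finset.sum_add_distrib, tot, bump]; ring
  -- The arc `e` runs from `a` to the mate of `b` and its mate from `b` to the mate of `a`, just as
  -- the cells `(a, b)` and `(b, a)`. Replacing cells by arcs therefore keeps the excess.
  · have hh : G.head e = G.mateV b := by rw [hb, G.tail_mateE, G.mateV_mateV]
    have hh' : G.head (G.mateE e) = G.mateV a := by rw [ha, G.head_mateE]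
    simp only [excess, div_add, div_single, Finset.sum_sub_distrib]
    have c1 := G.sum_cell_sub a b p (y c)
    have c2 := G.sum_cell_sub b a p (z c)
    rw [hh, hh', ← ha, ← hb]
    have i1 : ∀ x : V, ∀ w : ℤ, (if x = p then w else 0) = w * if p = x then 1 else 0 := by
      intro x w; simp [eq_comm]
    rw [i1, i1, i1, i1]
    linear_combination -c1 - c2

/-! ### The matrix of a symmetric flow -/

section ArcMatrix

variable {n m : ℕ} (H : SkewGraph (Fin n) (Fin m)) (f : Fin m → ℤ)

/-- The matrix of the values of `f` on the arcs whose number and that of whose mate are at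
least `j`. -/
def arcMatrix (j : ℕ) : Fin n → Fin n → ℤ := fun a b =>
  ∑ e ∈ Finset.univ.filter fun e : Fin m => j ≤ (e : ℕ) ∧ e < H.mateE e,
    f e * pair (H.tail e) (H.tail (H.mateE e)) a b

theorem arcMatrix_eq_zero (a b : Fin n) : H.arcMatrix f m a b = 0 := by
  unfold arcMatrix
  rw [Finset.filter_false_of_mem, Finset.sum_empty]
  intro e _ h
  have := e.2
  omega

/-- A pair of mated arcs is represented by its member of smaller number. The recursion is read
downwards to build the matrix and upwards to distribute it to the arcs. -/
theorem arcMatrix_of_lt {e : Fin m} (he : e < H.mateE e) :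
    H.arcMatrix f e =
      bump (H.arcMatrix f (e + 1)) (H.tail e) (H.tail (H.mateE e)) (f e) := by
  ext a b
  have : (Finset.univ.filter fun e' : Fin m => (e : ℕ) ≤ (e' : ℕ) ∧ e' < H.mateE e') =
      insert e (Finset.univ.filter fun e' : Fin m => (e : ℕ) + 1 ≤ (e' : ℕ) ∧ e' < H.mateE e') := by
    ext e'
    simp only [Finset.mem_filter, Finset.mem_univ, true_and, Finset.mem_insert]
    constructor
    · rintro ⟨h1, h2⟩
      by_cases h3 : e' = e
      · exact Or.inl h3
      · have : (e' : ℕ) ≠ e := fun h => h3 (Fin.ext h)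
        exact Or.inr ⟨by omega, h2⟩
    · rintro (rfl | ⟨h1, h2⟩)
      · exact ⟨le_rfl, he⟩
      · exact ⟨by omega, h2⟩
  rw [arcMatrix, this, Finset.sum_insert (by simp), bump, arcMatrix]
  ring

theorem arcMatrix_of_not_lt {e : Fin m} (he : ¬ e < H.mateE e) :
    H.arcMatrix f e = H.arcMatrix f (e + 1) := by
  ext a b
  unfold arcMatrix
  congr 1
  ext e'
  simp only [Finset.mem_filter, Finset.mem_univ, true_and]
  refine and_congr_left fun h => ⟨fun h1 => ?_, fun h1 => by omega⟩
  have : (e' : ℕ) ≠ e := by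
    intro h2
    have h3 : e' = e := Fin.ext h2
    exact he (h3 ▸ h)
  omega

variable {f}

/-- Taking mates is an involution without fixed points that preserves `f`, so each pair has exactly
one representative. -/
theorem sum_lt_mateE (hf : H.symm f = f) (g : Fin m → ℤ) :
    ∑ e with e < H.mateE e, f e * (g e + g (H.mateE e)) = ∑ e, f e * g e := by
  have hf' : ∀ e, f (H.mateE e) = f e := fun e => congrFun hf e
  have h1 : ∑ e with e < H.mateE e, f e * g (H.mateE e) = ∑ e with ¬ e < H.mateE e, f e * g e := by
    refine Finset.sum_nbij' H.mateE H.mateE ?_ ?_ ?_ ?_ ?_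
    · intro e he
      simp only [Finset.mem_filter, Finset.mem_univ, true_and, H.mateE_mateE, not_lt] at he ⊢
      exact he.le
    · intro e he
      simp only [Finset.mem_filter, Finset.mem_univ, true_and, H.mateE_mateE, not_lt] at he ⊢
      exact lt_of_le_of_ne he (H.mateE_ne e)
    · intro e _; exact H.mateE_mateE e
    · intro e _; exact H.mateE_mateE e
    · intro e _; rw [hf']
  simp only [mul_add, Finset.sum_add_distrib]
  rw [h1, Finset.sum_filter_add_sum_filter_not]

/-- The row of `p` sums the arcs leaving `p`. The arcs leaving the mate of `p` are the mates of the
arcs entering `p` and carry the same values. -/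
theorem row_arcMatrix (hf : H.symm f = f) (p : Fin n) :
    row (H.arcMatrix f 0) p - row (H.arcMatrix f 0) (H.mateV p) = H.div f p := by
  have hf' : ∀ e, f (H.mateE e) = f e := fun e => congrFun hf e
  have h1 : ∀ p, row (H.arcMatrix f 0) p = ∑ e, f e * if H.tail e = p then 1 else 0 := by
    intro p
    rw [← sum_lt_mateE H hf]
    simp only [row, arcMatrix]
    rw [Finset.sum_comm]
    simp only [← Finset.mul_sum, sum_pair]
    simp [eq_comm]
  rw [h1, h1]
  have h2 : ∑ e, (f e * if H.tail e = H.mateV p then 1 else 0) =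
      ∑ e, f e * if H.head e = p then 1 else 0 := by
    refine Finset.sum_nbij' H.mateE H.mateE (by simp) (by simp) (fun e _ => H.mateE_mateE e)
      (fun e _ => H.mateE_mateE e) ?_
    intro e _
    simp only [hf', H.head_mateE, H.mateV_eq_iff]
  rw [h2]
  simp only [div, mul_ite, mul_one, mul_zero, Finset.sum_filter]

end ArcMatrix

end SkewGraph

/-! ### Machine operations on the matrix, the degrees and the neighbour lists -/

namespace RAM

/-- Execution of programs one after another. -/
def block : List Program → Program
  | [] => .skip
  | P :: l => .seq P (block l)

/-- The expression for the address of the matrix cell given by the registers `x` and `y`, where the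
array `K + 6` holds the positions of the rows. -/
def addr (K x y : ℕ) : Term := .plus (.read (K + 6) (.reg x)) (.reg y)

@[simp] theorem addr_eval (K x y : ℕ) (M : Memory) :
    (addr K x y).eval M = M.arr (K + 6) (M.reg x) + M.reg y := rfl

/-- Increase of a cell of an array. -/
def incr (a : ℕ) (i p : Term) : Program := .write a i (.plus (.read a i) p)

/-- Decrease of a cell of an array. -/
def decr (a : ℕ) (i p : Term) : Program := .write a i (.minus (.read a i) p)

/-- Put the value of the register `y` in front of the list of the node in the register `x`. -/
def push (K x y : ℕ) : Program := block [
  .assign 5 (.plus (.reg 5) (.const 1)),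
  .write (K + 11) (.reg 5) (.reg y),
  .write (K + 12) (.reg 5) (.read (K + 10) (.reg x)),
  .write (K + 10) (.reg x) (.reg 5)]

/-- Add the register 13 to the cells of the matrix given by the registers 11 and 12. -/
def addP (K : ℕ) : Program := block [
  .branch (.eq (.read (K + 8) (addr K 11 12)) (.const 0)) (block [
    incr (K + 9) (.reg 11) (.const 1), incr (K + 9) (.reg 12) (.const 1),
    push K 11 12, push K 12 11]) .skip,
  incr (K + 8) (addr K 11 12) (.reg 13), incr (K + 8) (addr K 12 11) (.reg 13)]

/-- Decrease the degrees of the nodes in the registers 11 and 12 if their cell is zero. -/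
def dropP (K : ℕ) : Program :=
  .branch (.eq (.read (K + 8) (addr K 11 12)) (.const 0)) (block [
    decr (K + 9) (.reg 11) (.const 1), decr (K + 9) (.reg 12) (.const 1)]) .skip

/-- Subtract the register 13 from the cells of the matrix given by the registers 11 and 12. -/
def subP (K : ℕ) : Program := block [
  decr (K + 8) (addr K 11 12) (.reg 13), decr (K + 8) (addr K 12 11) (.reg 13), dropP K]

theorem loopFree_addP (K : ℕ) : LoopFree (addP K) := by
  simp [addP, block, incr, push, LoopFree]

theorem loopFree_subP (K : ℕ) : LoopFree (subP K) := by
  simp [subP, dropP, block, decr, LoopFree]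

@[simp] theorem regs_addP (K : ℕ) : regs (addP K) = {5} := by
  simp [addP, block, incr, push, regs]

@[simp] theorem regs_subP (K : ℕ) : regs (subP K) = ∅ := by
  simp [subP, dropP, block, decr, regs]

theorem mem_arrs_addP {K a : ℕ} (h : a ∈ arrs (addP K)) : K + 8 ≤ a ∧ a ≤ K + 12 := by
  simp [addP, block, incr, push, arrs] at h
  omega

theorem mem_arrs_subP {K a : ℕ} (h : a ∈ arrs (subP K)) : K + 8 ≤ a ∧ a ≤ K + 9 := by
  simp [subP, dropP, block, decr, arrs] at h
  omega

/-- Entry `q` of an array after two additions. -/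
theorem update_add_update_add (g : ℤ → ℤ) (i j δ q : ℤ) :
    Function.update (Function.update g i (g i + δ)) j (Function.update g i (g i + δ) j + δ) q =
      g q + δ * ((if q = i then 1 else 0) + if q = j then 1 else 0) := by
  simp only [Function.update_apply]
  by_cases h1 : q = i <;> by_cases h2 : q = j <;> by_cases h3 : j = i <;> simp_all
  ring

/-- Writing the effect as a sum of indicators covers coinciding addresses: on the diagonal the
amount is added twice, as `pair` demands. -/
theorem addP_arr8 (K : ℕ) (M : Memory) (q : ℤ) :
    (exec (addP K) M).arr (K + 8) q = M.arr (K + 8) q + M.reg 13 *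
      ((if q = M.arr (K + 6) (M.reg 11) + M.reg 12 then 1 else 0) +
        if q = M.arr (K + 6) (M.reg 12) + M.reg 11 then 1 else 0) := by
  rw [← update_add_update_add]
  by_cases h : M.arr (K + 8) (M.arr (K + 6) (M.reg 11) + M.reg 12) = 0
  · simp [addP, block, incr, push, exec, Test.Holds, Term.eval, Memory.setReg, Memory.setArr, h]
  · simp [addP, block, incr, push, exec, Test.Holds, Term.eval, Memory.setArr, h]

theorem addP_arr9 (K : ℕ) (M : Memory) (q : ℤ) :
    (exec (addP K) M).arr (K + 9) q = M.arr (K + 9) q +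
      if M.arr (K + 8) (M.arr (K + 6) (M.reg 11) + M.reg 12) = 0 then
      ((if q = M.reg 11 then 1 else 0) + if q = M.reg 12 then 1 else 0) else 0 := by
  by_cases h : M.arr (K + 8) (M.arr (K + 6) (M.reg 11) + M.reg 12) = 0
  · have := update_add_update_add (M.arr (K + 9)) (M.reg 11) (M.reg 12) 1 q
    rw [if_pos h]
    rw [one_mul] at this
    rw [← this]
    simp [addP, block, incr, push, exec, Test.Holds, Term.eval, Memory.setReg, Memory.setArr, h]
  · simp [addP, block, incr, push, exec, Test.Holds, Term.eval, Memory.setArr, h]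

theorem dropP_arr9 (K : ℕ) (M : Memory) (q : ℤ) :
    (exec (dropP K) M).arr (K + 9) q = M.arr (K + 9) q -
      if M.arr (K + 8) (M.arr (K + 6) (M.reg 11) + M.reg 12) = 0 then
      ((if q = M.reg 11 then 1 else 0) + if q = M.reg 12 then 1 else 0) else 0 := by
  by_cases h : M.arr (K + 8) (M.arr (K + 6) (M.reg 11) + M.reg 12) = 0
  · have := update_add_update_add (M.arr (K + 9)) (M.reg 11) (M.reg 12) (-1) q
    rw [if_pos h, sub_eq_add_neg, ← neg_one_mul, ← this]
    simp [dropP, block, decr, exec, Test.Holds, Term.eval, Memory.setArr, h, sub_eq_add_neg]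
  · simp [dropP, exec, Test.Holds, Term.eval, h]

theorem subP_arr8 (K : ℕ) (M : Memory) (q : ℤ) :
    (exec (subP K) M).arr (K + 8) q = M.arr (K + 8) q + -M.reg 13 *
      ((if q = M.arr (K + 6) (M.reg 11) + M.reg 12 then 1 else 0) +
        if q = M.arr (K + 6) (M.reg 12) + M.reg 11 then 1 else 0) := by
  rw [← update_add_update_add]
  simp only [subP, block, exec]
  rw [exec_arr (by simp [dropP, block, decr, arrs])]
  simp [exec, decr, Term.eval, Memory.setArr, ← sub_eq_add_neg]

/-- Unlike in `addP_arr9`, the cell is tested after the change, since a degree drops when the cell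
has become zero. -/
theorem subP_arr9 (K : ℕ) (M : Memory) (q : ℤ) :
    (exec (subP K) M).arr (K + 9) q = M.arr (K + 9) q -
      if (exec (subP K) M).arr (K + 8) (M.arr (K + 6) (M.reg 11) + M.reg 12) = 0 then
      ((if q = M.reg 11 then 1 else 0) + if q = M.reg 12 then 1 else 0) else 0 := by
  simp only [subP, block, exec]
  rw [dropP_arr9, exec_arr (P := dropP K) (a := K + 8) (by simp [dropP, block, decr, arrs])]
  simp [exec, decr, Term.eval, Memory.setArr]

/-- The linked list of nodes starting in the cell `h`, all of its cells being at most `c`. -/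
def Chain {n : ℕ} (val next : ℤ → ℤ) (c : ℤ) : ℤ → List (Fin n) → Prop
  | h, [] => h = 0
  | h, b :: l => 1 ≤ h ∧ h ≤ c ∧ val h = (b : ℕ) ∧ Chain val next c (next h) l

/-- New list entries take cells above the counter `c`, so existing lists are not disturbed by them.
-/
theorem Chain.congr {n : ℕ} {val next val' next' : ℤ → ℤ} {c c' h : ℤ} {l : List (Fin n)}
    (hl : Chain val next c h l) (hc : c ≤ c') (hv : ∀ z ≤ c, val' z = val z)
    (hn : ∀ z ≤ c, next' z = next z) : Chain val' next' c' h l := by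
  induction l generalizing h with
  | nil => exact hl
  | cons b l ih =>
    obtain ⟨h1, h2, h3, h4⟩ := hl
    refine ⟨h1, h2.trans hc, by rw [hv _ h2, h3], ?_⟩
    rw [hn _ h2]
    exact ih h4

/-- The memory holds linked lists of nodes for the nodes in `U`. -/
structure ListRep {n : ℕ} (K : ℕ) (M : Memory) (U : Finset (Fin n))
    (ℓ : Fin n → List (Fin n)) : Prop where
  chain : ∀ a ∈ U, Chain (M.arr (K + 11)) (M.arr (K + 12)) (M.reg 5) (M.arr (K + 10) (a : ℕ)) (ℓ a)
  count_nonneg : 0 ≤ M.reg 5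
  mem : ∀ a ∈ U, ∀ b ∈ ℓ a, b ∈ U

theorem ListRep.congr {n K : ℕ} {M N : Memory} {U : Finset (Fin n)} {ℓ : Fin n → List (Fin n)}
    (h : ListRep K M U ℓ) (h1 : ∀ a, K + 10 ≤ a → a ≤ K + 12 → N.arr a = M.arr a)
    (h2 : N.reg 5 = M.reg 5) : ListRep K N U ℓ where
  chain a ha := by
    rw [h1 _ (by omega) (by omega), h1 _ (by omega) (by omega), h1 _ (by omega) (by omega), h2]
    exact h.chain a ha
  count_nonneg := by rw [h2]; exact h.count_nonneg
  mem := h.mem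

theorem ListRep.push {n K : ℕ} {M : Memory} {U : Finset (Fin n)} {ℓ : Fin n → List (Fin n)}
    (h : ListRep K M U ℓ) {r s : ℕ} {x y : Fin n} (hr : M.reg r = (x : ℕ)) (hs : M.reg s = (y : ℕ))
    (hr5 : r ≠ 5) (hs5 : s ≠ 5) (hy : y ∈ U) :
    ListRep K (exec (push K r s) M) U (Function.update ℓ x (y :: ℓ x)) := by
  have e5 : (exec (RAM.push K r s) M).reg 5 = M.reg 5 + 1 := by
    simp [RAM.push, block, exec, Term.eval, Memory.setReg, Memory.setArr]
  have e10 : (exec (RAM.push K r s) M).arr (K + 10) =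
      Function.update (M.arr (K + 10)) (x : ℕ) (M.reg 5 + 1) := by
    simp [RAM.push, block, exec, Term.eval, Memory.setReg, Memory.setArr, hr, hr5]
  have e11 : (exec (RAM.push K r s) M).arr (K + 11) =
      Function.update (M.arr (K + 11)) (M.reg 5 + 1) (y : ℕ) := by
    simp [RAM.push, block, exec, Term.eval, Memory.setReg, Memory.setArr, hs, hs5]
  have e12 : (exec (RAM.push K r s) M).arr (K + 12) =
      Function.update (M.arr (K + 12)) (M.reg 5 + 1) (M.arr (K + 10) (x : ℕ)) := by
    simp [RAM.push, block, exec, Term.eval, Memory.setReg, Memory.setArr, hr, hr5]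
  have up : ∀ a ∈ U, Chain (Function.update (M.arr (K + 11)) (M.reg 5 + 1) (y : ℕ))
      (Function.update (M.arr (K + 12)) (M.reg 5 + 1) (M.arr (K + 10) (x : ℕ))) (M.reg 5 + 1)
      (M.arr (K + 10) (a : ℕ)) (ℓ a) := fun a ha =>
    (h.chain a ha).congr (by omega) (fun z hz => Function.update_of_ne (by omega) _ _)
      (fun z hz => Function.update_of_ne (by omega) _ _)
  refine ⟨fun a ha => ?_, by rw [e5]; have := h.count_nonneg; omega, fun a ha b hb => ?_⟩
  · rw [e5, e10, e11, e12]
    by_cases hax : a = x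
    · subst hax
      rw [Function.update_self, Function.update_self]
      refine ⟨by have := h.count_nonneg; omega, le_rfl, by rw [Function.update_self], ?_⟩
      rw [Function.update_self]
      exact up a ha
    · have : ((a : ℕ) : ℤ) ≠ (x : ℕ) := fun e => hax (Fin.ext (by exact_mod_cast e))
      rw [Function.update_of_ne this, Function.update_of_ne hax]
      exact up a ha
  · by_cases hax : a = x
    · subst hax
      rw [Function.update_self] at hb
      rcases List.mem_cons.1 hb with rfl | hb
      · exact hy
      · exact h.mem a ha b hb
    · rw [Function.update_of_ne hax] at hb
      exact h.mem a ha b hb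

/-- Neighbours are recorded only when the cell was zero; a neighbour may occur again if an old entry
is obsolete. What counts is that the total length grows by at most two. -/
theorem ListRep.addP {n K : ℕ} {M : Memory} {U : Finset (Fin n)} {ℓ : Fin n → List (Fin n)}
    (h : ListRep K M U ℓ) {x y : Fin n} (hx : M.reg 11 = (x : ℕ)) (hy : M.reg 12 = (y : ℕ))
    (hxU : x ∈ U) (hyU : y ∈ U) :
    ∃ ℓ', ListRep K (exec (addP K) M) U ℓ' ∧ (∀ a, ℓ a ⊆ ℓ' a) ∧
      (M.arr (K + 8) (M.arr (K + 6) (x : ℕ) + (y : ℕ)) = 0 → y ∈ ℓ' x ∧ x ∈ ℓ' y) ∧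
      ∑ a, (ℓ' a).length ≤ ∑ a, (ℓ a).length + 2 := by
  have hsum : ∀ (ℓ : Fin n → List (Fin n)) (x y : Fin n),
      ∑ a, (Function.update ℓ x (y :: ℓ x) a).length = ∑ a, (ℓ a).length + 1 := by
    intro ℓ x y
    have : ∀ a, (Function.update ℓ x (y :: ℓ x) a).length =
        (ℓ a).length + if a = x then 1 else 0 := by
      intro a
      by_cases h : a = x
      · subst h; simp
      · simp [h]
    simp [this, Finset.sum_add_distrib]
  by_cases h0 : M.arr (K + 8) (M.arr (K + 6) (x : ℕ) + (y : ℕ)) = 0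
  · have e : exec (RAM.addP K) M = exec (block [incr (K + 8) (addr K 11 12) (.reg 13),
        incr (K + 8) (addr K 12 11) (.reg 13)]) (exec (RAM.push K 12 11) (exec (RAM.push K 11 12)
        (exec (block [incr (K + 9) (.reg 11) (.const 1), incr (K + 9) (.reg 12) (.const 1)]) M))) := by
      simp [RAM.addP, block, exec, Test.Holds, Term.eval, hx, hy, h0]
    have h1 : ListRep K (exec (block [incr (K + 9) (.reg 11) (.const 1),
        incr (K + 9) (.reg 12) (.const 1)]) M) U ℓ := by
      refine h.congr (fun a ha _ => exec_arr ?_ _) (exec_reg ?_ _)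
      · simp [block, incr, arrs]; omega
      · simp [block, incr, regs]
    have hreg : ∀ r, (exec (block [incr (K + 9) (.reg 11) (.const 1),
        incr (K + 9) (.reg 12) (.const 1)]) M).reg r = M.reg r := fun r =>
      exec_reg (by simp [block, incr, regs]) _
    have h2 := h1.push (r := 11) (s := 12) (by rw [hreg, hx]) (by rw [hreg, hy]) (by norm_num)
      (by norm_num) hyU
    have hreg' : ∀ N, ∀ r, r ≠ 5 → (exec (RAM.push K 11 12) N).reg r = N.reg r := fun N r hr =>
      exec_reg (by simp [block, RAM.push, regs, hr]) _
    have h3 := h2.push (r := 12) (s := 11) (by rw [hreg' _ _ (by norm_num), hreg, hy])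
      (by rw [hreg' _ _ (by norm_num), hreg, hx]) (by norm_num) (by norm_num) hxU
    have s1 : ∀ a, ℓ a ⊆ Function.update ℓ x (y :: ℓ x) a := by
      intro a b hb
      by_cases hax : a = x
      · subst hax; simp [hb]
      · simpa [hax] using hb
    refine ⟨Function.update (Function.update ℓ x (y :: ℓ x)) y
      (x :: Function.update ℓ x (y :: ℓ x) y), ?_, ?_, fun _ => ⟨?_, by simp⟩, ?_⟩
    · rw [e]
      refine h3.congr (fun a ha _ => exec_arr ?_ _) (exec_reg ?_ _)
      · simp [block, incr, arrs]; omega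
      · simp [block, incr, regs]
    · intro a b hb
      have := s1 a hb
      by_cases hay : a = y
      · subst hay; simp [this]
      · simpa [hay] using this
    · by_cases hxy : x = y
      · subst hxy; simp
      · simp [hxy]
    · rw [hsum, hsum]
  · refine ⟨ℓ, ?_, fun a => List.Subset.refl _, fun h1 => absurd h1 h0, by omega⟩
    have e : exec (RAM.addP K) M = exec (block [incr (K + 8) (addr K 11 12) (.reg 13),
        incr (K + 8) (addr K 12 11) (.reg 13)]) M := by
      simp [RAM.addP, block, exec, Test.Holds, Term.eval, hx, hy, h0]
    rw [e]
    refine h.congr (fun a ha _ => exec_arr ?_ _) (exec_reg ?_ _)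
    · simp [block, incr, arrs]; omega
    · simp [block, incr, regs]

end RAM

/-! ### The matrix in memory and one splitting operation on the machine -/

namespace RAM

open SymMatrix

variable {n : ℕ}

/-- Rows of the matrix that belong to nodes of `U` do not overlap. -/
def Disjoint (U : Finset (Fin n)) (off : Fin n → ℤ) : Prop :=
  ∀ a ∈ U, ∀ b ∈ U, ∀ x y : Fin n,
    off a + ((x : ℕ) : ℤ) = off b + ((y : ℕ) : ℤ) → a = b ∧ x = y

theorem Fin.cast_eq_iff (x y : Fin n) : (((x : ℕ) : ℤ) = ((y : ℕ) : ℤ)) ↔ x = y := by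
  rw [Nat.cast_inj, Fin.ext_iff]

/-- The memory holds the matrix `A`, the degrees of the nodes and lists `ℓ` of their neighbours. -/
structure GraphRep (K : ℕ) (M : Memory) (U : Finset (Fin n)) (off : Fin n → ℤ)
    (A : Fin n → Fin n → ℤ) (ℓ : Fin n → List (Fin n)) : Prop where
  off_eq : ∀ a ∈ U, M.arr (K + 6) (a : ℕ) = off a
  mat : ∀ a ∈ U, ∀ b ∈ U, M.arr (K + 8) (off a + (b : ℕ)) = A a b
  deg_eq : ∀ a ∈ U, M.arr (K + 9) (a : ℕ) = deg A a
  lists : ListRep K M U ℓ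
  cover : ∀ a b, A a b ≠ 0 → b ∈ ℓ a

variable {K : ℕ} {M N : Memory} {U : Finset (Fin n)} {off : Fin n → ℤ} {A : Fin n → Fin n → ℤ}
  {ℓ : Fin n → List (Fin n)}

theorem GraphRep.congr (h : GraphRep K M U off A ℓ)
    (h1 : ∀ a, K + 6 ≤ a → a ≤ K + 12 → a ≠ K + 7 → N.arr a = M.arr a)
    (h2 : N.reg 5 = M.reg 5) : GraphRep K N U off A ℓ where
  off_eq := by rw [h1 _ (by omega) (by omega) (by omega)]; exact h.off_eq
  mat := by rw [h1 _ (by omega) (by omega) (by omega)]; exact h.mat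
  deg_eq := by rw [h1 _ (by omega) (by omega) (by omega)]; exact h.deg_eq
  lists := h.lists.congr (fun a h3 h4 => h1 a (by omega) (by omega) (by omega)) h2
  cover := h.cover

theorem Disjoint.sum_eq_pair (hd : Disjoint U off) {a x y : Fin n} (b : Fin n) (ha : a ∈ U)
    (hx : x ∈ U) (hy : y ∈ U) :
    (((if off a + ((b : ℕ) : ℤ) = off x + (y : ℕ) then 1 else 0) +
      if off a + ((b : ℕ) : ℤ) = off y + (x : ℕ) then 1 else 0) : ℤ) = pair x y a b := by
  have key : ∀ x ∈ U, ∀ y : Fin n, off a + ((b : ℕ) : ℤ) = off x + (y : ℕ) ↔ a = x ∧ b = y :=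
    fun x hx y => ⟨hd a ha x hx b y, by rintro ⟨rfl, rfl⟩; rfl⟩
  simp only [pair, cell, key x hx, key y hy]

theorem GraphRep.addP {mate : Fin n → Fin n} (h : GraphRep K M U off A ℓ)
    (hA : IsWeight mate U A) (hd : Disjoint U off)
    {x y : Fin n} {δ : ℤ} (hx : M.reg 11 = (x : ℕ)) (hy : M.reg 12 = (y : ℕ)) (hδ : M.reg 13 = δ)
    (hxU : x ∈ U) (hyU : y ∈ U) (h0 : 0 < δ) :
    ∃ ℓ', GraphRep K (exec (addP K) M) U off (bump A x y δ) ℓ' ∧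
      ∑ a, (ℓ' a).length ≤ ∑ a, (ℓ a).length + 2 := by
  obtain ⟨ℓ', h1, h2, h3, h4⟩ := h.lists.addP hx hy hxU hyU
  have hA0 : M.arr (K + 8) (M.arr (K + 6) (x : ℕ) + (y : ℕ)) = A x y := by
    rw [h.off_eq x hxU, h.mat x hxU y hyU]
  rw [hA0] at h3
  refine ⟨ℓ', ⟨fun a ha => ?_, fun a ha b hb => ?_, fun a ha => ?_, h1, fun a b hab => ?_⟩, h4⟩
  · rw [exec_arr (fun h => by have := mem_arrs_addP h; omega)]; exact h.off_eq a ha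
  · rw [addP_arr8, hx, hy, hδ, h.off_eq x hxU, h.off_eq y hyU, h.mat a ha b hb,
      hd.sum_eq_pair b ha hxU hyU]
    rfl
  · rw [addP_arr9, hx, hy, hA0, h.deg_eq a ha, deg_bump hA.nonneg hA.symm h0]
    simp only [Fin.cast_eq_iff]
  · by_cases hab0 : A a b = 0
    · by_cases e1 : a = x ∧ b = y
      · obtain ⟨rfl, rfl⟩ := e1; exact (h3 hab0).1
      · by_cases e2 : a = y ∧ b = x
        · obtain ⟨rfl, rfl⟩ := e2; rw [hA.symm] at hab0; exact (h3 hab0).2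
        · exact absurd (by rw [bump, pair_eq_zero e1 e2, hab0]; ring) hab
    · exact h2 a (h.cover a b hab0)

/-- The lists are left alone: `cover` asks only that they contain all neighbours, so entries made
obsolete by a subtraction may stay until they are met. -/
theorem GraphRep.subP {mate : Fin n → Fin n} (h : GraphRep K M U off A ℓ)
    (hd : Disjoint U off)
    {x y : Fin n} {δ : ℤ} (hx : M.reg 11 = (x : ℕ)) (hy : M.reg 12 = (y : ℕ)) (hδ : M.reg 13 = δ)
    (hxU : x ∈ U) (hyU : y ∈ U) (h0 : 0 < δ) (hA : IsWeight mate U (bump A x y (-δ))) :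
    GraphRep K (exec (subP K) M) U off (bump A x y (-δ)) ℓ := by
  have hm : ∀ a ∈ U, ∀ b ∈ U,
      (exec (RAM.subP K) M).arr (K + 8) (off a + (b : ℕ)) = bump A x y (-δ) a b := by
    intro a ha b hb
    rw [subP_arr8, hx, hy, hδ, h.off_eq x hxU, h.off_eq y hyU, h.mat a ha b hb,
      hd.sum_eq_pair b ha hxU hyU]
    rfl
  refine ⟨fun a ha => ?_, hm, fun a ha => ?_, ?_, fun a b hab => ?_⟩
  · rw [exec_arr (fun h => by have := mem_arrs_subP h; omega)]; exact h.off_eq a ha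
  · have h1 := deg_bump hA.nonneg hA.symm h0 a (a := x) (b := y)
    rw [bump_neg_bump] at h1
    rw [subP_arr9, hx, hy, h.off_eq x hxU, hm x hxU y hyU, h.deg_eq a ha, h1]
    simp only [Fin.cast_eq_iff]
    ring
  · refine h.lists.congr (fun a h1 h2 => exec_arr (fun h => ?_) _) (exec_reg (by simp) _)
    have := mem_arrs_subP h; omega
  · refine h.cover a b fun h1 => hab ?_
    have h2 := hA.nonneg a b
    have h3 := mul_nonneg h0.le (pair_nonneg x y a b)
    rw [bump] at h2 ⊢
    linarith

/-- `addP` for the nodes in the registers `r` and `s`. -/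
def addAt (K r s : ℕ) : Program :=
  block [.assign 11 (.reg r), .assign 12 (.reg s), addP K]

/-- `subP` for the nodes in the registers `r` and `s`. -/
def subAt (K r s : ℕ) : Program :=
  block [.assign 11 (.reg r), .assign 12 (.reg s), subP K]

theorem exec_addAt (K r s : ℕ) (M : Memory) :
    exec (addAt K r s) M = exec (addP K) (exec (block [.assign 11 (.reg r), .assign 12 (.reg s)]) M) :=
  rfl

theorem exec_subAt (K r s : ℕ) (M : Memory) :
    exec (subAt K r s) M = exec (subP K) (exec (block [.assign 11 (.reg r), .assign 12 (.reg s)]) M) :=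
  rfl

theorem GraphRep.addAt {mate : Fin n → Fin n} (h : GraphRep K M U off A ℓ)
    (hA : IsWeight mate U A) (hd : Disjoint U off)
    {x y : Fin n} {δ : ℤ} {r s : ℕ} (hs11 : s ≠ 11) (hx : M.reg r = (x : ℕ))
    (hy : M.reg s = (y : ℕ)) (hδ : M.reg 13 = δ) (hxU : x ∈ U) (hyU : y ∈ U) (h0 : 0 < δ) :
    ∃ ℓ', GraphRep K (exec (addAt K r s) M) U off (bump A x y δ) ℓ' ∧
      ∑ a, (ℓ' a).length ≤ ∑ a, (ℓ a).length + 2 := by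
  rw [exec_addAt]
  have h1 : GraphRep K (exec (block [.assign 11 (.reg r), .assign 12 (.reg s)]) M) U off A ℓ :=
    h.congr (fun a _ _ _ => rfl) (exec_reg (by simp [block, regs]) _)
  exact h1.addP hA hd (by simp [block, exec, Memory.setReg, Term.eval, hx])
    (by simp [block, exec, Memory.setReg, Term.eval, hs11, hy])
    (by rw [← hδ]; exact exec_reg (by simp [block, regs]) _) hxU hyU h0

theorem GraphRep.subAt {mate : Fin n → Fin n} (h : GraphRep K M U off A ℓ)
    (hd : Disjoint U off)
    {x y : Fin n} {δ : ℤ} {r s : ℕ} (hs11 : s ≠ 11) (hx : M.reg r = (x : ℕ))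
    (hy : M.reg s = (y : ℕ)) (hδ : M.reg 13 = δ) (hxU : x ∈ U) (hyU : y ∈ U) (h0 : 0 < δ)
    (hA : IsWeight mate U (bump A x y (-δ))) :
    GraphRep K (exec (subAt K r s) M) U off (bump A x y (-δ)) ℓ := by
  rw [exec_subAt]
  have h1 : GraphRep K (exec (block [.assign 11 (.reg r), .assign 12 (.reg s)]) M) U off A ℓ :=
    h.congr (fun a _ _ _ => rfl) (exec_reg (by simp [block, regs]) _)
  exact h1.subP hd (by simp [block, exec, Memory.setReg, Term.eval, hx])
    (by simp [block, exec, Memory.setReg, Term.eval, hs11, hy])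
    (by rw [← hδ]; exact exec_reg (by simp [block, regs]) _) hxU hyU h0 hA

@[simp] theorem regs_addAt (K r s : ℕ) : regs (addAt K r s) = {5, 11, 12} := by
  ext; simp [addAt, block, regs]; tauto

@[simp] theorem regs_subAt (K r s : ℕ) : regs (subAt K r s) = {11, 12} := by
  ext; simp [subAt, block, regs, or_comm]

theorem mem_arrs_addAt {K r s a : ℕ} (h : a ∈ arrs (addAt K r s)) : K + 8 ≤ a ∧ a ≤ K + 12 := by
  simp only [addAt, block, arrs, Set.mem_union, Set.mem_empty_iff_false, false_or, or_false] at h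
  exact mem_arrs_addP h

theorem mem_arrs_subAt {K r s a : ℕ} (h : a ∈ arrs (subAt K r s)) : K + 8 ≤ a ∧ a ≤ K + 9 := by
  simp only [subAt, block, arrs, Set.mem_union, Set.mem_empty_iff_false, false_or, or_false] at h
  exact mem_arrs_subP h

/-- Put the slack for splitting off at the nodes in the registers 14 to 17 into the register 13. -/
def slackP (K : ℕ) : Program := block [
  .assign 13 (.read (K + 8) (addr K 14 16)),
  .branch (.eq (.reg 14) (.reg 16)) (.assign 13 (.half (.reg 13))) .skip,
  .assign 18 (.read (K + 8) (addr K 15 17)),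
  .branch (.eq (.reg 15) (.reg 17)) (.assign 18 (.half (.reg 18))) .skip,
  .branch (.le (.reg 18) (.reg 13)) (.assign 13 (.reg 18)) .skip]

/-- Make a record of the splitting operation. -/
def recordP (K : ℕ) : Program := block [
  .write (K + 14) (.reg 9) (.reg 14), .write (K + 15) (.reg 9) (.reg 16),
  .write (K + 16) (.reg 9) (.reg 17), .write (K + 17) (.reg 9) (.reg 13),
  .assign 9 (.plus (.reg 9) (.const 1))]

/-- Put the nodes in the registers 16 and 17 on the stack. -/
def stackP (K : ℕ) : Program := block [
  .write (K + 13) (.reg 6) (.reg 16), .assign 6 (.plus (.reg 6) (.const 1)),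
  .write (K + 13) (.reg 6) (.reg 17), .assign 6 (.plus (.reg 6) (.const 1))]

/-- The changes of the graph in a splitting operation. -/
def splitP (K : ℕ) : Program := block [
  subAt K 14 16, subAt K 15 17,
  .branch (.eq (.reg 16) (.read 3 (.reg 17))) .skip (addAt K 16 17)]

/-- Splitting off at the nodes in the registers 14 to 17. -/
def stepP (K : ℕ) : Program := block [slackP K, recordP K, splitP K, stackP K]

theorem loopFree_stepP (K : ℕ) : LoopFree (stepP K) := by
  simp [stepP, slackP, recordP, splitP, stackP, block, LoopFree, addAt, subAt, loopFree_addP,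
    loopFree_subP]

theorem regs_stepP {K r : ℕ} (h : r ∈ regs (stepP K)) :
    r = 5 ∨ r = 6 ∨ r = 9 ∨ r = 11 ∨ r = 12 ∨ r = 13 ∨ r = 18 := by
  simp [stepP, slackP, recordP, splitP, stackP, block, regs] at h
  omega

theorem arrs_stepP {K a : ℕ} (h : a ∈ arrs (stepP K)) : K + 8 ≤ a ∧ a ≤ K + 17 := by
  simp only [stepP, slackP, recordP, splitP, stackP, block, arrs, Set.mem_union,
    Set.mem_empty_iff_false, false_or, or_false, Set.mem_singleton_iff] at h
  rcases h with h | (h | h | h) | h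
  · omega
  · have := mem_arrs_subAt h; omega
  · have := mem_arrs_subAt h; omega
  · have := mem_arrs_addAt h; omega
  · omega

theorem slackP_reg (K : ℕ) (M : Memory) :
    (exec (slackP K) M).reg 13 = min
      (if M.reg 14 = M.reg 16 then M.arr (K + 8) (M.arr (K + 6) (M.reg 14) + M.reg 16) / 2
        else M.arr (K + 8) (M.arr (K + 6) (M.reg 14) + M.reg 16))
      (if M.reg 15 = M.reg 17 then M.arr (K + 8) (M.arr (K + 6) (M.reg 15) + M.reg 17) / 2
        else M.arr (K + 8) (M.arr (K + 6) (M.reg 15) + M.reg 17)) := by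
  simp only [slackP, block, exec, Test.Holds, Term.eval, addr_eval, Memory.setReg]
  by_cases h1 : M.reg 14 = M.reg 16 <;> by_cases h2 : M.reg 15 = M.reg 17 <;>
    simp [h1, h2] <;> split_ifs <;> simp [min_def] <;> omega

/-- The memory holds the records of the splitting operations. -/
def LogRep (K : ℕ) (M : Memory) : List (Record (Fin n)) → Prop
  | [] => True
  | r :: l => M.arr (K + 14) l.length = (r.v : ℕ) ∧ M.arr (K + 15) l.length = (r.a : ℕ) ∧
      M.arr (K + 16) l.length = (r.b : ℕ) ∧ M.arr (K + 17) l.length = r.amount ∧ LogRep K M l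

theorem LogRep.congr {l : List (Record (Fin n))} (h : LogRep K M l)
    (hN : ∀ a, K + 14 ≤ a → a ≤ K + 17 → ∀ z : ℤ, z < l.length → N.arr a z = M.arr a z) :
    LogRep K N l := by
  induction l with
  | nil => trivial
  | cons r l ih =>
    obtain ⟨h1, h2, h3, h4, h5⟩ := h
    have hlt : ((l.length : ℕ) : ℤ) < ((r :: l).length : ℕ) := by simp
    refine ⟨?_, ?_, ?_, ?_, ih h5 fun a ha1 ha2 z hz => hN a ha1 ha2 z (by omega)⟩
    · rw [hN _ (by omega) (by omega) _ hlt, h1]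
    · rw [hN _ (by omega) (by omega) _ hlt, h2]
    · rw [hN _ (by omega) (by omega) _ hlt, h3]
    · rw [hN _ (by omega) (by omega) _ hlt, h4]

/-- The slack is computed before any cell changes, and the register 13 keeps it through both
subtractions and the addition. The intermediate matrices are weights by `splitOff_aux`, as the
single updates require. -/
theorem GraphRep.stepP {mate : Fin n → Fin n} (h : GraphRep K M U off A ℓ)
    (hA : IsWeight mate U A) (hd : Disjoint U off)
    (hne : ∀ x, mate x ≠ x) (hU : ∀ x ∈ U, mate x ∈ U)
    (hmate : ∀ x : Fin n, M.arr 3 (x : ℕ) = (mate x : ℕ))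
    {v a b : Fin n} (hv : M.reg 14 = (v : ℕ)) (hv' : M.reg 15 = (mate v : ℕ))
    (ha : M.reg 16 = (a : ℕ)) (hb : M.reg 17 = (b : ℕ)) (hva : A v a ≠ 0)
    (hvb : A (mate v) b ≠ 0) {l : List (Record (Fin n))} (hl : LogRep K M l)
    (hlen : M.reg 9 = l.length) :
    (∃ ℓ', GraphRep K (exec (stepP K) M) U off (splitOff mate A v a b (slack mate A v a b)) ℓ' ∧
      ∑ a, (ℓ' a).length ≤ ∑ a, (ℓ a).length + 2) ∧
    (LogRep K (exec (stepP K) M) (⟨v, a, b, slack mate A v a b⟩ :: l) ∧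
      (exec (stepP K) M).reg 9 = l.length + 1) ∧
    ((exec (stepP K) M).reg 6 = M.reg 6 + 2 ∧
      (exec (stepP K) M).arr (K + 13) = Function.update
        (Function.update (M.arr (K + 13)) (M.reg 6) (a : ℕ)) (M.reg 6 + 1) (b : ℕ)) := by
  have vU := hA.mem _ _ hva
  have aU := hA.mem_right hva
  have bU := hA.mem_right hvb
  have vU' := hU v vU
  have hs := hA.slack_pos hva hvb
  set s := slack mate A v a b with hsdef
  have e : exec (RAM.stepP K) M =
    exec (stackP K) (exec (splitP K) (exec (recordP K) (exec (slackP K) M))) := rfl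
  rw [e]
  have hs1 : (exec (slackP K) M).reg 13 = s := by
    rw [slackP_reg, hv, hv', ha, hb, h.off_eq v vU, h.off_eq _ vU', h.mat v vU a aU,
      h.mat _ vU' b bU]
    simp only [Fin.cast_eq_iff]
    rfl
  have r1 : ∀ r, r ≠ 13 → r ≠ 18 → (exec (slackP K) M).reg r = M.reg r := fun r h1 h2 =>
    exec_reg (by simp [slackP, block, regs, h1, h2]) _
  have a1 : ∀ r, (exec (slackP K) M).arr r = M.arr r := fun r =>
    exec_arr (by simp [slackP, block, arrs]) _
  set M1 := exec (slackP K) M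
  have r2 : ∀ r, r ≠ 9 → (exec (recordP K) M1).reg r = M1.reg r := fun r h1 =>
    exec_reg (by simp [recordP, block, regs, h1]) _
  have a2 : ∀ r, r < K + 14 → (exec (recordP K) M1).arr r = M1.arr r := fun r h1 =>
    exec_arr (by simp [recordP, block, arrs]; omega) _
  have w9 : (exec (recordP K) M1).reg 9 = l.length + 1 := by
    simp [recordP, block, exec, Memory.setReg, Memory.setArr, Term.eval, r1, hlen]
  have w14 : (exec (recordP K) M1).arr (K + 14) =
      Function.update (M.arr (K + 14)) l.length (v : ℕ) := by
    simp [recordP, block, exec, Memory.setReg, Memory.setArr, Term.eval, r1, hlen, a1, hv]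
  have w15 : (exec (recordP K) M1).arr (K + 15) =
      Function.update (M.arr (K + 15)) l.length (a : ℕ) := by
    simp [recordP, block, exec, Memory.setReg, Memory.setArr, Term.eval, r1, hlen, a1, ha]
  have w16 : (exec (recordP K) M1).arr (K + 16) =
      Function.update (M.arr (K + 16)) l.length (b : ℕ) := by
    simp [recordP, block, exec, Memory.setReg, Memory.setArr, Term.eval, r1, hlen, a1, hb]
  have w17 : (exec (recordP K) M1).arr (K + 17) = Function.update (M.arr (K + 17)) l.length s := by
    simp [recordP, block, exec, Memory.setReg, Memory.setArr, Term.eval, r1, hlen, a1, hs1]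
  set M2 := exec (recordP K) M1
  have g2 : GraphRep K M2 U off A ℓ := h.congr
    (fun a _ h2 _ => by rw [a2 _ (by omega), a1])
    (by rw [r2 _ (by norm_num), r1 _ (by norm_num) (by norm_num)])
  have rr : ∀ r, r ≠ 9 → r ≠ 13 → r ≠ 18 → M2.reg r = M.reg r := fun r h1 h2 h3 => by
    rw [r2 _ h1, r1 _ h2 h3]
  have hs2 : M2.reg 13 = s := by rw [r2 _ (by norm_num), hs1]
  obtain ⟨i1, i2⟩ := hA.splitOff_aux hne hva hvb
  have g3 := g2.subAt hd (r := 14) (s := 16) (by norm_num)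
    (by rw [rr _ (by norm_num) (by norm_num) (by norm_num), hv])
    (by rw [rr _ (by norm_num) (by norm_num) (by norm_num), ha]) hs2 vU aU hs i1
  have r3 : ∀ N : Memory, ∀ r s r' : ℕ, r' ≠ 11 → r' ≠ 12 → (exec (RAM.subAt K r s) N).reg r' =
      N.reg r' := fun N r s r' h1 h2 => exec_reg (by simp [h1, h2]) _
  have g4 := g3.subAt hd (r := 15) (s := 17) (by norm_num)
    (by rw [r3 _ _ _ _ (by norm_num) (by norm_num),
        rr _ (by norm_num) (by norm_num) (by norm_num), hv'])
    (by rw [r3 _ _ _ _ (by norm_num) (by norm_num),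
        rr _ (by norm_num) (by norm_num) (by norm_num), hb])
    (by rw [r3 _ _ _ _ (by norm_num) (by norm_num), hs2]) vU' bU hs i2
  have a3 : ∀ N : Memory, ∀ r s r' : ℕ, r' < K + 8 ∨ K + 9 < r' → (exec (RAM.subAt K r s) N).arr r' =
      N.arr r' := fun N r s r' h1 => exec_arr (fun h => by have := mem_arrs_subAt h; omega) _
  have g5 : ∃ ℓ', GraphRep K (exec (splitP K) M2) U off (splitOff mate A v a b s) ℓ' ∧
      ∑ a, (ℓ' a).length ≤ ∑ a, (ℓ a).length + 2 := by
    have e : exec (splitP K) M2 = exec (.branch (.eq (.reg 16) (.read 3 (.reg 17))) .skip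
      (RAM.addAt K 16 17)) (exec (RAM.subAt K 15 17) (exec (RAM.subAt K 14 16) M2)) := rfl
    rw [e]
    set M4 := exec (RAM.subAt K 15 17) (exec (RAM.subAt K 14 16) M2) with hM4
    have q : ∀ r, r ≠ 9 → r ≠ 13 → r ≠ 18 → r ≠ 11 → r ≠ 12 → M4.reg r = M.reg r := by
      intro r h1 h2 h3 h4 h5
      rw [hM4, r3 _ _ _ _ h4 h5, r3 _ _ _ _ h4 h5, rr _ h1 h2 h3]
    have q3 : M4.arr 3 (b : ℕ) = (mate b : ℕ) := by
      rw [hM4, a3 _ _ _ _ (by omega), a3 _ _ _ _ (by omega), a2 _ (by omega), a1, hmate]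
    have q16 := q 16 (by norm_num) (by norm_num) (by norm_num) (by norm_num) (by norm_num)
    have q17 := q 17 (by norm_num) (by norm_num) (by norm_num) (by norm_num) (by norm_num)
    rw [ha] at q16
    rw [hb] at q17
    have q13 : M4.reg 13 = s := by
      rw [hM4, r3 _ _ _ _ (by norm_num) (by norm_num), r3 _ _ _ _ (by norm_num) (by norm_num), hs2]
    simp only [exec, Test.Holds, Term.eval, q16, q17, q3, Fin.cast_eq_iff]
    by_cases hab : a = mate b
    · rw [if_pos hab, splitOff, if_pos hab]
      exact ⟨ℓ, g4, by omega⟩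
    · rw [if_neg hab, splitOff, if_neg hab]
      exact g4.addAt i2 hd (by norm_num) q16 q17 q13 aU bU hs
  have r5 : ∀ r, r ≠ 5 → r ≠ 11 → r ≠ 12 → (exec (splitP K) M2).reg r = M2.reg r :=
    fun r h1 h2 h3 => exec_reg (by simp [splitP, block, regs, h1, h2, h3]) _
  have a5 : ∀ r, r < K + 8 ∨ K + 12 < r → (exec (splitP K) M2).arr r = M2.arr r := by
    refine fun r h1 => exec_arr (fun h => ?_) _
    simp only [splitP, block, arrs, Set.mem_union, Set.mem_empty_iff_false, false_or,
      or_false] at h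
    rcases h with h | h | h
    · have := mem_arrs_subAt h; omega
    · have := mem_arrs_subAt h; omega
    · have := mem_arrs_addAt h; omega
  set M5 := exec (splitP K) M2
  have r6 : ∀ r, r ≠ 6 → (exec (stackP K) M5).reg r = M5.reg r :=
    fun r h1 => exec_reg (by simp [stackP, block, regs, h1]) _
  have a6 : ∀ r, r ≠ K + 13 → (exec (stackP K) M5).arr r = M5.arr r :=
    fun r h1 => exec_arr (by simp [stackP, block, arrs, h1]) _
  have z6 : M5.reg 6 = M.reg 6 := by
    rw [r5 _ (by norm_num) (by norm_num) (by norm_num), rr _ (by norm_num) (by norm_num)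
      (by norm_num)]
  refine ⟨?_, ⟨⟨?_, ?_, ?_, ?_, ?_⟩, ?_⟩, ?_, ?_⟩
  · obtain ⟨ℓ', h1, h2⟩ := g5
    exact ⟨ℓ', h1.congr (fun a _ h4 _ => a6 a (by omega)) (r6 _ (by norm_num)), h2⟩
  · rw [a6 _ (by omega), a5 _ (by omega), w14, Function.update_self]
  · rw [a6 _ (by omega), a5 _ (by omega), w15, Function.update_self]
  · rw [a6 _ (by omega), a5 _ (by omega), w16, Function.update_self]
  · rw [a6 _ (by omega), a5 _ (by omega), w17, Function.update_self]
  · refine hl.congr fun a h1 h2 z hz => ?_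
    rw [a6 _ (by omega), a5 _ (by omega)]
    obtain rfl | rfl | rfl | rfl : a = K + 14 ∨ a = K + 15 ∨ a = K + 16 ∨ a = K + 17 := by omega
    · rw [w14, Function.update_of_ne hz.ne]
    · rw [w15, Function.update_of_ne hz.ne]
    · rw [w16, Function.update_of_ne hz.ne]
    · rw [w17, Function.update_of_ne hz.ne]
  · rw [r6 _ (by norm_num), r5 _ (by norm_num) (by norm_num) (by norm_num), w9]
  · simp [stackP, block, exec, Memory.setReg, Memory.setArr, Term.eval, z6]
    ring
  · have y16 : M5.reg 16 = (a : ℕ) := by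
      rw [r5 _ (by norm_num) (by norm_num) (by norm_num), rr _ (by norm_num) (by norm_num)
        (by norm_num), ha]
    have y17 : M5.reg 17 = (b : ℕ) := by
      rw [r5 _ (by norm_num) (by norm_num) (by norm_num), rr _ (by norm_num) (by norm_num)
        (by norm_num), hb]
    have y13 : M5.arr (K + 13) = M.arr (K + 13) := by
      rw [a5 _ (by omega), a2 _ (by omega), a1]
    simp [stackP, block, exec, Memory.setReg, Memory.setArr, Term.eval, z6, y16, y17, y13]

end RAM

/-! ### The state of the elimination and its single steps -/

namespace SymMatrix

theorem Reduces.row_sub {V : Type*} [DecidableEq V] [Fintype V] {mate : V → V} {U : Finset V}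
    {A B : V → V → ℤ} {l : List (Record V)} (hm : ∀ x, mate (mate x) = x)
    (h : Reduces mate U A l B) (p : V) : row B p - row B (mate p) = row A p - row A (mate p) := by
  induction h with
  | nil => rfl
  | cons _ _ _ _ _ _ _ ih => rw [row_splitOff hm, ih]

end SymMatrix

namespace RAM

open SymMatrix

/-- A graph with terminals and a symmetric flow, a set `U` of nodes containing the terminals and the
ends of all arcs, and positions for the rows of a matrix belonging to the nodes of `U`. -/
structure Setup (n m k : ℕ) where
  G : SkewGraph (Fin n) (Fin m)
  s : Fin k → Fin n
  f : Fin m → ℤ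
  terminals : G.IsTerminals s
  flow : G.IsSymmFlow s f
  U : Finset (Fin n)
  off : Fin n → ℤ
  mate_mem : ∀ x ∈ U, G.mateV x ∈ U
  tail_mem : ∀ e, G.tail e ∈ U
  terminal_mem : ∀ i, s i ∈ U
  disjoint : Disjoint U off
  le_off : ∀ u ∈ U, (m : ℤ) ≤ off u
  card_le : U.card ≤ 2 * m + 2 * k

variable {n m k : ℕ} (Γ : Setup n m k) (K : ℕ)

/-- The matrix at the beginning. -/
def Setup.matrix : Fin n → Fin n → ℤ := Γ.G.arcMatrix Γ.f 0

/-- Only mates of terminals can have negative divergency. -/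
theorem Setup.div_nonneg {v : Fin n} (h : ∀ i, Γ.G.mateV v ≠ Γ.s i) : 0 ≤ Γ.G.div Γ.f v := by
  by_cases h1 : ∃ i, v = Γ.s i
  · obtain ⟨i, rfl⟩ := h1
    exact Γ.flow.div_source i
  · push Not at h1
    refine (Γ.flow.div_inner v h1 fun i e => h i ?_).ge
    rw [e, Γ.G.mateV_mateV]

/-- A node waiting on the stack or in the rest of the queue. -/
def Pending (M : Memory) (u : Fin n) : Prop :=
  (∃ i : ℤ, 0 ≤ i ∧ i < M.reg 6 ∧ M.arr (K + 13) i = (u : ℕ)) ∨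
  (∃ i : ℤ, M.reg 7 ≤ i ∧ i < M.reg 3 ∧ M.arr (K + 7) i = (u : ℕ))

/-- The part of the memory that is fixed after the initialization. -/
structure Fixed (M : Memory) : Prop where
  input_eq : ∀ a < 6, M.arr a = (input Γ.G Γ.s Γ.f).arr a
  off_eq : ∀ u ∈ Γ.U, M.arr (K + 6) (u : ℕ) = Γ.off u
  reg_one : M.reg 1 = m
  reg_three : M.reg 3 = Γ.U.card
  queue_mem : ∀ i : ℤ, 0 ≤ i → i < Γ.U.card → ∃ u ∈ Γ.U, M.arr (K + 7) i = (u : ℕ)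
  mem_queue : ∀ u ∈ Γ.U, ∃ i : ℤ, 0 ≤ i ∧ i < Γ.U.card ∧ M.arr (K + 7) i = (u : ℕ)

variable {Γ K}

theorem Fixed.congr {M N : Memory} (h : Fixed Γ K M) (h1 : N.reg 1 = M.reg 1)
    (h3 : N.reg 3 = M.reg 3) (ha : ∀ a, a < 6 ∨ a = K + 6 ∨ a = K + 7 → N.arr a = M.arr a) :
    Fixed Γ K N where
  input_eq a h := by rw [ha a (Or.inl h)]; exact Fixed.input_eq ‹_› a h
  off_eq := by rw [ha _ (by omega)]; exact h.off_eq
  reg_one := by rw [h1]; exact h.reg_one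
  reg_three := by rw [h3]; exact h.reg_three
  queue_mem := by rw [ha _ (by omega)]; exact h.queue_mem
  mem_queue := by rw [ha _ (by omega)]; exact h.mem_queue

theorem Fixed.mate_eq {M : Memory} (h : Fixed Γ K M) (x : Fin n) :
    M.arr 3 (x : ℕ) = (Γ.G.mateV x : ℕ) := by
  rw [h.input_eq 3 (by norm_num)]
  exact table_apply _ x

variable (Γ K)

/-- The state of the elimination, where the nodes in `T` are still present, the nodes in `R` are
just being eliminated, and the nodes in `P` need not be pending. -/
structure Core (M : Memory) (A : Fin n → Fin n → ℤ) (ℓ : Fin n → List (Fin n))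
    (l : List (Record (Fin n))) (T R P : Finset (Fin n)) : Prop where
  fixed : Fixed Γ K M
  graph : GraphRep K M Γ.U Γ.off A ℓ
  weight : IsWeight Γ.G.mateV Γ.U A
  reduces : Reduces Γ.G.mateV Γ.U Γ.matrix l A
  log : LogRep K M l
  log_length : M.reg 9 = l.length
  subset : T ⊆ Γ.U
  mate_mem : ∀ u ∈ T, Γ.G.mateV u ∈ T
  done : ∀ u ∈ Γ.U, M.arr (K + 18) (u : ℕ) = if u ∈ T then 0 else 1
  count : M.reg 4 = T.card
  zero : ∀ u, u ∉ T → u ∉ R → (∀ i, u ≠ Γ.s i) → ∀ y, A u y = 0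
  size_le : size A ≤ 2 * m
  top_nonneg : 0 ≤ M.reg 6
  stack : ∀ i : ℤ, 0 ≤ i → i < M.reg 6 → ∃ u ∈ Γ.U, M.arr (K + 13) i = (u : ℕ)
  cursor : 0 ≤ M.reg 7 ∧ M.reg 7 ≤ Γ.U.card
  pending : ∀ u ∈ T, u ∉ P → deg A u + deg A (Γ.G.mateV u) ≤ M.reg 8 →
    Pending K M u ∨ Pending K M (Γ.G.mateV u)

variable {Γ K} {M N : Memory} {A : Fin n → Fin n → ℤ} {ℓ : Fin n → List (Fin n)}
  {l : List (Record (Fin n))} {T R P : Finset (Fin n)}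

/-- The registers below 10 hold the state of the elimination; the others are scratch. -/
theorem Core.congr (h : Core Γ K M A ℓ l T R P) (hr : ∀ r, r < 10 → N.reg r = M.reg r)
    (ha : N.arr = M.arr) : Core Γ K N A ℓ l T R P where
  fixed := h.fixed.congr (hr _ (by norm_num)) (hr _ (by norm_num)) (fun a _ => by rw [ha])
  graph := h.graph.congr (fun a _ _ _ => by rw [ha]) (hr _ (by norm_num))
  weight := h.weight
  reduces := h.reduces
  log := h.log.congr fun a _ _ z _ => by rw [ha]
  log_length := by rw [hr _ (by norm_num)]; exact h.log_length
  subset := h.subset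
  mate_mem := h.mate_mem
  done := by rw [ha]; exact h.done
  count := by rw [hr _ (by norm_num)]; exact h.count
  zero := h.zero
  size_le := h.size_le
  top_nonneg := by rw [hr _ (by norm_num)]; exact h.top_nonneg
  stack := by rw [hr _ (by norm_num), ha]; exact h.stack
  cursor := by rw [hr _ (by norm_num)]; exact h.cursor
  pending := by
    unfold Pending
    rw [hr 3 (by norm_num), hr 6 (by norm_num), hr 7 (by norm_num), hr 8 (by norm_num), ha]
    exact h.pending

/-- Only `v`, its mate, `a` and `b` can change their degrees. The first two are no longer in `T`,
and the last two are put on the stack, so the invariant on pending nodes survives. -/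
theorem Core.stepP (h : Core Γ K M A ℓ l T R P) {v a b : Fin n} (hv : M.reg 14 = (v : ℕ))
    (hv' : M.reg 15 = (Γ.G.mateV v : ℕ))
    (ha : M.reg 16 = (a : ℕ)) (hb : M.reg 17 = (b : ℕ)) (hva : A v a ≠ 0)
    (hvb : A (Γ.G.mateV v) b ≠ 0) (hvT : v ∉ T) :
    (∃ ℓ' l', Core Γ K (exec (stepP K) M)
      (splitOff Γ.G.mateV A v a b (slack Γ.G.mateV A v a b)) ℓ' l' T R P ∧
      ∑ a, (ℓ' a).length ≤ ∑ a, (ℓ a).length + 2) ∧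
    (exec (RAM.stepP K) M).reg 6 = M.reg 6 + 2 := by
  have hm := Γ.G.mateV_mateV
  have hne := Γ.G.mateV_ne
  obtain ⟨⟨ℓ', h1, h2⟩, ⟨h3, h4⟩, h5, h6⟩ := h.graph.stepP h.weight Γ.disjoint hne Γ.mate_mem
    h.fixed.mate_eq hv hv' ha hb hva hvb h.log h.log_length
  refine ⟨⟨ℓ', ⟨v, a, b, slack Γ.G.mateV A v a b⟩ :: l, ?_, h2⟩, h5⟩
  have hr : ∀ r, r ≠ 5 → r ≠ 6 → r ≠ 9 → r < 10 → (exec (RAM.stepP K) M).reg r = M.reg r :=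
    fun r _ _ _ _ => exec_reg (fun h => by have := regs_stepP h; omega) _
  have harr : ∀ r, r < K + 8 ∨ K + 17 < r → (exec (RAM.stepP K) M).arr r = M.arr r :=
    fun r _ => exec_arr (fun h => by have := arrs_stepP h; omega) _
  have hW : ∀ i : ℤ, i < M.reg 6 →
      (exec (RAM.stepP K) M).arr (K + 13) i = M.arr (K + 13) i := by
    intro i hi
    rw [h6, Function.update_of_ne (by omega), Function.update_of_ne (by omega)]
  have hWa : (exec (RAM.stepP K) M).arr (K + 13) (M.reg 6) = (a : ℕ) := by
    rw [h6, Function.update_of_ne (by omega), Function.update_self]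
  have hWb : (exec (RAM.stepP K) M).arr (K + 13) (M.reg 6 + 1) = (b : ℕ) := by
    rw [h6, Function.update_self]
  have pa : Pending K (exec (RAM.stepP K) M) a :=
    Or.inl ⟨_, h.top_nonneg, by rw [h5]; omega, hWa⟩
  have pb : Pending K (exec (RAM.stepP K) M) b :=
    Or.inl ⟨_, by have := h.top_nonneg; omega, by rw [h5]; omega, hWb⟩
  have pold : ∀ u : Fin n, Pending K M u → Pending K (exec (RAM.stepP K) M) u := by
    rintro u (⟨i, hi0, hi1, hi2⟩ | ⟨i, hi0, hi1, hi2⟩)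
    · exact Or.inl ⟨i, hi0, by rw [h5]; omega, by rw [hW i hi1, hi2]⟩
    · refine Or.inr ⟨i, ?_, ?_, ?_⟩
      · rwa [hr 7 (by norm_num) (by norm_num) (by norm_num) (by norm_num)]
      · rwa [hr 3 (by norm_num) (by norm_num) (by norm_num) (by norm_num)]
      · rwa [harr _ (by omega)]
  exact {
    fixed := h.fixed.congr (hr _ (by norm_num) (by norm_num) (by norm_num) (by norm_num))
      (hr _ (by norm_num) (by norm_num) (by norm_num) (by norm_num))
      (fun a _ => harr a (by omega))
    graph := h1
    weight := h.weight.splitOff hm hne hva hvb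
    reduces := h.reduces.splitOff h.weight hm hne hva hvb
    log := h3
    log_length := by rw [h4]; simp
    subset := h.subset
    mate_mem := h.mate_mem
    done := by rw [harr _ (by omega)]; exact h.done
    count := by
      rw [hr _ (by norm_num) (by norm_num) (by norm_num) (by norm_num)]; exact h.count
    zero := fun u hu1 hu2 hu3 =>
      splitOff_row_eq_zero h.weight.symm (h.zero u hu1 hu2 hu3) hva hvb _
    size_le := (h.weight.size_splitOff_le hne hva hvb).trans h.size_le
    top_nonneg := by rw [h5]; have := h.top_nonneg; omega
    stack := by
      intro i hi0 hi1
      rw [h5] at hi1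
      by_cases c1 : i < M.reg 6
      · rw [hW i c1]; exact h.stack i hi0 c1
      · by_cases c2 : i = M.reg 6
        · exact ⟨a, h.weight.mem_right hva, by rw [c2, hWa]⟩
        · exact ⟨b, h.weight.mem_right hvb, by rw [← hWb]; congr 1; omega⟩
    cursor := by
      rw [hr _ (by norm_num) (by norm_num) (by norm_num) (by norm_num)]; exact h.cursor
    pending := by
      intro u hu huP hd
      rw [hr 8 (by norm_num) (by norm_num) (by norm_num) (by norm_num)] at hd
      by_cases c1 : u = a
      · left; rw [c1]; exact pa
      by_cases c2 : u = b
      · left; rw [c2]; exact pb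
      by_cases c3 : Γ.G.mateV u = a
      · right; rw [c3]; exact pa
      by_cases c4 : Γ.G.mateV u = b
      · right; rw [c4]; exact pb
      -- What remains is a pair disjoint from all four nodes; its degrees are as before.
      have e1 : ∀ w ∈ T, w ≠ v ∧ w ≠ Γ.G.mateV v := by
        intro w hw
        refine ⟨fun e => hvT (e ▸ hw), fun e => hvT ?_⟩
        have := h.mate_mem w hw
        rwa [e, hm] at this
      obtain ⟨e2, e3⟩ := e1 u hu
      obtain ⟨e4, e5⟩ := e1 _ (h.mate_mem u hu)
      rw [h.weight.deg_splitOff_of_ne hne hva hvb e2 e3 c1 c2,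
        h.weight.deg_splitOff_of_ne hne hva hvb e4 e5 c3 c4] at hd
      exact (h.pending u hu huP hd).imp (pold _) (pold _) }

/-- Remove the first cell of the list of the node in the register `r`. -/
def popP (K r : ℕ) : Program :=
  .write (K + 10) (.reg r) (.read (K + 12) (.read (K + 10) (.reg r)))

/-- One step in the elimination of the nodes in the registers 14 and 15. -/
def scanP (K : ℕ) : Program := block [
  .assign 16 (.read (K + 11) (.read (K + 10) (.reg 14))),
  .assign 17 (.read (K + 11) (.read (K + 10) (.reg 15))),
  .branch (.eq (.read (K + 8) (addr K 14 16)) (.const 0)) (popP K 14)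
    (.branch (.eq (.read (K + 8) (addr K 15 17)) (.const 0)) (popP K 15) (stepP K))]

theorem loopFree_scanP (K : ℕ) : LoopFree (scanP K) := by
  simp [scanP, block, LoopFree, loopFree_stepP, popP]

theorem Chain.exists_cons {val next : ℤ → ℤ} {c h : ℤ} {l : List (Fin n)}
    (hl : Chain val next c h l) (h1 : 1 ≤ h) :
    ∃ b t, l = b :: t ∧ val h = (b : ℕ) ∧ Chain val next c (next h) t := by
  cases l with
  | nil => change h = 0 at hl; omega
  | cons b t => exact ⟨b, t, rfl, hl.2.2.1, hl.2.2.2⟩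

theorem Chain.eq_nil {val next : ℤ → ℤ} {c h : ℤ} {l : List (Fin n)}
    (hl : Chain val next c h l) (h1 : ¬ 1 ≤ h) : l = [] := by
  cases l with
  | nil => rfl
  | cons b t => exact absurd hl.1 h1

/-- An entry whose cell is zero is not required by `cover`. Its removal is paid by the length of the
lists. -/
theorem Core.popP (h : Core Γ K M A ℓ l T R P) {r : ℕ} {x b : Fin n} {t : List (Fin n)}
    (hx : M.reg r = (x : ℕ)) (hxU : x ∈ Γ.U) (hl : ℓ x = b :: t) (hA : A x b = 0) :
    Core Γ K (exec (popP K r) M) A (Function.update ℓ x t) l T R P ∧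
      ∑ a, (Function.update ℓ x t a).length + 1 = ∑ a, (ℓ a).length := by
  have harr : ∀ a, a ≠ K + 10 → (exec (RAM.popP K r) M).arr a = M.arr a := fun a ha =>
    exec_arr (by simpa [RAM.popP, arrs] using ha) _
  have hreg : ∀ r', (exec (RAM.popP K r) M).reg r' = M.reg r' := fun _ => rfl
  have h10 : (exec (RAM.popP K r) M).arr (K + 10) =
      Function.update (M.arr (K + 10)) (x : ℕ) (M.arr (K + 12) (M.arr (K + 10) (x : ℕ))) := by
    simp [RAM.popP, exec, Memory.setArr, Term.eval, hx]
  have hc := h.graph.lists.chain x hxU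
  rw [hl] at hc
  refine ⟨?_, ?_⟩
  · refine { h with
      fixed := h.fixed.congr rfl rfl (fun a _ => harr a (by omega))
      graph := ?_
      log := h.log.congr fun a _ _ z _ => by rw [harr a (by omega)]
      done := by rw [harr _ (by omega)]; exact h.done
      stack := by rw [harr _ (by omega)]; exact h.stack
      pending := ?_ }
    · refine ⟨?_, ?_, ?_, ⟨fun a ha => ?_, h.graph.lists.count_nonneg, fun a ha c hc => ?_⟩, ?_⟩
      · rw [harr _ (by omega)]; exact h.graph.off_eq
      · rw [harr _ (by omega)]; exact h.graph.mat
      · rw [harr _ (by omega)]; exact h.graph.deg_eq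
      · rw [harr _ (by omega), harr _ (by omega), h10]
        by_cases hax : a = x
        · subst hax
          rw [Function.update_self, Function.update_self]
          exact hc.2.2.2
        · rw [Function.update_of_ne hax, Function.update_of_ne]
          · exact h.graph.lists.chain a ha
          · exact fun e => hax ((Fin.cast_eq_iff _ _).1 e)
      · by_cases hax : a = x
        · subst hax
          rw [Function.update_self] at hc
          exact h.graph.lists.mem a ha c (by rw [hl]; exact List.mem_cons_of_mem _ hc)
        · rw [Function.update_of_ne hax] at hc
          exact h.graph.lists.mem a ha c hc
      · intro a c hac
        have := h.graph.cover a c hac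
        by_cases hax : a = x
        · subst hax
          rw [Function.update_self]
          rw [hl] at this
          rcases List.mem_cons.1 this with rfl | h1
          · exact absurd hA hac
          · exact h1
        · rwa [Function.update_of_ne hax]
    · unfold Pending
      rw [harr _ (by omega), harr _ (by omega)]
      exact h.pending
  · have : ∀ a, (Function.update ℓ x t a).length + (if a = x then 1 else 0) = (ℓ a).length := by
      intro a
      by_cases hax : a = x
      · subst hax; simp [hl]
      · simp [hax]
    rw [← Finset.sum_congr rfl fun a _ => this a, Finset.sum_add_distrib]
    simp

/-- The two possibilities for a potential that decreases during the elimination of `v`. -/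
def Weighted (mate : Fin n → Fin n) (A : Fin n → Fin n → ℤ) (v : Fin n) (α β : ℤ) : Prop :=
  (α = 1 ∧ β = 2 ∧ A (mate v) (mate v) = 0) ∨ (α = 2 ∧ β = 1 ∧ A v v = 0)

/-- The potential is the length of all lists, plus the height of the stack, plus five times a
weighted degree of the pair being eliminated. Each round lowers it by at least one. -/
theorem Core.scanP (h : Core Γ K M A ℓ l T R P) {v : Fin n} (hv : M.reg 14 = (v : ℕ))
    (hv' : M.reg 15 = (Γ.G.mateV v : ℕ)) (hvU : v ∈ Γ.U) (hvT : v ∉ T) {α β : ℤ}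
    (hW : Weighted Γ.G.mateV A v α β)
    (h1 : 1 ≤ M.arr (K + 10) (v : ℕ)) (h2 : 1 ≤ M.arr (K + 10) (Γ.G.mateV v : ℕ)) :
    ∃ A' ℓ' l', Core Γ K (exec (scanP K) M) A' ℓ' l' T R P ∧ Weighted Γ.G.mateV A' v α β ∧
      (exec (RAM.scanP K) M).reg 14 = (v : ℕ) ∧
      (exec (RAM.scanP K) M).reg 15 = (Γ.G.mateV v : ℕ) ∧
      ∑ a, ((ℓ' a).length : ℤ) + (exec (RAM.scanP K) M).reg 6 +
        5 * (α * deg A' v + β * deg A' (Γ.G.mateV v)) + 1 ≤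
      ∑ a, ((ℓ a).length : ℤ) + M.reg 6 +
        5 * (α * deg A v + β * deg A (Γ.G.mateV v)) := by
  have hm := Γ.G.mateV_mateV
  have hne := Γ.G.mateV_ne
  have hvU' := Γ.mate_mem v hvU
  obtain ⟨a, t, ht, hta, -⟩ := (h.graph.lists.chain v hvU).exists_cons h1
  obtain ⟨b, u, hu, hub, -⟩ := (h.graph.lists.chain _ hvU').exists_cons h2
  have aU : a ∈ Γ.U := h.graph.lists.mem v hvU a (by simp [ht])
  have bU : b ∈ Γ.U := h.graph.lists.mem _ hvU' b (by simp [hu])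
  set M1 := exec (block [
    .assign 16 (.read (K + 11) (.read (K + 10) (.reg 14))),
    .assign 17 (.read (K + 11) (.read (K + 10) (.reg 15)))]) M with hM1
  have c1 : Core Γ K M1 A ℓ l T R P := by
    refine h.congr (fun r hr => exec_reg ?_ _) rfl
    simp [block, regs]; omega
  have r14 : M1.reg 14 = (v : ℕ) := by rw [← hv]; exact exec_reg (by simp [block, regs]) _
  have r15 : M1.reg 15 = (Γ.G.mateV v : ℕ) := by
    rw [← hv']; exact exec_reg (by simp [block, regs]) _
  have r6 : M1.reg 6 = M.reg 6 := exec_reg (by simp [block, regs]) _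
  have r16 : M1.reg 16 = (a : ℕ) := by
    simp [hM1, block, exec, Memory.setReg, Term.eval, hv, hta]
  have r17 : M1.reg 17 = (b : ℕ) := by
    simp [hM1, block, exec, Memory.setReg, Term.eval, hv', hub]
  have e : exec (RAM.scanP K) M = exec (.branch (.eq (.read (K + 8) (addr K 14 16)) (.const 0))
      (RAM.popP K 14) (.branch (.eq (.read (K + 8) (addr K 15 17)) (.const 0))
      (RAM.popP K 15) (RAM.stepP K))) M1 := rfl
  rw [e]
  have m1 : M1.arr (K + 8) (M1.arr (K + 6) (v : ℕ) + (a : ℕ)) = A v a := by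
    rw [c1.graph.off_eq v hvU, c1.graph.mat v hvU a aU]
  have m2 : M1.arr (K + 8) (M1.arr (K + 6) (Γ.G.mateV v : ℕ) + (b : ℕ)) = A (Γ.G.mateV v) b := by
    rw [c1.graph.off_eq _ hvU', c1.graph.mat _ hvU' b bU]
  simp only [exec, Test.Holds, Term.eval, addr_eval, r14, r15, r16, r17, m1, m2]
  by_cases z1 : A v a = 0
  · rw [if_pos z1]
    obtain ⟨q1, q2⟩ := c1.popP r14 hvU ht z1
    refine ⟨A, _, l, q1, hW, r14, r15, ?_⟩
    have : (exec (RAM.popP K 14) M1).reg 6 = M.reg 6 := r6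
    rw [this]
    have q3 : ∑ a, ((Function.update ℓ v t a).length : ℤ) + 1 = ∑ a, ((ℓ a).length : ℤ) := by
      exact_mod_cast q2
    linarith
  · rw [if_neg z1]
    by_cases z2 : A (Γ.G.mateV v) b = 0
    · rw [if_pos z2]
      obtain ⟨q1, q2⟩ := c1.popP r15 hvU' hu z2
      refine ⟨A, _, l, q1, hW, r14, r15, ?_⟩
      have : (exec (RAM.popP K 15) M1).reg 6 = M.reg 6 := r6
      rw [this]
      have q3 : ∑ a, ((Function.update ℓ (Γ.G.mateV v) u a).length : ℤ) + 1 =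
          ∑ a, ((ℓ a).length : ℤ) := by
        exact_mod_cast q2
      linarith
    · rw [if_neg z2]
      obtain ⟨⟨ℓ', l', q1, q2⟩, q3⟩ := c1.stepP r14 r15 r16 r17 z1 z2 hvT
      have hr : ∀ r, 14 ≤ r → r ≤ 15 → (exec (RAM.stepP K) M1).reg r = M1.reg r :=
        fun r _ _ => exec_reg (fun h => by have := regs_stepP h; omega) _
      obtain ⟨p1, p2⟩ := h.weight.splitOff_progress hm hne z1 z2
      refine ⟨_, ℓ', l', q1, ?_, by rw [hr _ (by norm_num) (by norm_num), r14],
        by rw [hr _ (by norm_num) (by norm_num), r15], ?_⟩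
      · rcases hW with ⟨w1, w2, w3⟩ | ⟨w1, w2, w3⟩
        · exact Or.inl ⟨w1, w2, h.weight.splitOff_diag hm hne z1 z2 (Or.inr rfl) w3⟩
        · exact Or.inr ⟨w1, w2, h.weight.splitOff_diag hm hne z1 z2 (Or.inl rfl) w3⟩
      -- A splitting adds at most two list entries and two stack entries, and lowers the weighted
      -- degree by at least one. The factor five leaves a net decrease of one.
      · have q4 : ∑ a, ((ℓ' a).length : ℤ) ≤ ∑ a, ((ℓ a).length : ℤ) + 2 := by exact_mod_cast q2
        rw [q3, r6]
        rcases hW with ⟨w1, w2, w3⟩ | ⟨w1, w2, w3⟩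
        · have := p1 w3; rw [w1, w2]; linarith
        · have := p2 w3; rw [w1, w2]; linarith

end RAM

/-! ### Elimination of a node and its mate -/

namespace RAM

open SymMatrix

theorem cast_add_one_le {a b : ℤ} (h : a + 1 ≤ b) : (a : ℝ) + 1 ≤ b := by exact_mod_cast h

/-- Beginning of the elimination of the node in the register 14. -/
def startP (K : ℕ) : Program := block [
  .assign 15 (.read 3 (.reg 14)),
  .write (K + 18) (.reg 14) (.const 1), .write (K + 18) (.reg 15) (.const 1),
  .assign 4 (.minus (.reg 4) (.const 2)),
  .branch (.both (.neg (.eq (.read (K + 8) (addr K 14 14)) (.const 0)))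
      (.neg (.eq (.read (K + 8) (addr K 15 15)) (.const 0))))
    (block [.assign 16 (.reg 14), .assign 17 (.reg 15), stepP K]) .skip]

/-- Both lists of the nodes in the registers 14 and 15 are nonempty. -/
def scanTest (K : ℕ) : Test :=
  .both (.le (.const 1) (.read (K + 10) (.reg 14))) (.le (.const 1) (.read (K + 10) (.reg 15)))

/-- Elimination of the node in the register 14 and its mate. -/
def elimP (K : ℕ) : Program := .seq (startP K) (.loop (scanTest K) (scanP K))

theorem loopFree_startP (K : ℕ) : LoopFree (startP K) := by
  simp [startP, block, LoopFree, loopFree_stepP]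

variable {n m k : ℕ} {Γ : Setup n m k} {K : ℕ} {M N : Memory} {A : Fin n → Fin n → ℤ}
  {ℓ : Fin n → List (Fin n)} {l : List (Record (Fin n))} {T R P : Finset (Fin n)}

/-- If both nodes have diagonal entries, one preliminary splitting destroys one of these. Afterwards
one of the two potentials of `Weighted` is available. The 4 accounts for two list entries and two
stack entries. -/
theorem Core.startP {v : Fin n} (h : Core Γ K M A ℓ l T ∅ {v, Γ.G.mateV v})
    (hv : M.reg 14 = (v : ℕ)) (hvT : v ∈ T) :
    ∃ A' ℓ' l', Core Γ K (exec (RAM.startP K) M) A' ℓ' l' (T \ {v, Γ.G.mateV v}) {v, Γ.G.mateV v} ∅ ∧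
      (∃ α β, Weighted Γ.G.mateV A' v α β) ∧
      ((exec (RAM.startP K) M).reg 14 = (v : ℕ) ∧
      (exec (RAM.startP K) M).reg 15 = (Γ.G.mateV v : ℕ)) ∧
      ((exec (RAM.startP K) M).reg 7 = M.reg 7 ∧ (exec (RAM.startP K) M).reg 8 = M.reg 8) ∧
      deg A' v ≤ deg A v ∧ deg A' (Γ.G.mateV v) ≤ deg A (Γ.G.mateV v) ∧
      ∑ a, ((ℓ' a).length : ℤ) + (exec (RAM.startP K) M).reg 6 ≤
        ∑ a, ((ℓ a).length : ℤ) + M.reg 6 + 4 := by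
  have hm := Γ.G.mateV_mateV
  have hne := Γ.G.mateV_ne
  have hvU := h.subset hvT
  have hvU' := Γ.mate_mem v hvU
  have hvT' := h.mate_mem v hvT
  set P1 : Program := block [
    .assign 15 (.read 3 (.reg 14)),
    .write (K + 18) (.reg 14) (.const 1), .write (K + 18) (.reg 15) (.const 1),
    .assign 4 (.minus (.reg 4) (.const 2))] with hP1
  have e : exec (RAM.startP K) M = exec (.branch
      (.both (.neg (.eq (.read (K + 8) (addr K 14 14)) (.const 0)))
      (.neg (.eq (.read (K + 8) (addr K 15 15)) (.const 0))))
    (block [.assign 16 (.reg 14), .assign 17 (.reg 15), RAM.stepP K]) .skip) (exec P1 M) := rfl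
  have r14 : (exec P1 M).reg 14 = (v : ℕ) := by
    rw [← hv]; exact exec_reg (by simp [hP1, block, regs]) _
  have r15 : (exec P1 M).reg 15 = (Γ.G.mateV v : ℕ) := by
    rw [← h.fixed.mate_eq]
    simp [hP1, block, exec, Memory.setReg, Memory.setArr, Term.eval, hv]
  have r4 : (exec P1 M).reg 4 = M.reg 4 - 2 := by
    simp [hP1, block, exec, Memory.setReg, Memory.setArr, Term.eval]
  have hr : ∀ r, r ≠ 15 → r ≠ 4 → (exec P1 M).reg r = M.reg r := fun r h1 h2 =>
    exec_reg (by simp [hP1, block, regs, h1, h2]) _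
  have harr : ∀ a, a ≠ K + 18 → (exec P1 M).arr a = M.arr a := fun a h1 =>
    exec_arr (by simp [hP1, block, arrs, h1]) _
  have a18 : (exec P1 M).arr (K + 18) =
      Function.update (Function.update (M.arr (K + 18)) (v : ℕ) 1) (Γ.G.mateV v : ℕ) 1 := by
    have := h.fixed.mate_eq v
    simp [hP1, block, exec, Memory.setReg, Memory.setArr, Term.eval, hv, this]
  set M1 := exec P1 M
  have hmem : ∀ u, u ∈ T \ {v, Γ.G.mateV v} ↔ u ∈ T ∧ u ≠ v ∧ u ≠ Γ.G.mateV v := by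
    intro u; simp
  have c1 : Core Γ K M1 A ℓ l (T \ {v, Γ.G.mateV v}) {v, Γ.G.mateV v} ∅ := by
    refine { h with
      fixed := h.fixed.congr (hr _ (by norm_num) (by norm_num)) (hr _ (by norm_num) (by norm_num))
        (fun a _ => harr a (by omega))
      graph := h.graph.congr (fun a _ _ _ => harr a (by omega)) (hr _ (by norm_num) (by norm_num))
      log := h.log.congr fun a _ _ z _ => by rw [harr a (by omega)]
      log_length := by rw [hr _ (by norm_num) (by norm_num)]; exact h.log_length
      subset := Finset.sdiff_subset.trans h.subset
      mate_mem := ?_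
      done := ?_
      count := ?_
      zero := ?_
      top_nonneg := by rw [hr _ (by norm_num) (by norm_num)]; exact h.top_nonneg
      stack := by rw [hr _ (by norm_num) (by norm_num), harr _ (by omega)]; exact h.stack
      cursor := by rw [hr _ (by norm_num) (by norm_num)]; exact h.cursor
      pending := ?_ }
    · intro u hu
      rw [hmem] at hu ⊢
      refine ⟨h.mate_mem u hu.1, fun e => hu.2.2 ?_, fun e => hu.2.1 ?_⟩
      · rw [← e, hm]
      · rw [← hm u, e, hm]
    · intro u hu
      rw [a18]
      by_cases e1 : u = Γ.G.mateV v
      · subst e1; rw [Function.update_self, if_neg]; simp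
      · rw [Function.update_of_ne (fun e => e1 ((Fin.cast_eq_iff _ _).1 e))]
        by_cases e2 : u = v
        · subst e2; rw [Function.update_self, if_neg]; simp
        · rw [Function.update_of_ne (fun e => e2 ((Fin.cast_eq_iff _ _).1 e)), h.done u hu]
          simp [hmem, e1, e2]
    · rw [r4, h.count, Finset.card_sdiff_of_subset]
      · have h2 : ({v, Γ.G.mateV v} : Finset (Fin n)).card = 2 := Finset.card_pair (hne v).symm
        have h3 : ({v, Γ.G.mateV v} : Finset (Fin n)).card ≤ T.card := by
          apply Finset.card_le_card
          intro x hx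
          simp only [Finset.mem_insert, Finset.mem_singleton] at hx
          rcases hx with rfl | rfl <;> assumption
        rw [h2] at h3 ⊢
        omega
      · intro x hx
        simp only [Finset.mem_insert, Finset.mem_singleton] at hx
        rcases hx with rfl | rfl <;> assumption
    · intro u hu1 hu2 hu3
      refine h.zero u (fun hu => hu1 ?_) (by simp) hu3
      simp only [Finset.mem_insert, Finset.mem_singleton, not_or] at hu2
      exact (hmem u).2 ⟨hu, hu2.1, hu2.2⟩
    · intro u hu _ hd
      rw [hmem] at hu
      unfold Pending
      rw [hr 3 (by norm_num) (by norm_num), hr 6 (by norm_num) (by norm_num),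
        hr 7 (by norm_num) (by norm_num), harr _ (by omega), harr _ (by omega)]
      rw [hr 8 (by norm_num) (by norm_num)] at hd
      exact h.pending u hu.1 (by simp [hu.2]) hd
  have m1 : M1.arr (K + 8) (M1.arr (K + 6) (v : ℕ) + (v : ℕ)) = A v v := by
    rw [c1.graph.off_eq v hvU, c1.graph.mat v hvU v hvU]
  have m2 : M1.arr (K + 8) (M1.arr (K + 6) (Γ.G.mateV v : ℕ) + (Γ.G.mateV v : ℕ)) =
      A (Γ.G.mateV v) (Γ.G.mateV v) := by
    rw [c1.graph.off_eq _ hvU', c1.graph.mat _ hvU' _ hvU']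
  rw [e]
  simp only [exec, Test.Holds, Term.eval, addr_eval, r14, r15, m1, m2]
  by_cases z : ¬ A v v = 0 ∧ ¬ A (Γ.G.mateV v) (Γ.G.mateV v) = 0
  · rw [if_pos z]
    have e2 : exec (block [.assign 16 (.reg 14), .assign 17 (.reg 15), RAM.stepP K]) M1 =
      exec (RAM.stepP K) (exec (block [.assign 16 (.reg 14), .assign 17 (.reg 15)]) M1) := rfl
    rw [e2]
    have hr2 : ∀ r, r ≠ 16 → r ≠ 17 →
        (exec (block [.assign 16 (.reg 14), .assign 17 (.reg 15)]) M1).reg r = M1.reg r :=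
      fun r h1 h2 => exec_reg (by simp [block, regs, h1, h2]) _
    have q16 : (exec (block [.assign 16 (.reg 14), .assign 17 (.reg 15)]) M1).reg 16 =
        (v : ℕ) := by simp [block, exec, Memory.setReg, Term.eval, r14]
    have q17 : (exec (block [.assign 16 (.reg 14), .assign 17 (.reg 15)]) M1).reg 17 =
        (Γ.G.mateV v : ℕ) := by simp [block, exec, Memory.setReg, Term.eval, r15]
    set M2 := exec (block [.assign 16 (.reg 14), .assign 17 (.reg 15)]) M1
    have c2 : Core Γ K M2 A ℓ l (T \ {v, Γ.G.mateV v}) {v, Γ.G.mateV v} ∅ :=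
      c1.congr (fun r h => hr2 r (by omega) (by omega)) rfl
    obtain ⟨⟨ℓ', l', q1, q2⟩, q3⟩ := c2.stepP (by rw [hr2 _ (by norm_num) (by norm_num), r14])
      (by rw [hr2 _ (by norm_num) (by norm_num), r15]) q16 q17 z.1 z.2 (by simp)
    have hr3 : ∀ r, r = 7 ∨ r = 8 ∨ r = 14 ∨ r = 15 →
        (exec (RAM.stepP K) M2).reg r = M2.reg r :=
      fun r _ => exec_reg (fun h => by have := regs_stepP h; omega) _
    obtain ⟨p1, p2, p3⟩ := h.weight.splitOff_both_diag hm hne z.1 z.2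
    refine ⟨_, ℓ', l', q1, ?_, ⟨?_, ?_⟩, ⟨?_, ?_⟩, p2, p3, ?_⟩
    · rcases p1 with p1 | p1
      · exact ⟨2, 1, Or.inr ⟨rfl, rfl, p1⟩⟩
      · exact ⟨1, 2, Or.inl ⟨rfl, rfl, p1⟩⟩
    · rw [hr3 _ (by norm_num), hr2 _ (by norm_num) (by norm_num), r14]
    · rw [hr3 _ (by norm_num), hr2 _ (by norm_num) (by norm_num), r15]
    · rw [hr3 _ (by norm_num), hr2 _ (by norm_num) (by norm_num), hr _ (by norm_num) (by norm_num)]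
    · rw [hr3 _ (by norm_num), hr2 _ (by norm_num) (by norm_num), hr _ (by norm_num) (by norm_num)]
    · have q4 : ∑ a, ((ℓ' a).length : ℤ) ≤ ∑ a, ((ℓ a).length : ℤ) + 2 := by exact_mod_cast q2
      rw [q3, hr2 _ (by norm_num) (by norm_num), hr _ (by norm_num) (by norm_num)]
      linarith
  · rw [if_neg z]
    refine ⟨A, ℓ, l, c1, ?_, ⟨r14, r15⟩, ⟨?_, ?_⟩, le_rfl, le_rfl, ?_⟩
    · by_cases z1 : A v v = 0
      · exact ⟨2, 1, Or.inr ⟨rfl, rfl, z1⟩⟩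
      · refine ⟨1, 2, Or.inl ⟨rfl, rfl, ?_⟩⟩
        by_contra z2
        exact z ⟨z1, z2⟩
    · exact hr _ (by norm_num) (by norm_num)
    · exact hr _ (by norm_num) (by norm_num)
    · rw [hr _ (by norm_num) (by norm_num)]; linarith

/-- The row sum at `v` minus that at its mate is still the divergency of the flow at `v`, which is
nonnegative here. So if the row of `v` vanishes, the nonnegative row of its mate vanishes too. -/
theorem Core.row_mate_eq_zero (h : Core Γ K M A ℓ l T R P) {v : Fin n}
    (hv : ∀ i, Γ.G.mateV v ≠ Γ.s i) (h0 : ∀ y, A v y = 0) (y : Fin n) : A (Γ.G.mateV v) y = 0 := by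
  have h1 := Reduces.row_sub Γ.G.mateV_mateV h.reduces v
  rw [Setup.matrix, Γ.G.row_arcMatrix Γ.flow.symmetric] at h1
  have h2 := Γ.div_nonneg hv
  have h3 : row A v = 0 := Finset.sum_eq_zero fun y _ => h0 y
  have h4 : row A (Γ.G.mateV v) ≤ 0 := by omega
  have h5 := Finset.single_le_sum (f := fun y => A (Γ.G.mateV v) y)
    (fun y _ => h.weight.nonneg _ y) (Finset.mem_univ y)
  have h6 := h.weight.nonneg (Γ.G.mateV v) y
  simp only [row] at h4
  linarith

/-- An empty list means an empty row. If the empty row is that of the mate of a nonterminal `u`,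
then `row_mate_eq_zero` transfers the emptiness to `u`; a terminal may keep its row. -/
theorem Core.finish {v : Fin n} (h : Core Γ K M A ℓ l T {v, Γ.G.mateV v} P)
    (hvU : v ∈ Γ.U) (hn : ℓ v = [] ∨ ℓ (Γ.G.mateV v) = []) : Core Γ K M A ℓ l T ∅ P := by
  have key : ∀ v, ℓ v = [] → ∀ y, A v y = 0 := by
    intro v hv y
    by_contra h1
    have := h.graph.cover v y h1
    simp [hv] at this
  refine { h with zero := fun u hu1 _ hu3 => ?_ }
  by_cases e1 : u = v
  · subst e1
    rcases hn with hn | hn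
    · exact key _ hn
    · have := h.row_mate_eq_zero (v := Γ.G.mateV u) (by rwa [Γ.G.mateV_mateV]) (key _ hn)
      rwa [Γ.G.mateV_mateV] at this
  · by_cases e2 : u = Γ.G.mateV v
    · subst e2
      rcases hn with hn | hn
      · exact h.row_mate_eq_zero hu3 (key _ hn)
      · exact key _ hn
    · exact h.zero u hu1 (by simp [e1, e2]) hu3

theorem halts_elimP {v : Fin n} (h : Core Γ K M A ℓ l T ∅ {v, Γ.G.mateV v})
    (hv : M.reg 14 = (v : ℕ)) (hvT : v ∈ T) {C x w : ℝ} (hw : 0 ≤ w)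
    (hC : (bound (scanP K) : ℝ) + (scanTest K).cost + 1 ≤ C)
    (hx : C * (∑ a, ((ℓ a).length : ℝ) + M.reg 6 +
      10 * (deg A v + deg A (Γ.G.mateV v) : ℤ) + 5) + bound (startP K) + w ≤ x) :
    Halts (elimP K) M x fun N y => ∃ A' ℓ' l',
      Core Γ K N A' ℓ' l' (T \ {v, Γ.G.mateV v}) ∅ ∅ ∧
      (N.reg 7 = M.reg 7 ∧ N.reg 8 = M.reg 8) ∧
      C * (∑ a, ((ℓ' a).length : ℝ) + N.reg 6) + w ≤ y := by
  have hvU := h.subset hvT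
  have hvU' := Γ.mate_mem v hvU
  have hC0 : 0 ≤ C := le_trans (by positivity) hC
  obtain ⟨A1, ℓ1, l1, c1, ⟨α, β, hW⟩, ⟨r14, r15⟩, ⟨r7, r8⟩, d1, d2, s1⟩ := h.startP hv hvT
  refine Halts.seq (Halts.of_loopFree (loopFree_startP K) fun x1 hx1 => ?_)
  have hαβ : (1 ≤ α ∧ α ≤ 2) ∧ 1 ≤ β ∧ β ≤ 2 := by
    rcases hW with ⟨rfl, rfl, -⟩ | ⟨rfl, rfl, -⟩ <;> norm_num
  -- The invariant keeps the potential of `Core.scanP` in units of `C`; the final 1 pays for the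
  -- test that ends the loop.
  refine Halts.loop (I := fun N y => ∃ A' ℓ' l',
      Core Γ K N A' ℓ' l' (T \ {v, Γ.G.mateV v}) {v, Γ.G.mateV v} ∅ ∧
      Weighted Γ.G.mateV A' v α β ∧
      (N.reg 14 = (v : ℕ) ∧ N.reg 15 = (Γ.G.mateV v : ℕ)) ∧
      (N.reg 7 = M.reg 7 ∧ N.reg 8 = M.reg 8) ∧
      C * ((∑ a, ((ℓ' a).length : ℤ) + N.reg 6 +
        5 * (α * deg A' v + β * deg A' (Γ.G.mateV v)) + 1 : ℤ) : ℝ) + w ≤ y) ?_ ?_ ?_ ?_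
  · rintro N y ⟨A', ℓ', l', c, -, -, -, hy⟩
    refine le_trans ?_ hy
    have h1 := c.top_nonneg
    have h2 := deg_nonneg A' v
    have h3 := deg_nonneg A' (Γ.G.mateV v)
    have h4 : (0 : ℤ) ≤ ∑ a, ((ℓ' a).length : ℤ) := by positivity
    have h5 := mul_nonneg (le_trans zero_le_one hαβ.1.1) h2
    have h6 := mul_nonneg (le_trans zero_le_one hαβ.2.1) h3
    have h7 : (0 : ℤ) ≤ ∑ a, ((ℓ' a).length : ℤ) + N.reg 6 +
        5 * (α * deg A' v + β * deg A' (Γ.G.mateV v)) + 1 := by linarith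
    have h8 : (0 : ℝ) ≤ ((∑ a, ((ℓ' a).length : ℤ) + N.reg 6 +
        5 * (α * deg A' v + β * deg A' (Γ.G.mateV v)) + 1 : ℤ) : ℝ) := by exact_mod_cast h7
    positivity
  · rintro N y ⟨A', ℓ', l', c, w1, ⟨q14, q15⟩, ⟨q7, q8⟩, hy⟩ hb
    simp only [scanTest, Test.Holds, Term.eval, q14, q15] at hb
    obtain ⟨A2, ℓ2, l2, c2, w2, t14, t15, hs⟩ := c.scanP q14 q15 hvU (by simp) w1 hb.1 hb.2
    refine Halts.of_loopFree (loopFree_scanP K) fun y' hy' => ?_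
    have hr : ∀ r, r = 7 ∨ r = 8 → (exec (scanP K) N).reg r = N.reg r := by
      refine fun r hr => exec_reg (fun h => ?_) _
      simp only [scanP, block, popP, regs, Set.mem_union, Set.mem_empty_iff_false, false_or,
        or_false, Set.mem_singleton_iff] at h
      rcases h with h | h | h
      · omega
      · omega
      · have := regs_stepP h; omega
    refine ⟨A2, ℓ2, l2, c2, w2, ⟨t14, t15⟩, ⟨by rw [hr _ (by norm_num), q7],
      by rw [hr _ (by norm_num), q8]⟩, ?_⟩
    have hs' : ((∑ a, ((ℓ2 a).length : ℤ) + (exec (scanP K) N).reg 6 +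
        5 * (α * deg A2 v + β * deg A2 (Γ.G.mateV v)) + 1 : ℤ) : ℝ) + 1 ≤
        ((∑ a, ((ℓ' a).length : ℤ) + N.reg 6 +
        5 * (α * deg A' v + β * deg A' (Γ.G.mateV v)) + 1 : ℤ) : ℝ) := cast_add_one_le (by linarith)
    have := mul_le_mul_of_nonneg_left hs' hC0
    rw [mul_add, mul_one] at this
    linarith
  · rintro N y ⟨A', ℓ', l', c, w1, ⟨q14, q15⟩, ⟨q7, q8⟩, hy⟩ hb
    simp only [scanTest, Test.Holds, Term.eval, q14, q15] at hb
    refine ⟨A', ℓ', l', c.finish hvU ?_, ⟨q7, q8⟩, ?_⟩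
    · by_cases h1 : 1 ≤ N.arr (K + 10) (v : ℕ)
      · right
        exact (c.graph.lists.chain _ hvU').eq_nil fun h2 => hb ⟨h1, h2⟩
      · left
        exact (c.graph.lists.chain _ hvU).eq_nil h1
    · have h2 := deg_nonneg A' v
      have h3 := deg_nonneg A' (Γ.G.mateV v)
      have h5 := mul_nonneg (le_trans zero_le_one hαβ.1.1) h2
      have h6 := mul_nonneg (le_trans zero_le_one hαβ.2.1) h3
      have h7 : ((∑ a, ((ℓ' a).length : ℤ) + N.reg 6 : ℤ) : ℝ) + 1 ≤
        ((∑ a, ((ℓ' a).length : ℤ) + N.reg 6 +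
        5 * (α * deg A' v + β * deg A' (Γ.G.mateV v)) + 1 : ℤ) : ℝ) :=
        cast_add_one_le (by linarith)
      have h8 := mul_le_mul_of_nonneg_left h7 hC0
      have h9 : (0 : ℝ) ≤ bound (scanP K) := Nat.cast_nonneg _
      push_cast at h8 hy ⊢
      linarith
  · refine ⟨A1, ℓ1, l1, c1, hW, ⟨r14, r15⟩, ⟨r7, r8⟩, ?_⟩
    have h2 := deg_nonneg A1 v
    have h3 := deg_nonneg A1 (Γ.G.mateV v)
    have h4 := mul_le_mul_of_nonneg_right hαβ.1.2 h2
    have h5 := mul_le_mul_of_nonneg_right hαβ.2.2 h3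
    -- The 10 is five times the larger weight 2, and 5 is the 4 from `Core.startP` plus the 1 of the
    -- invariant.
    have h7 : ((∑ a, ((ℓ1 a).length : ℤ) + (exec (startP K) M).reg 6 +
        5 * (α * deg A1 v + β * deg A1 (Γ.G.mateV v)) + 1 : ℤ) : ℝ) ≤
        ((∑ a, ((ℓ a).length : ℤ) + M.reg 6 +
        10 * (deg A v + deg A (Γ.G.mateV v)) + 5 : ℤ) : ℝ) := Int.cast_le.2 (by linarith)
    have h8 := mul_le_mul_of_nonneg_left h7 hC0
    push_cast at h8 hx ⊢
    linarith

end RAM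

/-! ### The order of elimination and its total cost -/

/-- The cost of a node of degree `d` is paid by the decrease of `m * log (m + i ^ 2)`. -/
theorem le_mul_log_sub_log {d i m κ : ℝ} (hm : 0 < m) (hi : 2 ≤ i) (hκ : 0 ≤ κ)
    (h1 : d * i ≤ κ * m) (h2 : d ≤ κ * i) :
    d ≤ κ * (m * Real.log (m + i ^ 2) - m * Real.log (m + (i - 2) ^ 2)) := by
  have p1 : 0 < m + i ^ 2 := by positivity
  have p2 : 0 < m + (i - 2) ^ 2 := by positivity
  -- From `1 - 1 / x ≤ log x`, the logarithm falls by at least `(4 * i - 4) / (m + i ^ 2)`, which is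
  -- at least `2 * i / (m + i ^ 2)` because `2 ≤ i`.
  have h3 := Real.one_sub_inv_le_log_of_pos (div_pos p1 p2)
  rw [Real.log_div p1.ne' p2.ne', inv_div] at h3
  have h4 : 2 * i / (m + i ^ 2) ≤ 1 - (m + (i - 2) ^ 2) / (m + i ^ 2) := by
    rw [one_sub_div p1.ne', div_le_div_iff_of_pos_right p1]
    nlinarith
  -- Indeed `d * (m + i ^ 2) = d * m + (d * i) * i ≤ 2 * κ * m * i`, each hypothesis bounding one
  -- term.
  have h5 : d ≤ κ * (m * (2 * i / (m + i ^ 2))) := by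
    rw [← mul_div_assoc, ← mul_div_assoc, le_div_iff₀ p1]
    nlinarith
  refine h5.trans (mul_le_mul_of_nonneg_left ?_ hκ)
  rw [← mul_sub]
  exact mul_le_mul_of_nonneg_left (h4.trans h3) hm.le

namespace RAM

open SymMatrix

/-- Take a node from the stack. -/
def popStackP (K : ℕ) : Program := block [
  .assign 6 (.minus (.reg 6) (.const 1)), .assign 14 (.read (K + 13) (.reg 6))]

/-- Double the threshold and return to the beginning of the queue. -/
def resetP : Program := block [.assign 8 (.plus (.reg 8) (.reg 8)), .assign 7 (.const 0)]

/-- Take a node from the queue. -/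
def popQueueP (K : ℕ) : Program := block [
  .assign 14 (.read (K + 7) (.reg 7)), .assign 7 (.plus (.reg 7) (.const 1))]

/-- Put the next candidate for elimination into the register 14. -/
def fetchP (K : ℕ) : Program :=
  .branch (.le (.const 1) (.reg 6)) (popStackP K)
    (.seq (.branch (.le (.reg 3) (.reg 7)) resetP .skip) (popQueueP K))

/-- The node in the register 14 is present and its degree is at most the threshold. -/
def lowTest (K : ℕ) : Test :=
  .both (.eq (.read (K + 18) (.reg 14)) (.const 0))
    (.le (.plus (.read (K + 9) (.reg 14)) (.read (K + 9) (.read 3 (.reg 14)))) (.reg 8))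

/-- Elimination of all nodes. -/
def mainP (K : ℕ) : Program :=
  .loop (.le (.const 1) (.reg 4)) (.seq (fetchP K) (.branch (lowTest K) (elimP K) .skip))

theorem loopFree_fetchP (K : ℕ) : LoopFree (fetchP K) := by
  simp [fetchP, popStackP, resetP, popQueueP, block, LoopFree]

variable {n m k : ℕ} {Γ : Setup n m k} {K : ℕ} {M N : Memory} {A : Fin n → Fin n → ℤ}
  {ℓ : Fin n → List (Fin n)} {l : List (Record (Fin n))} {T R P : Finset (Fin n)}

/-- The node taken off may have been the only witness that its pair is pending, so this pair is
exempted until it has been tested. -/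
theorem Core.popStackP (h : Core Γ K M A ℓ l T ∅ ∅) (h6 : 1 ≤ M.reg 6) :
    ∃ v ∈ Γ.U, Core Γ K (exec (popStackP K) M) A ℓ l T ∅ {v, Γ.G.mateV v} ∧
      (exec (popStackP K) M).reg 14 = (v : ℕ) := by
  obtain ⟨v, hvU, hv⟩ := h.stack (M.reg 6 - 1) (by omega) (by omega)
  have hr : ∀ r, r ≠ 6 → r ≠ 14 → (exec (RAM.popStackP K) M).reg r = M.reg r := fun r h1 h2 =>
    exec_reg (by simp [RAM.popStackP, block, regs, h1, h2]) _
  have r6 : (exec (RAM.popStackP K) M).reg 6 = M.reg 6 - 1 := by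
    simp [RAM.popStackP, block, exec, Memory.setReg, Term.eval]
  have ha : (exec (RAM.popStackP K) M).arr = M.arr := rfl
  refine ⟨v, hvU, ?_, by rw [← hv]; simp [RAM.popStackP, block, exec, Memory.setReg, Term.eval]⟩
  refine { h with
    fixed := h.fixed.congr (hr _ (by norm_num) (by norm_num)) (hr _ (by norm_num) (by norm_num))
      (fun a _ => by rw [ha])
    graph := h.graph.congr (fun a _ _ _ => by rw [ha]) (hr _ (by norm_num) (by norm_num))
    log := h.log.congr fun a _ _ z _ => by rw [ha]
    log_length := by rw [hr _ (by norm_num) (by norm_num)]; exact h.log_length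
    count := by rw [hr _ (by norm_num) (by norm_num)]; exact h.count
    top_nonneg := by rw [r6]; omega
    stack := fun i hi0 hi1 => h.stack i hi0 (by rw [r6] at hi1; omega)
    cursor := by rw [hr _ (by norm_num) (by norm_num)]; exact h.cursor
    pending := ?_ }
  intro u hu huP hd
  simp only [Finset.mem_insert, Finset.mem_singleton, not_or] at huP
  have key : ∀ w : Fin n, w ≠ v → Pending K M w → Pending K (exec (RAM.popStackP K) M) w := by
    rintro w hw (⟨i, hi0, hi1, hi2⟩ | hq)
    · refine Or.inl ⟨i, hi0, ?_, hi2⟩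
      rw [r6]
      have : i ≠ M.reg 6 - 1 := by
        rintro rfl
        rw [hv] at hi2
        exact hw ((Fin.cast_eq_iff _ _).1 hi2).symm
      omega
    · exact Or.inr hq
  refine (h.pending u hu (by simp) hd).imp (key _ huP.1) (key _ fun e => huP.2 ?_)
  rw [← e, Γ.G.mateV_mateV]

theorem Core.popQueueP (h : Core Γ K M A ℓ l T ∅ ∅) (h7 : M.reg 7 < Γ.U.card) :
    ∃ v ∈ Γ.U, Core Γ K (exec (popQueueP K) M) A ℓ l T ∅ {v, Γ.G.mateV v} ∧
      (exec (popQueueP K) M).reg 14 = (v : ℕ) := by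
  obtain ⟨v, hvU, hv⟩ := h.fixed.queue_mem (M.reg 7) h.cursor.1 h7
  have hr : ∀ r, r ≠ 7 → r ≠ 14 → (exec (RAM.popQueueP K) M).reg r = M.reg r := fun r h1 h2 =>
    exec_reg (by simp [RAM.popQueueP, block, regs, h1, h2]) _
  have r7 : (exec (RAM.popQueueP K) M).reg 7 = M.reg 7 + 1 := by
    simp [RAM.popQueueP, block, exec, Memory.setReg, Term.eval]
  have ha : (exec (RAM.popQueueP K) M).arr = M.arr := rfl
  refine ⟨v, hvU, ?_, by rw [← hv]; simp [RAM.popQueueP, block, exec, Memory.setReg, Term.eval]⟩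
  refine { h with
    fixed := h.fixed.congr (hr _ (by norm_num) (by norm_num)) (hr _ (by norm_num) (by norm_num))
      (fun a _ => by rw [ha])
    graph := h.graph.congr (fun a _ _ _ => by rw [ha]) (hr _ (by norm_num) (by norm_num))
    log := h.log.congr fun a _ _ z _ => by rw [ha]
    log_length := by rw [hr _ (by norm_num) (by norm_num)]; exact h.log_length
    count := by rw [hr _ (by norm_num) (by norm_num)]; exact h.count
    top_nonneg := by rw [hr _ (by norm_num) (by norm_num)]; exact h.top_nonneg
    stack := by rw [hr _ (by norm_num) (by norm_num)]; exact h.stack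
    cursor := by rw [r7]; have := h.cursor; omega
    pending := ?_ }
  intro u hu huP hd
  simp only [Finset.mem_insert, Finset.mem_singleton, not_or] at huP
  have key : ∀ w : Fin n, w ≠ v → Pending K M w → Pending K (exec (RAM.popQueueP K) M) w := by
    rintro w hw (hs | ⟨i, hi0, hi1, hi2⟩)
    · exact Or.inl hs
    · refine Or.inr ⟨i, ?_, hi1, hi2⟩
      rw [r7]
      have : i ≠ M.reg 7 := by
        rintro rfl
        rw [hv] at hi2
        exact hw ((Fin.cast_eq_iff _ _).1 hi2).symm
      omega
  refine (h.pending u hu (by simp) hd).imp (key _ huP.1) (key _ fun e => huP.2 ?_)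
  rw [← e, Γ.G.mateV_mateV]

/-- With the cursor back at the start all nodes are pending, so the invariant holds for the doubled
threshold as for any other. -/
theorem Core.resetP (h : Core Γ K M A ℓ l T ∅ ∅) : Core Γ K (exec resetP M) A ℓ l T ∅ ∅ := by
  have hr : ∀ r, r ≠ 7 → r ≠ 8 → (exec RAM.resetP M).reg r = M.reg r := fun r h1 h2 =>
    exec_reg (by simp [RAM.resetP, block, regs, h1, h2]) _
  have r7 : (exec RAM.resetP M).reg 7 = 0 := by
    simp [RAM.resetP, block, exec, Memory.setReg, Term.eval]
  have ha : (exec RAM.resetP M).arr = M.arr := rfl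
  refine { h with
    fixed := h.fixed.congr (hr _ (by norm_num) (by norm_num)) (hr _ (by norm_num) (by norm_num))
      (fun a _ => by rw [ha])
    graph := h.graph.congr (fun a _ _ _ => by rw [ha]) (hr _ (by norm_num) (by norm_num))
    log := h.log.congr fun a _ _ z _ => by rw [ha]
    log_length := by rw [hr _ (by norm_num) (by norm_num)]; exact h.log_length
    count := by rw [hr _ (by norm_num) (by norm_num)]; exact h.count
    top_nonneg := by rw [hr _ (by norm_num) (by norm_num)]; exact h.top_nonneg
    stack := by rw [hr _ (by norm_num) (by norm_num)]; exact h.stack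
    cursor := by rw [r7]; exact ⟨le_rfl, by positivity⟩
    pending := ?_ }
  intro u hu _ _
  left
  obtain ⟨i, hi0, hi1, hi2⟩ := h.fixed.mem_queue u (h.subset hu)
  refine Or.inr ⟨i, by rwa [r7], ?_, by rwa [ha]⟩
  rw [hr _ (by norm_num) (by norm_num), h.fixed.reg_three]
  exact hi1

/-- If nothing is waiting then the threshold is small. -/
theorem Core.threshold_mul_card_le (h : Core Γ K M A ℓ l T ∅ ∅) (h6 : ¬ 1 ≤ M.reg 6)
    (h7 : M.reg 3 ≤ M.reg 7) : M.reg 8 * T.card ≤ 4 * m := by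
  have hp : ∀ u : Fin n, ¬ Pending K M u := by
    rintro u (⟨i, hi0, hi1, -⟩ | ⟨i, hi0, hi1, -⟩)
    · omega
    · omega
  -- Averaging: every remaining pair exceeds the threshold, while the right side is at most twice
  -- `size A`, which never exceeds `2 * m`.
  have h1 : ∑ u ∈ T, M.reg 8 ≤ ∑ u ∈ T, (deg A u + deg A (Γ.G.mateV u)) := by
    refine Finset.sum_le_sum fun u hu => ?_
    by_contra h2
    rcases h.pending u hu (by simp) (by omega) with h3 | h3
    · exact hp _ h3
    · exact hp _ h3
  rw [Finset.sum_const, nsmul_eq_mul, Finset.sum_add_distrib] at h1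
  have h2 : ∑ u ∈ T, deg A (Γ.G.mateV u) = ∑ u ∈ T, deg A u :=
    Finset.sum_nbij' Γ.G.mateV Γ.G.mateV h.mate_mem h.mate_mem
      (fun u _ => Γ.G.mateV_mateV u) (fun u _ => Γ.G.mateV_mateV u) (fun _ _ => rfl)
  have h3 : ∑ u ∈ T, deg A u ≤ size A :=
    Finset.sum_le_sum_of_subset_of_nonneg (Finset.subset_univ _) fun u _ _ => deg_nonneg A u
  have h4 := h.size_le
  linarith

/-- The number of candidates that are to be considered until the end. -/
noncomputable def load (Γ : Setup n m k) (M : Memory) : ℝ :=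
  M.reg 6 + (Γ.U.card - M.reg 7) +
    Γ.U.card * Real.logb 2 ((8 + 2 * k) * m / M.reg 8)

/-- Bounds for the threshold. -/
structure Bounded (k m : ℕ) (T : Finset (Fin n)) (D : ℤ) : Prop where
  pos : 1 ≤ D
  mul_card_le : D * T.card ≤ (8 + 2 * k) * m
  le : D ≤ (8 + 2 * k) * m

theorem Core.load_nonneg (h : Core Γ K M A ℓ l T R P) (hD : Bounded k m T (M.reg 8)) :
    (M.reg 6 : ℝ) ≤ load Γ M := by
  have h1 : (M.reg 7 : ℝ) ≤ Γ.U.card := by exact_mod_cast h.cursor.2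
  have h2 : (0 : ℝ) < M.reg 8 := by exact_mod_cast hD.pos
  have h3 : (M.reg 8 : ℝ) ≤ (8 + 2 * k) * m := by exact_mod_cast hD.le
  have h4 : 0 ≤ Real.logb 2 ((8 + 2 * k) * m / M.reg 8) :=
    Real.logb_nonneg (by norm_num) (by rwa [one_le_div h2])
  have h5 : (0 : ℝ) ≤ Γ.U.card * Real.logb 2 ((8 + 2 * k) * m / M.reg 8) := by positivity
  unfold load
  linarith

/-- Taking a candidate from the stack or the queue uses up one unit of `load`. Refilling the queue
is free in terms of `load`, since doubling the threshold lowers the logarithm. -/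
theorem Core.fetchP (h : Core Γ K M A ℓ l T ∅ ∅) (hT : T.Nonempty)
    (hD : Bounded k m T (M.reg 8)) :
    ∃ v ∈ Γ.U, Core Γ K (exec (fetchP K) M) A ℓ l T ∅ {v, Γ.G.mateV v} ∧
      (exec (fetchP K) M).reg 14 = (v : ℕ) ∧ Bounded k m T ((exec (fetchP K) M).reg 8) ∧
      load Γ (exec (fetchP K) M) + 1 ≤ load Γ M := by
  have hTc : 1 ≤ T.card := hT.card_pos
  have hUc : 1 ≤ Γ.U.card := (hT.mono h.subset).card_pos
  by_cases h6 : 1 ≤ M.reg 6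
  · have e : exec (RAM.fetchP K) M = exec (RAM.popStackP K) M := by
      have h6' : Test.Holds M (.le (.const 1) (.reg 6)) := h6
      simp only [RAM.fetchP, exec, if_pos h6']
    rw [e]
    obtain ⟨v, h1, h2, h3⟩ := h.popStackP h6
    have hr : ∀ r, r ≠ 6 → r ≠ 14 → (exec (RAM.popStackP K) M).reg r = M.reg r := fun r h1 h2 =>
      exec_reg (by simp [RAM.popStackP, block, regs, h1, h2]) _
    have r6 : (exec (RAM.popStackP K) M).reg 6 = M.reg 6 - 1 := by
      simp [RAM.popStackP, block, exec, Memory.setReg, Term.eval]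
    have r8 := hr 8 (by norm_num) (by norm_num)
    refine ⟨v, h1, h2, h3, by rwa [r8], ?_⟩
    rw [load, load, r6, r8, hr 7 (by norm_num) (by norm_num)]
    push_cast
    linarith
  · have h3 := h.fixed.reg_three
    have h6' : ¬ Test.Holds M (.le (.const 1) (.reg 6)) := h6
    obtain ⟨M1, e, c1, q7, hD1, hl⟩ : ∃ M1, exec (RAM.fetchP K) M = exec (RAM.popQueueP K) M1 ∧
        Core Γ K M1 A ℓ l T ∅ ∅ ∧ M1.reg 7 < Γ.U.card ∧ Bounded k m T (M1.reg 8) ∧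
        load Γ M1 = load Γ M := by
      by_cases h7 : M.reg 3 ≤ M.reg 7
      · refine ⟨exec RAM.resetP M, ?_, h.resetP, ?_, ?_, ?_⟩
        · have h7' : Test.Holds M (.le (.reg 3) (.reg 7)) := h7
          simp only [RAM.fetchP, exec, if_neg h6', if_pos h7']
        · have : (exec RAM.resetP M).reg 7 = 0 := by
            simp [RAM.resetP, block, exec, Memory.setReg, Term.eval]
          rw [this]; omega
        · have r8 : (exec RAM.resetP M).reg 8 = M.reg 8 + M.reg 8 := by
            simp [RAM.resetP, block, exec, Memory.setReg, Term.eval]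
          -- Doubling `4 * m` gives at most `8 * m`, within `Bounded`; the bound for the threshold
          -- itself follows as `T` is nonempty.
          have hb := h.threshold_mul_card_le h6 h7
          have hk : (0 : ℤ) ≤ 2 * k * m := by positivity
          have hT' : (1 : ℤ) ≤ T.card := by exact_mod_cast hTc
          rw [r8]
          refine ⟨by have := hD.pos; omega, by nlinarith, ?_⟩
          have := hD.pos
          nlinarith
        · have r8 : (exec RAM.resetP M).reg 8 = 2 * M.reg 8 := by
            simp [RAM.resetP, block, exec, Memory.setReg, Term.eval]; ring
          have r7 : (exec RAM.resetP M).reg 7 = 0 := by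
            simp [RAM.resetP, block, exec, Memory.setReg, Term.eval]
          have r6 : (exec RAM.resetP M).reg 6 = M.reg 6 := by
            simp [RAM.resetP, block, exec, Memory.setReg, Term.eval]
          have e7 : M.reg 7 = Γ.U.card := by have := h.cursor; omega
          have p1 : (0 : ℝ) < M.reg 8 := by exact_mod_cast hD.pos
          have p2 : (M.reg 8 : ℝ) ≤ (8 + 2 * k) * m := by exact_mod_cast hD.le
          rw [load, load, r6, r7, r8, e7]
          -- The logarithm drops by one, which releases `Γ.U.card` units, exactly the length of the
          -- refilled queue.
          have : Real.logb 2 ((8 + 2 * k) * m / ((2 * M.reg 8 : ℤ) : ℝ)) =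
              Real.logb 2 ((8 + 2 * k) * m / M.reg 8) - 1 := by
            push_cast
            rw [mul_comm (2 : ℝ) (M.reg 8 : ℝ), ← div_div, Real.logb_div _ (by norm_num),
              Real.logb_self_eq_one (by norm_num)]
            have : 0 < (8 + 2 * (k : ℝ)) * m / M.reg 8 := div_pos (p1.trans_le p2) p1
            exact this.ne'
          rw [this]
          push_cast
          ring
      · refine ⟨M, ?_, h, by omega, hD, rfl⟩
        have h7' : ¬ Test.Holds M (.le (.reg 3) (.reg 7)) := h7
        simp only [RAM.fetchP, exec, if_neg h6', if_neg h7']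
    rw [e]
    obtain ⟨v, h1, h2, h3⟩ := c1.popQueueP q7
    have hr : ∀ r, r ≠ 7 → r ≠ 14 → (exec (RAM.popQueueP K) M1).reg r = M1.reg r := fun r h1 h2 =>
      exec_reg (by simp [RAM.popQueueP, block, regs, h1, h2]) _
    have r7 : (exec (RAM.popQueueP K) M1).reg 7 = M1.reg 7 + 1 := by
      simp [RAM.popQueueP, block, exec, Memory.setReg, Term.eval]
    have r8 := hr 8 (by norm_num) (by norm_num)
    refine ⟨v, h1, h2, h3, by rwa [r8], ?_⟩
    rw [← hl, load, load, r7, r8, hr 6 (by norm_num) (by norm_num)]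
    push_cast
    linarith

/-- Nonzero cells lead only to nodes still present or to terminals. -/
theorem Core.deg_le (h : Core Γ K M A ℓ l T ∅ P) (v : Fin n) : deg A v ≤ T.card + k + 1 := by
  have h1 : deg A v ≤ (T ∪ Finset.univ.image Γ.s).card + 1 := by
    refine deg_le_card fun y hy => ?_
    by_contra h2
    simp only [Finset.mem_union, Finset.mem_image, Finset.mem_univ, true_and, not_or,
      not_exists] at h2
    rw [h.weight.symm] at hy
    exact hy (h.zero y h2.1 (by simp) (fun i e => h2.2 i e.symm) v)
  have h2 : (T ∪ Finset.univ.image Γ.s).card ≤ T.card + k := by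
    refine (Finset.card_union_le _ _).trans (Nat.add_le_add_left ?_ _)
    exact Finset.card_image_le.trans (by simp)
  have h3 : ((T ∪ Finset.univ.image Γ.s).card : ℤ) ≤ T.card + k := by exact_mod_cast h2
  linarith

/-- The time needed for the elimination of `i` nodes, up to a constant factor. -/
noncomputable def elimTime (k m : ℕ) (i : ℝ) : ℝ :=
  (8 + 2 * k) * (m * Real.log (m + i ^ 2) - m * Real.log m)

theorem elimTime_nonneg (k m : ℕ) (i : ℝ) : 0 ≤ elimTime k m i := by
  unfold elimTime
  rcases Nat.eq_zero_or_pos m with rfl | hm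
  · simp
  · have hm' : (0 : ℝ) < m := by exact_mod_cast hm
    have : Real.log m ≤ Real.log (m + i ^ 2) := Real.log_le_log hm' (by nlinarith)
    have : (m : ℝ) * Real.log m ≤ m * Real.log (m + i ^ 2) :=
      mul_le_mul_of_nonneg_left this hm'.le
    have : (0 : ℝ) ≤ (8 + 2 * k) := by positivity
    apply mul_nonneg this; linarith

theorem halts_mainP (hm : 1 ≤ m) (h : Core Γ K M A ℓ l T ∅ ∅) (hD : Bounded k m T (M.reg 8))
    {C x w : ℝ} (hw : 0 ≤ w)
    (hC : (bound (scanP K) : ℝ) + (scanTest K).cost + bound (startP K) + bound (fetchP K) +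
      (lowTest K).cost + 10 ≤ C)
    (hx : C * (∑ a, ((ℓ a).length : ℝ) + load Γ M + 10 * elimTime k m T.card +
      6 * T.card + 1) + w ≤ x) :
    Halts (mainP K) M x fun N y => ∃ A' ℓ' l', Core Γ K N A' ℓ' l' ∅ ∅ ∅ ∧ w ≤ y := by
  have n1 : (0 : ℝ) ≤ bound (scanP K) := Nat.cast_nonneg _
  have n2 : (0 : ℝ) ≤ (scanTest K).cost := Nat.cast_nonneg _
  have n3 : (0 : ℝ) ≤ bound (startP K) := Nat.cast_nonneg _
  have n4 : (0 : ℝ) ≤ bound (fetchP K) := Nat.cast_nonneg _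
  have n5 : (0 : ℝ) ≤ (lowTest K).cost := Nat.cast_nonneg _
  have hC0 : 0 ≤ C := by linarith
  have hm0 : (0 : ℝ) < m := by exact_mod_cast hm
  have hcost : ((Test.le (.const 1) (.reg 4)).cost : ℝ) = 3 := by simp [Test.cost, Term.cost]
  -- The load pays for fetching and testing one candidate per round, `elimTime` for the degrees of
  -- eliminated pairs, and 6 per remaining node for the fixed costs of an elimination.
  refine Halts.loop (I := fun N y => ∃ A' ℓ' l' T', Core Γ K N A' ℓ' l' T' ∅ ∅ ∧
    Bounded k m T' (N.reg 8) ∧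
    C * (∑ a, ((ℓ' a).length : ℝ) + load Γ N + 10 * elimTime k m T'.card + 6 * T'.card + 1) + w ≤
      y) ?_ ?_ ?_ ⟨A, ℓ, l, T, h, hD, hx⟩
  · rintro N y ⟨A', ℓ', l', T', c, hD', hy⟩
    refine le_trans ?_ hy
    have h1 := c.load_nonneg hD'
    have h2 : (0 : ℝ) ≤ N.reg 6 := by exact_mod_cast c.top_nonneg
    have h3 := elimTime_nonneg k m T'.card
    have h4 : (0 : ℝ) ≤ ∑ a, ((ℓ' a).length : ℝ) := by positivity
    have h5 : (0 : ℝ) ≤ T'.card := Nat.cast_nonneg _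
    have : 0 ≤ C * (∑ a, ((ℓ' a).length : ℝ) + load Γ N + 10 * elimTime k m T'.card +
      6 * T'.card + 1) := mul_nonneg hC0 (by linarith)
    linarith
  · rintro N y ⟨A', ℓ', l', T', c, hD', hy⟩ hb
    simp only [Test.Holds, Term.eval, c.count] at hb
    have hT' : T'.Nonempty := Finset.card_pos.1 (by exact_mod_cast hb)
    obtain ⟨v, hvU, c1, r14, hD1, hl1⟩ := c.fetchP hT' hD'
    refine Halts.seq (Halts.of_loopFree (loopFree_fetchP K) fun y1 hy1 => ?_)
    rw [hcost] at hy1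
    set N1 := exec (fetchP K) N
    have e1 : N1.arr (K + 18) (v : ℕ) = if v ∈ T' then 0 else 1 := c1.done v hvU
    have e2 : N1.arr 3 (v : ℕ) = (Γ.G.mateV v : ℕ) := c1.fixed.mate_eq v
    have e3 := c1.graph.deg_eq v hvU
    have e4 := c1.graph.deg_eq _ (Γ.mate_mem v hvU)
    have hy2 : C * (∑ a, ((ℓ' a).length : ℝ) + load Γ N1 + 10 * elimTime k m T'.card +
        6 * T'.card + 1) + w ≤ y1 - ((lowTest K).cost + 1) - 1 := by
      have := mul_le_mul_of_nonneg_left hl1 hC0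
      linarith
    refine Halts.branch (fun ht => ?_) (fun ht => ?_)
    · simp only [lowTest, Test.Holds, Term.eval, r14, e1, e2, e3, e4] at ht
      have hvT : v ∈ T' := by
        by_contra h1
        rw [if_neg h1] at ht
        exact absurd ht.1 one_ne_zero
      have hd := ht.2
      set d := deg A' v + deg A' (Γ.G.mateV v) with hdd
      have hd0 : 0 ≤ d := add_nonneg (deg_nonneg _ _) (deg_nonneg _ _)
      have hsub : ({v, Γ.G.mateV v} : Finset (Fin n)) ⊆ T' := by
        intro x hx
        simp only [Finset.mem_insert, Finset.mem_singleton] at hx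
        rcases hx with rfl | rfl
        · exact hvT
        · exact c1.mate_mem _ hvT
      have hc2 : ({v, Γ.G.mateV v} : Finset (Fin n)).card = 2 :=
        Finset.card_pair (Γ.G.mateV_ne v).symm
      have hle2 : 2 ≤ T'.card := hc2 ▸ Finset.card_le_card hsub
      have hcard : (T' \ {v, Γ.G.mateV v}).card + 2 = T'.card := by
        rw [Finset.card_sdiff_of_subset hsub, hc2]; omega
      have hcardR : ((T' \ {v, Γ.G.mateV v}).card : ℝ) = T'.card - 2 := by
        rw [← hcard]; push_cast; ring
      have hdi : d * T'.card ≤ (8 + 2 * k) * m :=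
        (mul_le_mul_of_nonneg_right hd (by positivity)).trans hD1.mul_card_le
      -- Twice the bound of `Core.deg_le`, the constants being absorbed by `T'.card ≥ 2`.
      have hdk : d ≤ (8 + 2 * k) * T'.card := by
        have a1 := c1.deg_le v
        have a2 := c1.deg_le (Γ.G.mateV v)
        have a3 : (2 : ℤ) ≤ T'.card := by exact_mod_cast hle2
        have a4 : (k : ℤ) * 1 ≤ k * T'.card :=
          mul_le_mul_of_nonneg_left (by linarith) (by positivity)
        linarith
      have hlog : (d : ℝ) + elimTime k m (T' \ {v, Γ.G.mateV v}).card ≤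
          elimTime k m T'.card := by
        have := le_mul_log_sub_log (d := d) (i := T'.card) (m := m) (κ := 8 + 2 * k) hm0
          (by exact_mod_cast hle2) (by positivity) (by exact_mod_cast hdi)
          (by exact_mod_cast hdk)
        rw [hcardR]
        unfold elimTime
        linarith
      have hl0 := c1.load_nonneg hD1
      -- This is the part of the credit that the elimination hands through untouched. The height of
      -- the stack is excluded, as it is part of the potential inside `halts_elimP`.
      have hw' : (0 : ℝ) ≤ C * ((load Γ N1 - N1.reg 6) +
          10 * elimTime k m (T' \ {v, Γ.G.mateV v}).card +
          6 * (T' \ {v, Γ.G.mateV v}).card + 1) + w := by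
        have := elimTime_nonneg k m (T' \ {v, Γ.G.mateV v}).card
        have : (0 : ℝ) ≤ (T' \ {v, Γ.G.mateV v}).card := Nat.cast_nonneg _
        have : (0 : ℝ) ≤ C * ((load Γ N1 - N1.reg 6) +
          10 * elimTime k m (T' \ {v, Γ.G.mateV v}).card +
          6 * (T' \ {v, Γ.G.mateV v}).card + 1) := mul_nonneg hC0 (by linarith)
        linarith
      refine (halts_elimP c1 r14 hvT (C := C) hw' (by linarith) ?_).mono ?_
      · have p1 := mul_le_mul_of_nonneg_left hlog hC0
        rw [← hdd, hcardR]
        rw [hcardR] at p1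
        rw [mul_add] at p1
        nlinarith
      · rintro N2 y2 ⟨A2, ℓ2, l2, c2, ⟨q7, q8⟩, hy3⟩
        refine ⟨A2, ℓ2, l2, _, c2, ?_, ?_⟩
        · rw [q8]
          refine ⟨hD1.pos, le_trans ?_ hD1.mul_card_le, hD1.le⟩
          refine mul_le_mul_of_nonneg_left ?_ (by have := hD1.pos; omega)
          exact_mod_cast Finset.card_le_card Finset.sdiff_subset
        · have : load Γ N2 - N2.reg 6 = load Γ N1 - N1.reg 6 := by
            unfold load; rw [q7, q8]; ring
          rw [← this] at hy3
          linarith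
    · refine Halts.of_loopFree trivial fun y2 hy3 => ?_
      change ∃ A' ℓ' l' T', Core Γ K N1 A' ℓ' l' T' ∅ ∅ ∧ _
      refine ⟨A', ℓ', l', T', { c1 with pending := fun u hu _ hd => ?_ }, hD1, ?_⟩
      -- A rejected candidate is either absent or above the threshold, so the exemption of its pair
      -- can be lifted.
      · by_cases hu' : u ∈ ({v, Γ.G.mateV v} : Finset (Fin n))
        · exfalso
          apply ht
          simp only [lowTest, Test.Holds, Term.eval, r14, e1, e2, e3, e4]
          simp only [Finset.mem_insert, Finset.mem_singleton] at hu'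
          rcases hu' with rfl | rfl
          · exact ⟨by rw [if_pos hu], hd⟩
          · have := c1.mate_mem _ hu
            rw [Γ.G.mateV_mateV] at this hd
            exact ⟨by rw [if_pos this], by linarith⟩
        · exact c1.pending u hu hu' hd
      · simp only [bound] at hy3
        push_cast at hy3
        change C * (∑ a, ((ℓ' a).length : ℝ) + load Γ N1 + 10 * elimTime k m T'.card +
          6 * T'.card + 1) + w ≤ y2
        linarith
  · rintro N y ⟨A', ℓ', l', T', c, hD', hy⟩ hb
    simp only [Test.Holds, Term.eval, c.count] at hb
    have hT' : T' = ∅ := by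
      rw [← Finset.card_eq_zero]; omega
    subst hT'
    refine ⟨A', ℓ', l', c, ?_⟩
    rw [hcost]
    have h1 := c.load_nonneg hD'
    have h2 : (0 : ℝ) ≤ N.reg 6 := by exact_mod_cast c.top_nonneg
    have h3 := elimTime_nonneg k m (∅ : Finset (Fin n)).card
    have h4 : (0 : ℝ) ≤ ∑ a, ((ℓ' a).length : ℝ) := by positivity
    have : C * 1 ≤ C * (∑ a, ((ℓ' a).length : ℝ) + load Γ N +
      10 * elimTime k m (∅ : Finset (Fin n)).card + 6 * (∅ : Finset (Fin n)).card + 1) :=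
      mul_le_mul_of_nonneg_left (by simp only [Finset.card_empty, Nat.cast_zero] at *; linarith) hC0
    linarith

end RAM

/-! ### Assigning matrix rows and queue places to the relevant nodes -/

namespace RAM

open SymMatrix

/-- Give a row of the matrix and a place in the queue to the node in the register 11, unless it
already has them. -/
def touchP (K : ℕ) : Program :=
  .branch (.eq (.read (K + 6) (.reg 11)) (.const 0)) (block [
    .write (K + 6) (.reg 11) (.reg 2), .assign 2 (.plus (.reg 2) (.reg 0)),
    .write (K + 7) (.reg 3) (.reg 11), .assign 3 (.plus (.reg 3) (.const 1))]) .skip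

/-- Rows and places in the queue for the node given by `p` and its mate. -/
def touchPairP (K : ℕ) (p : Term) : Program := block [
  .assign 11 p, touchP K, .assign 11 (.read 3 (.reg 11)), touchP K]

/-- Rows and places in the queue for `i` terminals and their mates. -/
def touchTerminalsP (K : ℕ) : ℕ → Program
  | 0 => .skip
  | i + 1 => .seq (touchTerminalsP K i) (touchPairP K (.read 5 (.const i)))

theorem loopFree_touchPairP (K : ℕ) (p : Term) : LoopFree (touchPairP K p) := by
  simp [touchPairP, touchP, block, LoopFree]

theorem loopFree_touchTerminalsP (K i : ℕ) : LoopFree (touchTerminalsP K i) := by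
  induction i with
  | zero => trivial
  | succ i ih => exact ⟨ih, loopFree_touchPairP _ _⟩

theorem regs_touchPairP {K r : ℕ} {p : Term} (h : r ∈ regs (touchPairP K p)) :
    r = 2 ∨ r = 3 ∨ r = 11 := by
  simp [touchPairP, touchP, block, regs] at h
  omega

theorem arrs_touchPairP {K a : ℕ} {p : Term} (h : a ∈ arrs (touchPairP K p)) :
    a = K + 6 ∨ a = K + 7 := by
  simp [touchPairP, touchP, block, arrs] at h
  omega

theorem regs_touchTerminalsP {K i r : ℕ} (h : r ∈ regs (touchTerminalsP K i)) :
    r = 2 ∨ r = 3 ∨ r = 11 := by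
  induction i with
  | zero => exact h.elim
  | succ i ih => exact h.elim ih regs_touchPairP

theorem arrs_touchTerminalsP {K i a : ℕ} (h : a ∈ arrs (touchTerminalsP K i)) :
    a = K + 6 ∨ a = K + 7 := by
  induction i with
  | zero => exact h.elim
  | succ i ih => exact h.elim ih arrs_touchPairP

variable {n m k K : ℕ} {M N : Memory} {U : Finset (Fin n)}

/-- The nodes in `U` have rows of the matrix and places in the queue. -/
structure TouchRep (m K : ℕ) (M : Memory) (U : Finset (Fin n)) : Prop where
  reg_two : M.reg 2 = m + n * U.card
  reg_three : M.reg 3 = U.card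
  off_eq_zero : ∀ x, x ∉ U → M.arr (K + 6) (x : ℕ) = 0
  place : ∀ x ∈ U, ∃ i < U.card, M.arr (K + 6) (x : ℕ) = m + n * i ∧ M.arr (K + 7) i = (x : ℕ)
  queue : ∀ i < U.card, ∃ x ∈ U, M.arr (K + 7) i = (x : ℕ)

theorem TouchRep.congr (h : TouchRep m K M U) (h2 : N.reg 2 = M.reg 2) (h3 : N.reg 3 = M.reg 3)
    (ha : ∀ a, a = K + 6 ∨ a = K + 7 → N.arr a = M.arr a) : TouchRep m K N U where
  reg_two := by rw [h2]; exact h.reg_two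
  reg_three := by rw [h3]; exact h.reg_three
  off_eq_zero := by rw [ha _ (by omega)]; exact h.off_eq_zero
  place := by rw [ha _ (by omega), ha _ (by omega)]; exact h.place
  queue := by rw [ha _ (by omega)]; exact h.queue

/-- Positions of rows start at `m ≥ 1`, so the initial value zero marks a node without a row. The
next free position is kept in a register and advanced by `n`, which avoids multiplication. -/
theorem TouchRep.touchP (h : TouchRep m K M U) (hm : 1 ≤ m) (h0 : M.reg 0 = n) {x : Fin n}
    (hx : M.reg 11 = (x : ℕ)) : TouchRep m K (exec (touchP K) M) (insert x U) := by
  by_cases hxU : x ∈ U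
  · obtain ⟨i, -, h1, -⟩ := h.place x hxU
    have h2 : ¬ Test.Holds M (.eq (.read (K + 6) (.reg 11)) (.const 0)) := by
      simp only [Test.Holds, Term.eval, hx, h1]
      have : (0 : ℤ) ≤ n * i := by positivity
      omega
    rw [Finset.insert_eq_of_mem hxU]
    simp only [RAM.touchP, exec, if_neg h2]
    exact h
  · have h2 : Test.Holds M (.eq (.read (K + 6) (.reg 11)) (.const 0)) := by
      simp only [Test.Holds, Term.eval, hx, h.off_eq_zero x hxU]
    have hc := Finset.card_insert_of_notMem hxU
    have e6 : (exec (RAM.touchP K) M).arr (K + 6) =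
        Function.update (M.arr (K + 6)) (x : ℕ) (m + n * U.card) := by
      simp only [RAM.touchP, exec, if_pos h2]
      simp [block, exec, Term.eval, Memory.setReg, Memory.setArr, hx, h.reg_two]
    have e7 : (exec (RAM.touchP K) M).arr (K + 7) =
        Function.update (M.arr (K + 7)) U.card (x : ℕ) := by
      simp only [RAM.touchP, exec, if_pos h2]
      simp [block, exec, Term.eval, Memory.setReg, Memory.setArr, hx, h.reg_three]
    have hne : ∀ y : Fin n, y ≠ x → ((y : ℕ) : ℤ) ≠ (x : ℕ) := fun y hy e =>
      hy ((Fin.cast_eq_iff _ _).1 e)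
    constructor
    · simp only [RAM.touchP, exec, if_pos h2]
      simp [block, exec, Term.eval, Memory.setReg, Memory.setArr, h.reg_two, h0, hc]
      ring
    · simp only [RAM.touchP, exec, if_pos h2]
      simp [block, exec, Term.eval, Memory.setReg, Memory.setArr, h.reg_three, hc]
    · intro y hy
      simp only [Finset.mem_insert, not_or] at hy
      rw [e6, Function.update_of_ne (hne y hy.1)]
      exact h.off_eq_zero y hy.2
    · intro y hy
      by_cases hyx : y = x
      · subst hyx
        exact ⟨U.card, by omega, by rw [e6, Function.update_self],
          by rw [e7, Function.update_self]⟩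
      · obtain ⟨i, hi, h3, h4⟩ := h.place y ((Finset.mem_insert.1 hy).resolve_left hyx)
        refine ⟨i, by omega, by rw [e6, Function.update_of_ne (hne y hyx), h3], ?_⟩
        rw [e7, Function.update_of_ne (by omega), h4]
    · intro i hi
      by_cases hiU : i = U.card
      · subst hiU
        exact ⟨x, Finset.mem_insert_self _ _, by rw [e7, Function.update_self]⟩
      · obtain ⟨y, hy, h3⟩ := h.queue i (by omega)
        exact ⟨y, Finset.mem_insert_of_mem hy, by rw [e7, Function.update_of_ne (by omega), h3]⟩

/-- The part of the memory that is not concerned by the assignment of rows. -/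
structure Untouched (G : SkewGraph (Fin n) (Fin m)) (s : Fin k → Fin n) (f : Fin m → ℤ) (K : ℕ)
    (M : Memory) : Prop where
  reg_eq : ∀ r, r ≠ 2 → r ≠ 3 → r ≠ 10 → r ≠ 11 → M.reg r = (input G s f).reg r
  arr_eq : ∀ a, a ≠ K + 6 → a ≠ K + 7 → M.arr a = (input G s f).arr a

variable {G : SkewGraph (Fin n) (Fin m)} {s : Fin k → Fin n} {f : Fin m → ℤ}

theorem Untouched.exec (h : Untouched G s f K M) {P : Program}
    (hr : ∀ r ∈ regs P, r = 2 ∨ r = 3 ∨ r = 10 ∨ r = 11)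
    (ha : ∀ a ∈ arrs P, a = K + 6 ∨ a = K + 7) : Untouched G s f K (exec P M) where
  reg_eq r h1 h2 h3 h4 := by
    rw [exec_reg fun hP => by have := hr r hP; omega]
    exact h.reg_eq r h1 h2 h3 h4
  arr_eq a h1 h2 := by
    rw [exec_arr fun hP => by have := ha a hP; omega]
    exact h.arr_eq a h1 h2

theorem Untouched.touchPairP (h : Untouched G s f K M) (p : Term) :
    Untouched G s f K (RAM.exec (touchPairP K p) M) :=
  h.exec (fun r hr => by have := regs_touchPairP hr; omega) fun _ => arrs_touchPairP

/-- The set `U` with the node `x` and its mate. -/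
def insertPair (G : SkewGraph (Fin n) (Fin m)) (U : Finset (Fin n)) (x : Fin n) :
    Finset (Fin n) :=
  insert (G.mateV x) (insert x U)

theorem card_insertPair_le (U : Finset (Fin n)) (x : Fin n) :
    (insertPair G U x).card ≤ U.card + 2 :=
  (Finset.card_insert_le _ _).trans (by have := Finset.card_insert_le x U; omega)

theorem mate_mem_insertPair (hU : ∀ x ∈ U, G.mateV x ∈ U) (x : Fin n) :
    ∀ y ∈ insertPair G U x, G.mateV y ∈ insertPair G U x := by
  intro y hy
  simp only [insertPair, Finset.mem_insert] at hy ⊢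
  rcases hy with rfl | rfl | hy
  · right; left; exact G.mateV_mateV x
  · left; rfl
  · right; right; exact hU y hy

theorem TouchRep.touchPairP (h : TouchRep m K M U) (hu : Untouched G s f K M) (hK : 1 ≤ K)
    (hm : 1 ≤ m) {x : Fin n} {p : Term} (hx : p.eval M = (x : ℕ)) :
    TouchRep m K (exec (touchPairP K p) M) (insertPair G U x) := by
  have h0 : M.reg 0 = n := hu.reg_eq 0 (by norm_num) (by norm_num) (by norm_num) (by norm_num)
  have e : exec (RAM.touchPairP K p) M = exec (RAM.touchP K)
    ((exec (RAM.touchP K) (M.setReg 11 (p.eval M))).setReg 11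
      ((exec (RAM.touchP K) (M.setReg 11 (p.eval M))).arr 3
        ((exec (RAM.touchP K) (M.setReg 11 (p.eval M))).reg 11))) := rfl
  rw [e]
  have h1 : TouchRep m K (M.setReg 11 (p.eval M)) U := h.congr rfl rfl fun _ _ => rfl
  have h2 := h1.touchP hm (by simpa [Memory.setReg] using h0) (x := x) (by simp [Memory.setReg, hx])
  have hr : ∀ N : Memory, ∀ r, r ≠ 2 → r ≠ 3 → (exec (RAM.touchP K) N).reg r = N.reg r :=
    fun N r h1 h2 => exec_reg (by simp [RAM.touchP, block, regs, h1, h2]) _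
  have e11 : (exec (RAM.touchP K) (M.setReg 11 (p.eval M))).reg 11 = (x : ℕ) := by
    rw [hr _ _ (by norm_num) (by norm_num)]; simp [Memory.setReg, hx]
  have e3 : (exec (RAM.touchP K) (M.setReg 11 (p.eval M))).arr 3 = M.arr 3 :=
    exec_arr (by simp [RAM.touchP, block, arrs]) _
  have e3' : M.arr 3 (x : ℕ) = (G.mateV x : ℕ) := by
    rw [hu.arr_eq 3 (by omega) (by omega)]
    exact table_apply _ x
  rw [e11, e3, e3']
  refine TouchRep.touchP ?_ hm ?_ ?_
  · exact h2.congr rfl rfl fun _ _ => rfl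
  · simp only [Memory.setReg, ne_eq, OfNat.zero_ne_ofNat, not_false_eq_true,
      Function.update_of_ne]
    rw [hr _ _ (by norm_num) (by norm_num)]
    simpa [Memory.setReg] using h0
  · simp [Memory.setReg]

theorem TouchRep.touchTerminalsP (h : TouchRep m K M (∅ : Finset (Fin n)))
    (hu : Untouched G s f K M) (hK : 1 ≤ K) (hm : 1 ≤ m) (i : ℕ) (hi : i ≤ k) :
    ∃ U : Finset (Fin n), TouchRep m K (exec (touchTerminalsP K i) M) U ∧
      (∀ x ∈ U, G.mateV x ∈ U) ∧ (∀ j : Fin k, (j : ℕ) < i → s j ∈ U) ∧ U.card ≤ 2 * i := by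
  induction i with
  | zero => exact ⟨∅, h, by simp, by simp, by simp⟩
  | succ i ih =>
    obtain ⟨U, h1, h2, h3, h4⟩ := ih (by omega)
    have hu' : Untouched G s f K (exec (RAM.touchTerminalsP K i) M) :=
      hu.exec (fun r hr => by have := regs_touchTerminalsP hr; omega)
        fun _ => arrs_touchTerminalsP
    refine ⟨insertPair G U (s ⟨i, hi⟩), ?_, mate_mem_insertPair h2 _, ?_, ?_⟩
    · refine h1.touchPairP hu' hK hm ?_
      simp only [Term.eval]
      rw [hu'.arr_eq 5 (by omega) (by omega)]
      exact table_apply (fun i => ((s i : ℕ) : ℤ)) ⟨i, hi⟩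
    · intro j hj
      simp only [insertPair, Finset.mem_insert]
      by_cases hji : (j : ℕ) = i
      · right; left; congr 1; exact Fin.ext hji
      · right; right; exact h3 j (by omega)
    · have := card_insertPair_le (G := G) U (s ⟨i, hi⟩)
      omega

/-- Rows and places in the queue for the tails of all arcs. -/
def touchTailsP (K : ℕ) : Program :=
  .loop (.le (.const 1) (.reg 10))
    (.seq (.assign 10 (.minus (.reg 10) (.const 1))) (touchPairP K (.read 0 (.reg 10))))

/-- Rows and places in the queue for the terminals and the ends of all arcs, and their mates. -/
def touchAllP (k K : ℕ) : Program :=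
  .seq (.seq (.assign 2 (.reg 1)) (.seq (touchTerminalsP K k) (.assign 10 (.reg 1))))
    (touchTailsP K)

/-- Heads are covered as well: the head of an arc is the mate of the tail of the mated arc, and the
set is closed under mates. Each arc adds at most two nodes, so the time does not depend on `n`. -/
theorem halts_touchTailsP (hu : Untouched G s f K M) (h : TouchRep m K M U)
    (hK : 1 ≤ K) (hm : 1 ≤ m) (hU : ∀ x ∈ U, G.mateV x ∈ U) (hc : U.card ≤ 2 * k)
    (h10 : M.reg 10 = m) {C x w : ℝ} (hw : 0 ≤ w)
    (hC : (bound (touchPairP K (.read 0 (.reg 10))) : ℝ) + 10 ≤ C)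
    (hx : C * (m + 1) + w ≤ x) :
    Halts (touchTailsP K) M x fun N y => ∃ U' : Finset (Fin n), Untouched G s f K N ∧
      TouchRep m K N U' ∧ (∀ x ∈ U', G.mateV x ∈ U') ∧ U ⊆ U' ∧ (∀ e, G.tail e ∈ U') ∧
      U'.card ≤ 2 * m + 2 * k ∧ w ≤ y := by
  have n1 : (0 : ℝ) ≤ bound (touchPairP K (.read 0 (.reg 10))) := Nat.cast_nonneg _
  have hcost : ((Test.le (.const 1) (.reg 10)).cost : ℝ) = 3 := by simp [Test.cost, Term.cost]
  refine Halts.loop (I := fun N y => ∃ (U' : Finset (Fin n)) (i : ℕ), Untouched G s f K N ∧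
    TouchRep m K N U' ∧ (∀ x ∈ U', G.mateV x ∈ U') ∧ U ⊆ U' ∧
    (N.reg 10 = i ∧ i ≤ m) ∧ (∀ e : Fin m, i ≤ (e : ℕ) → G.tail e ∈ U') ∧
    U'.card ≤ 2 * (m - i) + 2 * k ∧ C * (i + 1) + w ≤ y) ?_ ?_ ?_ ?_
  · rintro N y ⟨U', i, -, -, -, -, -, -, -, hy⟩
    refine le_trans ?_ hy
    have : 0 ≤ C := by linarith
    positivity
  · rintro N y ⟨U', i, c1, c2, c3, c4, ⟨c5, c5'⟩, c6, c7, hy⟩ hb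
    simp only [Test.Holds, Term.eval, c5] at hb
    have hi : 1 ≤ i := by omega
    have hi' : i - 1 < m := by omega
    refine Halts.of_loopFree ⟨trivial, loopFree_touchPairP _ _⟩ fun y' hy' => ?_
    simp only [exec]
    set N1 := N.setReg 10 (Term.eval N (.minus (.reg 10) (.const 1)))
    have r10 : N1.reg 10 = (i - 1 : ℕ) := by
      simp only [N1, Memory.setReg, Term.eval, c5, Function.update_self]
      omega
    have u1 : Untouched G s f K N1 := ⟨fun r h1 h2 h3 h4 => by
      simp only [N1, Memory.setReg, Function.update_of_ne h3]
      exact c1.reg_eq r h1 h2 h3 h4, c1.arr_eq⟩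
    have t1 : TouchRep m K N1 U' := c2.congr (by simp [N1, Memory.setReg])
      (by simp [N1, Memory.setReg]) fun _ _ => rfl
    have ht : (Term.read 0 (.reg 10)).eval N1 = (G.tail ⟨i - 1, hi'⟩ : ℕ) := by
      simp only [Term.eval, r10]
      rw [u1.arr_eq 0 (by omega) (by omega)]
      exact table_apply (fun e => ((G.tail e : ℕ) : ℤ)) ⟨i - 1, hi'⟩
    refine ⟨insertPair G U' (G.tail ⟨i - 1, hi'⟩), i - 1, u1.touchPairP _,
      t1.touchPairP u1 hK hm ht, mate_mem_insertPair c3 _, ?_, ⟨?_, by omega⟩, ?_, ?_, ?_⟩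
    · exact c4.trans ((Finset.subset_insert _ _).trans (Finset.subset_insert _ _))
    · rw [exec_reg fun h => by have := regs_touchPairP h; omega, r10]
    · intro e he
      simp only [insertPair, Finset.mem_insert]
      by_cases hei : (e : ℕ) = i - 1
      · right; left; congr 1; exact Fin.ext hei
      · right; right; exact c6 e (by omega)
    · have := card_insertPair_le (G := G) U' (G.tail ⟨i - 1, hi'⟩)
      omega
    · rw [hcost] at hy'
      simp only [bound, Term.cost] at hy'
      push_cast [Nat.cast_sub hi] at hy' ⊢
      linarith
  · rintro N y ⟨U', i, c1, c2, c3, c4, ⟨c5, c5'⟩, c6, c7, hy⟩ hb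
    simp only [Test.Holds, Term.eval, c5] at hb
    obtain rfl : i = 0 := by omega
    refine ⟨U', c1, c2, c3, c4, fun e => c6 e (by omega), by omega, ?_⟩
    rw [hcost]
    push_cast at hy
    linarith
  · exact ⟨U, m, hu, h, hU, subset_rfl, ⟨h10, le_rfl⟩, fun e he => by omega, by omega, hx⟩

theorem halts_touchAllP (hK : 1 ≤ K) (hm : 1 ≤ m) {C x w : ℝ} (hw : 0 ≤ w)
    (hC : (bound (touchPairP K (.read 0 (.reg 10))) : ℝ) + bound (touchTerminalsP K k) + 10 ≤ C)
    (hx : C * (m + 2) + w ≤ x) :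
    Halts (touchAllP k K) (input G s f) x fun N y => ∃ U : Finset (Fin n), Untouched G s f K N ∧
      TouchRep m K N U ∧ (∀ x ∈ U, G.mateV x ∈ U) ∧ (∀ i, s i ∈ U) ∧ (∀ e, G.tail e ∈ U) ∧
      U.card ≤ 2 * m + 2 * k ∧ w ≤ y := by
  have n1 : (0 : ℝ) ≤ bound (touchPairP K (.read 0 (.reg 10))) := Nat.cast_nonneg _
  have n2 : (0 : ℝ) ≤ bound (touchTerminalsP K k) := Nat.cast_nonneg _
  refine Halts.seq (Halts.of_loopFree ⟨trivial, loopFree_touchTerminalsP _ _, trivial⟩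
    fun y hy => ?_)
  simp only [exec]
  set N0 := (input G s f).setReg 2 (Term.eval (input G s f) (.reg 1)) with hN0
  have u0 : Untouched G s f K N0 := ⟨fun r h1 _ _ _ => by simp [hN0, Memory.setReg, h1],
    fun _ _ _ => rfl⟩
  have a0 : ∀ a, K + 6 ≤ a → N0.arr a = fun _ => 0 := by
    intro a ha
    simp only [hN0, Memory.setReg, input]
    split <;> first | omega | rfl
  have t0 : TouchRep m K N0 (∅ : Finset (Fin n)) := by
    refine ⟨?_, ?_, fun x _ => by rw [a0 _ (by omega)], by simp, by simp⟩
    · simp [hN0, Memory.setReg, Term.eval, input]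
    · simp [hN0, Memory.setReg, input]
  obtain ⟨U, h1, h2, h3, h4⟩ := t0.touchTerminalsP u0 hK hm k le_rfl
  set N1 := exec (touchTerminalsP K k) N0 with hN1
  have u1 : Untouched G s f K N1 := u0.exec
    (fun r hr => by have := regs_touchTerminalsP hr; omega) fun _ => arrs_touchTerminalsP
  refine (halts_touchTailsP (U := U) (C := C) (w := w) (G := G) (s := s) (f := f) ⟨?_, ?_⟩ ?_ hK hm
    h2 h4 ?_ hw (by linarith) ?_).mono ?_
  · intro r i1 i2 i3 i4
    simp only [Memory.setReg, Function.update_of_ne i3]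
    exact u1.reg_eq r i1 i2 i3 i4
  · exact u1.arr_eq
  · exact h1.congr (by simp [Memory.setReg]) (by simp [Memory.setReg]) fun _ _ => rfl
  · simp only [Memory.setReg, Function.update_self, Term.eval]
    exact u1.reg_eq 1 (by norm_num) (by norm_num) (by norm_num) (by norm_num)
  · simp only [bound, Term.cost] at hy
    push_cast at hy
    linarith
  · rintro N z ⟨U', i1, i2, i3, i4, i5, i6, i7⟩
    exact ⟨U', i1, i2, i3, fun i => i4 (h3 i i.2), i5, i6, i7⟩

end RAM

/-! ### Building the initial matrix -/

namespace RAM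

open SymMatrix

variable {n m k K : ℕ} {M N : Memory} {U : Finset (Fin n)} {G : SkewGraph (Fin n) (Fin m)}
  {s : Fin k → Fin n} {f : Fin m → ℤ}

/-- The setup given by the rows assigned in the memory. -/
def TouchRep.setup (h : TouchRep m K M U) (hs : G.IsTerminals s) (hf : G.IsSymmFlow s f)
    (hU : ∀ x ∈ U, G.mateV x ∈ U) (hsU : ∀ i, s i ∈ U) (ht : ∀ e, G.tail e ∈ U)
    (hc : U.card ≤ 2 * m + 2 * k) : Setup n m k where
  G := G
  s := s
  f := f
  terminals := hs
  flow := hf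
  U := U
  off x := M.arr (K + 6) (x : ℕ)
  mate_mem := hU
  tail_mem := ht
  terminal_mem := hsU
  disjoint := by
    intro a ha b hb x y hxy
    obtain ⟨i, -, h1, h2⟩ := h.place a ha
    obtain ⟨j, -, h3, h4⟩ := h.place b hb
    dsimp only at hxy
    rw [h1, h3] at hxy
    have hx := x.2
    have hy := y.2
    -- Division with remainder by `n` recovers the row and the column, and the queue recovers the
    -- node from the number of its row.
    have hxy' : n * i + (x : ℕ) = n * j + (y : ℕ) := by
      have : ((n * i + (x : ℕ) : ℕ) : ℤ) = (n * j + (y : ℕ) : ℕ) := by push_cast; linarith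
      exact_mod_cast this
    have hn : 0 < n := by omega
    have hij : i = j := by
      have e1 : (n * i + (x : ℕ)) / n = i := by
        rw [Nat.mul_add_div hn, Nat.div_eq_of_lt hx, add_zero]
      have e2 : (n * j + (y : ℕ)) / n = j := by
        rw [Nat.mul_add_div hn, Nat.div_eq_of_lt hy, add_zero]
      rw [← e1, hxy', e2]
    subst hij
    rw [h2] at h4
    exact ⟨(Fin.cast_eq_iff _ _).1 h4, Fin.ext (by omega)⟩
  le_off := by
    intro x hx
    obtain ⟨i, -, h1, -⟩ := h.place x hx
    rw [h1]
    have : (0 : ℤ) ≤ n * i := by positivity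
    omega
  card_le := hc

/-- Add the value of the preceding arc and its mate to the matrix. -/
def buildStepP (K : ℕ) : Program :=
  .seq (.assign 10 (.minus (.reg 10) (.const 1)))
    (.branch (.both (.le (.plus (.reg 10) (.const 1)) (.read 2 (.reg 10)))
        (.le (.const 1) (.read 4 (.reg 10))))
      (block [.assign 11 (.read 0 (.reg 10)), .assign 12 (.read 0 (.read 2 (.reg 10))),
        .assign 13 (.read 4 (.reg 10)), addP K]) .skip)

/-- Add the values of all pairs of mated arcs to the matrix. -/
def buildP (K : ℕ) : Program := .loop (.le (.const 1) (.reg 10)) (buildStepP K)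

theorem loopFree_buildStepP (K : ℕ) : LoopFree (buildStepP K) := by
  simp [buildStepP, block, LoopFree, loopFree_addP]

theorem regs_buildStepP {K r : ℕ} (h : r ∈ regs (buildStepP K)) :
    r = 5 ∨ r = 10 ∨ r = 11 ∨ r = 12 ∨ r = 13 := by
  simp [buildStepP, block, regs] at h
  omega

theorem arrs_buildStepP {K a : ℕ} (h : a ∈ arrs (buildStepP K)) : K + 8 ≤ a ∧ a ≤ K + 12 := by
  simp only [buildStepP, block, arrs, Set.mem_union, Set.mem_empty_iff_false, false_or,
    or_false] at h
  exact mem_arrs_addP h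

variable {Γ : Setup n m k}

theorem Setup.bump_arcMatrix (Γ : Setup n m k) (e : Fin m) :
    Γ.G.arcMatrix Γ.f e = bump (Γ.G.arcMatrix Γ.f (e + 1)) (Γ.G.tail e) (Γ.G.tail (Γ.G.mateE e))
      (if e < Γ.G.mateE e then Γ.f e else 0) := by
  split_ifs with h
  · exact Γ.G.arcMatrix_of_lt Γ.f h
  · rw [Γ.G.arcMatrix_of_not_lt Γ.f h]
    ext x y
    simp [bump]

/-- The state of the construction of the matrix from the arcs with numbers at least `i`. -/
structure BuildRep (Γ : Setup n m k) (K : ℕ) (M : Memory) (ℓ : Fin n → List (Fin n))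
    (i : ℕ) : Prop where
  fixed : Fixed Γ K M
  graph : GraphRep K M Γ.U Γ.off (Γ.G.arcMatrix Γ.f i) ℓ
  weight : IsWeight Γ.G.mateV Γ.U (Γ.G.arcMatrix Γ.f i)
  size_le : size (Γ.G.arcMatrix Γ.f i) + 2 * i ≤ 2 * m
  length_le : ∑ a, (ℓ a).length + 2 * i ≤ 2 * m
  reg_ten : M.reg 10 = i
  le : i ≤ m
  done : ∀ x, M.arr (K + 18) x = 0
  commodity : ∀ a, 6 ≤ a → a < K + 6 → ∀ x, M.arr a x = 0
  reg_zero : ∀ r, 6 ≤ r → r ≤ 9 → M.reg r = 0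

/-- Arcs without flow are skipped, because `addP` would count a neighbour for a cell that stays
zero. Every arc number gains two units, which bounds both the size of the matrix and the lists by `2
* m`. -/
theorem BuildRep.step {i : ℕ} {ℓ : Fin n → List (Fin n)} (h : BuildRep Γ K M ℓ (i + 1)) :
    ∃ ℓ', BuildRep Γ K (exec (buildStepP K) M) ℓ' i := by
  have hi : i < m := h.le
  set e : Fin m := ⟨i, hi⟩
  have hr : ∀ r, r ≠ 5 → r ≠ 10 → r ≠ 11 → r ≠ 12 → r ≠ 13 →
      (exec (buildStepP K) M).reg r = M.reg r := fun r _ _ _ _ _ =>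
    exec_reg (fun h => by have := regs_buildStepP h; omega) _
  have ha : ∀ a, (a < K + 8 ∨ K + 12 < a) → (exec (buildStepP K) M).arr a = M.arr a :=
    fun a _ => exec_arr (fun h => by have := arrs_buildStepP h; omega) _
  set M1 := M.setReg 10 (M.reg 10 - 1) with hM1
  have r10 : M1.reg 10 = i := by
    simp only [hM1, Memory.setReg, Function.update_self, h.reg_ten]
    push_cast; ring
  have hin : ∀ a < 6, M1.arr a = (input Γ.G Γ.s Γ.f).arr a := fun a ha => h.fixed.input_eq a ha
  have e2 : M1.arr 2 i = (Γ.G.mateE e : ℕ) := by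
    rw [hin 2 (by norm_num)]; exact table_apply (fun e => ((Γ.G.mateE e : ℕ) : ℤ)) e
  have e0 : ∀ e : Fin m, M1.arr 0 (e : ℕ) = (Γ.G.tail e : ℕ) := fun e => by
    rw [hin 0 (by norm_num)]; exact table_apply (fun e => ((Γ.G.tail e : ℕ) : ℤ)) e
  have e4 : M1.arr 4 i = Γ.f e := by
    rw [hin 4 (by norm_num)]; exact table_apply Γ.f e
  have hbump := Γ.bump_arcMatrix e
  have hne : Γ.G.tail e ≠ Γ.G.mateV (Γ.G.tail (Γ.G.mateE e)) := by
    rw [Γ.G.tail_mateE, Γ.G.mateV_mateV]; exact Γ.G.tail_ne_head e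
  have hexec : exec (buildStepP K) M = exec (.branch
      (.both (.le (.plus (.reg 10) (.const 1)) (.read 2 (.reg 10)))
        (.le (.const 1) (.read 4 (.reg 10))))
      (block [.assign 11 (.read 0 (.reg 10)), .assign 12 (.read 0 (.read 2 (.reg 10))),
        .assign 13 (.read 4 (.reg 10)), addP K]) .skip) M1 := rfl
  have g1 : GraphRep K M1 Γ.U Γ.off (Γ.G.arcMatrix Γ.f (i + 1)) ℓ :=
    h.graph.congr (fun _ _ _ _ => rfl) (by simp [hM1, Memory.setReg])
  have hz := h.size_le
  have hl := h.length_le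
  have key : ∃ ℓ', GraphRep K (exec (buildStepP K) M) Γ.U Γ.off (Γ.G.arcMatrix Γ.f i) ℓ' ∧
      size (Γ.G.arcMatrix Γ.f i) + 2 * i ≤ 2 * m ∧ ∑ a, (ℓ' a).length + 2 * i ≤ 2 * m := by
    by_cases hb : e < Γ.G.mateE e ∧ 1 ≤ Γ.f e
    · have hb' : Test.Holds M1 (.both (.le (.plus (.reg 10) (.const 1)) (.read 2 (.reg 10)))
          (.le (.const 1) (.read 4 (.reg 10)))) := by
        simp only [Test.Holds, Term.eval, r10, e2, e4]
        have h1 : i < (Γ.G.mateE e : ℕ) := hb.1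
        exact ⟨by omega, hb.2⟩
      rw [hexec]
      simp only [exec, if_pos hb']
      rw [if_pos hb.1] at hbump
      have e3 : exec (block [.assign 11 (.read 0 (.reg 10)),
          .assign 12 (.read 0 (.read 2 (.reg 10))), .assign 13 (.read 4 (.reg 10)), addP K]) M1 =
        exec (addP K) (exec (block [.assign 11 (.read 0 (.reg 10)),
          .assign 12 (.read 0 (.read 2 (.reg 10))), .assign 13 (.read 4 (.reg 10))]) M1) := rfl
      rw [e3]
      set M2 := exec (block [.assign 11 (.read 0 (.reg 10)),
          .assign 12 (.read 0 (.read 2 (.reg 10))), .assign 13 (.read 4 (.reg 10))]) M1 with hM2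
      have g2 : GraphRep K M2 Γ.U Γ.off (Γ.G.arcMatrix Γ.f (i + 1)) ℓ :=
        g1.congr (fun _ _ _ _ => rfl) (exec_reg (by simp [block, regs]) _)
      have q11 : M2.reg 11 = (Γ.G.tail e : ℕ) := by
        simp only [hM2, block, exec, Memory.setReg, Term.eval]
        simp [r10]
        exact e0 e
      have q12 : M2.reg 12 = (Γ.G.tail (Γ.G.mateE e) : ℕ) := by
        simp only [hM2, block, exec, Memory.setReg, Term.eval]
        simp [r10, e2]
        exact e0 _
      have q13 : M2.reg 13 = Γ.f e := by
        simp only [hM2, block, exec, Memory.setReg, Term.eval]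
        simp [r10, e4]
      obtain ⟨ℓ', i1, i2⟩ := g2.addP h.weight Γ.disjoint q11 q12 q13 (Γ.tail_mem _)
        (Γ.tail_mem _) (by have := hb.2; omega)
      change Γ.G.arcMatrix Γ.f i = _ at hbump
      refine ⟨ℓ', by rw [hbump]; exact i1, ?_, by omega⟩
      rw [hbump, size_bump h.weight.nonneg h.weight.symm (by have := hb.2; omega)]
      push_cast at hz
      split_ifs <;> linarith
    · have hb' : ¬ Test.Holds M1 (.both (.le (.plus (.reg 10) (.const 1)) (.read 2 (.reg 10)))
          (.le (.const 1) (.read 4 (.reg 10)))) := by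
        simp only [Test.Holds, Term.eval, r10, e2, e4]
        rintro ⟨h1, h2⟩
        exact hb ⟨Fin.lt_def.2 (by change i < _; omega), h2⟩
      have e5 : Γ.G.arcMatrix Γ.f i = Γ.G.arcMatrix Γ.f (i + 1) := by
        change Γ.G.arcMatrix Γ.f i = _ at hbump
        rw [hbump]
        have : (if e < Γ.G.mateE e then Γ.f e else 0) = 0 := by
          split_ifs with h1
          · have := Γ.flow.nonneg e
            have : ¬ 1 ≤ Γ.f e := fun h2 => hb ⟨h1, h2⟩
            omega
          · rfl
        ext x y
        rw [this, bump, zero_mul, add_zero]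
      rw [hexec]
      simp only [exec, if_neg hb']
      refine ⟨ℓ, by rw [e5]; exact g1, ?_, by omega⟩
      rw [e5]; push_cast at hz; linarith
  obtain ⟨ℓ', k1, k2, k3⟩ := key
  have q10 : (exec (buildStepP K) M).reg 10 = i := by
    have : exec (buildStepP K) M = exec (.branch
      (.both (.le (.plus (.reg 10) (.const 1)) (.read 2 (.reg 10)))
        (.le (.const 1) (.read 4 (.reg 10))))
      (block [.assign 11 (.read 0 (.reg 10)), .assign 12 (.read 0 (.read 2 (.reg 10))),
        .assign 13 (.read 4 (.reg 10)), addP K]) .skip) M1 := rfl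
    rw [this, exec_reg (by simp [block, regs]), r10]
  refine ⟨ℓ', h.fixed.congr (hr _ (by norm_num) (by norm_num) (by norm_num) (by norm_num)
    (by norm_num)) (hr _ (by norm_num) (by norm_num) (by norm_num) (by norm_num)
    (by norm_num)) (fun a h1 => ha a (by omega)), k1, ?_, k2, k3, q10, by omega, ?_, ?_, ?_⟩
  · change IsWeight _ _ (Γ.G.arcMatrix Γ.f e)
    rw [hbump]
    refine h.weight.bump_add Γ.G.mateV_mateV (Γ.tail_mem _) (Γ.tail_mem _) hne ?_
    split_ifs
    · exact Γ.flow.nonneg e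
    · exact le_rfl
  · rw [ha _ (by omega)]; exact h.done
  · intro a h1 h2; rw [ha _ (by omega)]; exact h.commodity a h1 h2
  · intro r h1 h2
    rw [hr r (by omega) (by omega) (by omega) (by omega) (by omega)]
    exact h.reg_zero r h1 h2

theorem halts_buildP {ℓ : Fin n → List (Fin n)} (h : BuildRep Γ K M ℓ m) {C x w : ℝ} (hw : 0 ≤ w)
    (hC : (bound (buildStepP K) : ℝ) + 10 ≤ C) (hx : C * (m + 1) + w ≤ x) :
    Halts (buildP K) M x fun N y => ∃ ℓ', BuildRep Γ K N ℓ' 0 ∧ w ≤ y := by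
  have n1 : (0 : ℝ) ≤ bound (buildStepP K) := Nat.cast_nonneg _
  have hcost : ((Test.le (.const 1) (.reg 10)).cost : ℝ) = 3 := by simp [Test.cost, Term.cost]
  refine Halts.loop (I := fun N y => ∃ (i : ℕ) (ℓ' : Fin n → List (Fin n)), BuildRep Γ K N ℓ' i ∧
    C * (i + 1) + w ≤ y) ?_ ?_ ?_ ⟨m, ℓ, h, hx⟩
  · rintro N y ⟨i, ℓ', c, hy⟩
    refine le_trans ?_ hy
    have : 0 ≤ C := by linarith
    positivity
  · rintro N y ⟨i, ℓ', c, hy⟩ hb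
    simp only [Test.Holds, Term.eval, c.reg_ten] at hb
    obtain ⟨i, rfl⟩ : ∃ j, i = j + 1 := ⟨i - 1, by omega⟩
    obtain ⟨ℓ2, c2⟩ := c.step
    refine Halts.of_loopFree (loopFree_buildStepP K) fun y' hy' => ⟨i, ℓ2, c2, ?_⟩
    rw [hcost] at hy'
    push_cast at hy
    linarith
  · rintro N y ⟨i, ℓ', c, hy⟩ hb
    simp only [Test.Holds, Term.eval, c.reg_ten] at hb
    obtain rfl : i = 0 := by omega
    refine ⟨ℓ', c, ?_⟩
    rw [hcost]
    push_cast at hy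
    linarith

/-- Construction of the matrix. -/
def initP (k K : ℕ) : Program :=
  .seq (touchAllP k K) (.seq (.assign 10 (.reg 1)) (.seq (buildP K)
    (block [.assign 4 (.reg 3), .assign 8 (.const 1)])))

theorem halts_initP (hs : G.IsTerminals s) (hf : G.IsSymmFlow s f) (hK : 1 ≤ K) (hm : 1 ≤ m)
    {C x w : ℝ} (hw : 0 ≤ w)
    (hC : (bound (touchPairP K (.read 0 (.reg 10))) : ℝ) + bound (touchTerminalsP K k) +
      bound (buildStepP K) + 10 ≤ C)
    (hx : C * (2 * m + 5) + w ≤ x) :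
    Halts (initP k K) (input G s f) x fun N y => ∃ (Γ : Setup n m k) (ℓ : Fin n → List (Fin n)),
      (Γ.G = G ∧ Γ.s = s ∧ Γ.f = f) ∧ Core Γ K N Γ.matrix ℓ [] Γ.U ∅ ∅ ∧
      (∑ a, (ℓ a).length ≤ 2 * m) ∧
      (N.reg 6 = 0 ∧ N.reg 7 = 0 ∧ N.reg 8 = 1) ∧
      (∀ a, 6 ≤ a → a < K + 6 → ∀ x, N.arr a x = 0) ∧ w ≤ y := by
  have n1 : (0 : ℝ) ≤ bound (touchPairP K (.read 0 (.reg 10))) := Nat.cast_nonneg _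
  have n2 : (0 : ℝ) ≤ bound (touchTerminalsP K k) := Nat.cast_nonneg _
  have n3 : (0 : ℝ) ≤ bound (buildStepP K) := Nat.cast_nonneg _
  have hC0 : 10 ≤ C := by linarith
  refine Halts.seq ((halts_touchAllP (C := C) (w := C * (m + 3) + w) hK hm (by positivity)
    (by linarith) (by linarith)).mono ?_)
  rintro N y ⟨U, u, t, h1, h2, h3, h4, hy⟩
  refine Halts.seq (Halts.of_loopFree trivial fun y1 hy1 => ?_)
  simp only [bound, Term.cost] at hy1
  push_cast at hy1
  set N1 := exec (.assign 10 (.reg 1)) N with hN1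
  have hr : ∀ r, r ≠ 10 → N1.reg r = N.reg r := fun r h => exec_reg (by simp [regs, h]) _
  have harr : N1.arr = N.arr := rfl
  have t1 : TouchRep m K N1 U := t.congr (hr _ (by norm_num)) (hr _ (by norm_num))
    fun _ _ => by rw [harr]
  set Γ := t1.setup hs hf h1 h2 h3 h4
  have hzero : ∀ a, 6 ≤ a → a ≠ K + 6 → a ≠ K + 7 → ∀ x, N1.arr a x = 0 := by
    intro a i1 i2 i3 x
    rw [harr, u.arr_eq a i2 i3]
    simp only [input]
    split <;> first | omega | rfl
  have hA : Γ.G.arcMatrix Γ.f m = fun _ _ => 0 := by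
    ext a b; exact Γ.G.arcMatrix_eq_zero Γ.f a b
  have r1 : N1.reg 1 = m := by
    rw [hr _ (by norm_num)]
    exact u.reg_eq 1 (by norm_num) (by norm_num) (by norm_num) (by norm_num)
  have hdeg : ∀ x : Fin n, deg (fun _ _ : Fin n => (0 : ℤ)) x = 0 := fun x => by simp [deg]
  have b1 : BuildRep Γ K N1 (fun _ => []) m := by
    refine ⟨⟨?_, fun u _ => rfl, r1, t1.reg_three, ?_, ?_⟩, ?_, ?_, ?_, by simp, ?_, le_rfl, ?_,
      ?_, ?_⟩
    · intro a ha
      rw [harr, u.arr_eq a (by omega) (by omega)]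
      rfl
    · intro i hi0 hi1
      lift i to ℕ using hi0
      exact t1.queue i (by exact_mod_cast hi1)
    · intro x hx
      obtain ⟨i, hi, -, h6⟩ := t1.place x hx
      exact ⟨i, by positivity, by exact_mod_cast hi, h6⟩
    · rw [hA]
      refine ⟨fun _ _ => rfl, fun a _ b _ => hzero _ (by omega) (by omega) (by omega) _,
        fun a _ => ?_, ⟨fun a _ => hzero _ (by omega) (by omega) (by omega) _, ?_, by simp⟩, by simp⟩
      · rw [hzero _ (by omega) (by omega) (by omega), hdeg]
      · rw [hr _ (by norm_num),
          u.reg_eq 5 (by norm_num) (by norm_num) (by norm_num) (by norm_num)]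
        simp [input]
    · rw [hA]
      exact ⟨by simp, by simp, by simp, by simp, by simp⟩
    · rw [hA]; simp [size, hdeg]
    · have : N1.reg 10 = N.reg 1 := by simp [hN1, exec, Memory.setReg, Term.eval]
      rw [this, ← hr 1 (by norm_num), r1]
    · exact hzero _ (by omega) (by omega) (by omega)
    · intro a i1 i2; exact hzero a i1 (by omega) (by omega)
    · intro r i1 i2
      rw [hr r (by omega), u.reg_eq r (by omega) (by omega) (by omega) (by omega)]
      simp only [input]
      split <;> omega
  refine Halts.seq ((halts_buildP b1 (C := C) (w := C + w) (by positivity) (by linarith)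
    (by linarith)).mono ?_)
  rintro N2 y2 ⟨ℓ, c, hy2⟩
  refine Halts.of_loopFree (by simp [block, LoopFree]) fun y3 hy3 => ?_
  simp only [bound, block, Term.cost] at hy3
  push_cast at hy3
  set N3 := exec (block [.assign 4 (.reg 3), .assign 8 (.const 1)]) N2 with hN3
  have hr3 : ∀ r, r ≠ 4 → r ≠ 8 → N3.reg r = N2.reg r := fun r h h' =>
    exec_reg (by simp [regs, block, h, h']) _
  have harr3 : N3.arr = N2.arr := rfl
  have q4 : N3.reg 4 = Γ.U.card := by
    rw [← c.fixed.reg_three]; simp [hN3, block, exec, Memory.setReg, Term.eval]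
  have q8 : N3.reg 8 = 1 := by simp [hN3, block, exec, Memory.setReg, Term.eval]
  have q6 : N3.reg 6 = 0 := by
    rw [hr3 _ (by norm_num) (by norm_num), c.reg_zero 6 (by norm_num) (by norm_num)]
  have q7 : N3.reg 7 = 0 := by
    rw [hr3 _ (by norm_num) (by norm_num), c.reg_zero 7 (by norm_num) (by norm_num)]
  have f3 : Fixed Γ K N3 := c.fixed.congr (hr3 _ (by norm_num) (by norm_num))
    (hr3 _ (by norm_num) (by norm_num)) fun _ _ => by rw [harr3]
  refine ⟨Γ, ℓ, ⟨rfl, rfl, rfl⟩, ?_, by simpa using c.length_le, ⟨q6, q7, q8⟩,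
    by rw [harr3]; exact c.commodity, by linarith⟩
  refine ⟨f3, c.graph.congr (fun _ _ _ _ => by rw [harr3]) (hr3 _ (by norm_num) (by norm_num)),
    c.weight, .nil, trivial, ?_, subset_rfl, h1, ?_, q4, ?_, by simpa [Setup.matrix] using c.size_le, by rw [q6],
    ?_, by rw [q7]; exact ⟨le_rfl, by positivity⟩, ?_⟩
  · rw [hr3 _ (by norm_num) (by norm_num), c.reg_zero 9 (by norm_num) (by norm_num)]; simp
  · intro x hx; rw [if_pos hx, harr3, c.done]
  · intro x hx _ _ y
    by_contra h5
    exact hx (c.weight.mem x y h5)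
  · intro i i1 i2; omega
  -- At the beginning the whole queue is still ahead of the cursor.
  · intro x hx _ _
    left; right
    obtain ⟨i, i1, i2, i3⟩ := f3.mem_queue x hx
    exact ⟨i, by omega, by rw [f3.reg_three]; exact i2, i3⟩

end RAM

/-! ### Frame rules and transfer of amounts within the commodities -/

namespace RAM

open SymMatrix

theorem Runs.arr_eq {P : Program} {M N : Memory} {t : ℕ} (h : Runs P M t N) :
    ∀ a ∉ arrs P, N.arr a = M.arr a := by
  induction h with
  | skip M => intro a _; rfl
  | assign M x p => intro a _; rfl
  | write M c i p =>
    intro a ha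
    have : a ≠ c := ha
    simp [Memory.setArr, this]
  | seq _ _ h1 h2 =>
    intro a ha
    simp only [arrs, Set.mem_union, not_or] at ha
    rw [h2 a ha.2, h1 a ha.1]
  | branch_true _ _ h1 =>
    intro a ha
    simp only [arrs, Set.mem_union, not_or] at ha
    exact h1 a ha.1
  | branch_false _ _ h1 =>
    intro a ha
    simp only [arrs, Set.mem_union, not_or] at ha
    exact h1 a ha.2
  | loop_true _ _ _ h1 h2 =>
    intro a ha
    rw [h2 a ha, h1 a ha]
  | loop_false _ => intro a _; rfl

/-- The register `r` is increased by one whenever it is changed. -/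
def Counts (r : ℕ) : Program → Prop
  | .skip => True
  | .assign x p => x = r → p = .plus (.reg r) (.const 1)
  | .write _ _ _ => True
  | .seq P Q => Counts r P ∧ Counts r Q
  | .branch _ P Q => Counts r P ∧ Counts r Q
  | .loop _ P => Counts r P

/-- Applied to the counter of records: their number is at most the time spent, so undoing them needs
no separate count. -/
theorem Runs.reg_le {P : Program} {M N : Memory} {t : ℕ} (h : Runs P M t N) {r : ℕ} :
    Counts r P → N.reg r ≤ M.reg r + t := by
  induction h with
  | skip M => intro _; simp
  | assign M x p =>
    intro hp
    by_cases hx : x = r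
    · subst hx
      rw [hp rfl]
      simp only [Memory.setReg, Function.update_self, Term.eval, Term.cost]
      push_cast
      linarith
    · have : r ≠ x := Ne.symm hx
      simp only [Memory.setReg, Function.update_of_ne this]
      omega
  | write M c i p => intro _; simp only [Memory.setArr]; omega
  | seq _ _ h1 h2 =>
    intro hp
    have := h1 hp.1
    have := h2 hp.2
    push_cast; linarith
  | branch_true _ _ h1 => intro hp; have := h1 hp.1; push_cast; linarith
  | branch_false _ _ h1 => intro hp; have := h1 hp.2; push_cast; linarith
  | loop_true _ _ _ h1 h2 =>
    intro hp
    have := h1 hp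
    have := h2 hp
    push_cast; linarith
  | loop_false _ => intro _; push_cast; linarith

theorem Halts.frame {P : Program} {M : Memory} {x : ℝ} {R : Memory → ℝ → Prop}
    (h : Halts P M x R) {r : ℕ} (hr : Counts r P) : Halts P M x fun N y =>
      R N y ∧ (∀ a ∉ arrs P, N.arr a = M.arr a) ∧ N.reg r + y ≤ M.reg r + x := by
  obtain ⟨t, N, h1, h2⟩ := h
  refine ⟨t, N, h1, h2, h1.arr_eq, ?_⟩
  have : (N.reg r : ℝ) ≤ M.reg r + t := by exact_mod_cast h1.reg_le hr
  linarith

/-- Transfer from the cell of the array `c` given by the register 20 to the cells given by the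
registers 21 and 22, the register 23 being the largest amount allowed. -/
def pullCellP (c : ℕ) : Program := block [
  .assign 24 (.read c (.reg 20)),
  .branch (.le (.reg 23) (.reg 24)) (.assign 24 (.reg 23)) .skip,
  decr c (.reg 20) (.reg 24), incr c (.reg 21) (.reg 24), incr c (.reg 22) (.reg 24),
  .assign 23 (.minus (.reg 23) (.reg 24))]

/-- Transfer of a total amount in the register 23 in the given arrays. -/
def pullP {ι : Type*} (num : ι → ℕ) : List ι → Program
  | [] => .skip
  | c :: l => .seq (pullCellP (num c)) (pullP num l)

variable {ι : Type*} {num : ι → ℕ} {M : Memory}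

theorem loopFree_pullP (num : ι → ℕ) (l : List ι) : LoopFree (pullP num l) := by
  induction l with
  | nil => trivial
  | cons c l ih => exact ⟨by simp [pullCellP, block, decr, incr, LoopFree], ih⟩

theorem regs_pullCellP {c r : ℕ} (h : r ∈ regs (pullCellP c)) : r = 23 ∨ r = 24 := by
  simp [pullCellP, block, decr, incr, regs] at h
  omega

theorem arrs_pullCellP {c a : ℕ} (h : a ∈ arrs (pullCellP c)) : a = c := by
  simpa [pullCellP, block, decr, incr, arrs] using h

theorem regs_pullP {l : List ι} {r : ℕ} (h : r ∈ regs (pullP num l)) : r = 23 ∨ r = 24 := by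
  induction l with
  | nil => exact h.elim
  | cons c l ih => exact h.elim regs_pullCellP ih

theorem arrs_pullP {l : List ι} {a : ℕ} (h : a ∈ arrs (pullP num l)) : ∃ c ∈ l, a = num c := by
  induction l with
  | nil => exact h.elim
  | cons c l ih =>
    rcases h with h | h
    · exact ⟨c, by simp, arrs_pullCellP h⟩
    · obtain ⟨d, h1, h2⟩ := ih h
      exact ⟨d, by simp [h1], h2⟩

theorem update_sub_add_add (g : ℤ → ℤ) (p q r y z : ℤ) :
    Function.update (Function.update (Function.update g p (g p - y)) q
      (Function.update g p (g p - y) q + y)) r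
      (Function.update (Function.update g p (g p - y)) q
      (Function.update g p (g p - y) q + y) r + y) z =
    g z + y * ((if z = q then 1 else 0) + (if z = r then 1 else 0) - if z = p then 1 else 0) := by
  have h : ∀ (g : ℤ → ℤ) (p y z : ℤ),
      Function.update g p (g p + y) z = g z + y * if z = p then 1 else 0 := by
    intro g p y z
    by_cases h : z = p
    · subst h; simp
    · simp [h]
  rw [h, h, sub_eq_add_neg, h]
  ring

theorem pullCellP_spec (c : ℕ) (M : Memory) :
    (exec (pullCellP c) M).reg 23 = M.reg 23 - min (M.reg 23) (M.arr c (M.reg 20)) ∧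
    ∀ q, (exec (pullCellP c) M).arr c q =
      M.arr c q + min (M.reg 23) (M.arr c (M.reg 20)) * ((if q = M.reg 21 then 1 else 0) +
        (if q = M.reg 22 then 1 else 0) - if q = M.reg 20 then 1 else 0) := by
  set M2 := exec (.branch (.le (.reg 23) (.reg 24)) (.assign 24 (.reg 23)) .skip)
    (M.setReg 24 (M.arr c (M.reg 20))) with hM2
  have e24 : M2.reg 24 = min (M.reg 23) (M.arr c (M.reg 20)) := by
    by_cases h : M.reg 23 ≤ M.arr c (M.reg 20)
    · have h' : Test.Holds (M.setReg 24 (M.arr c (M.reg 20))) (.le (.reg 23) (.reg 24)) := by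
        simpa [Test.Holds, Term.eval, Memory.setReg] using h
      simp only [hM2, exec, if_pos h', min_eq_left h]
      simp [Memory.setReg, Term.eval]
    · have h' : ¬ Test.Holds (M.setReg 24 (M.arr c (M.reg 20))) (.le (.reg 23) (.reg 24)) := by
        simpa [Test.Holds, Term.eval, Memory.setReg] using h
      simp only [hM2, exec, if_neg h', min_eq_right (not_le.1 h).le]
      simp [Memory.setReg]
  have hr : ∀ r, r ≠ 24 → M2.reg r = M.reg r := fun r h => by
    rw [hM2, exec_reg (by simp [regs, h])]
    simp [Memory.setReg, h]
  have ha : M2.arr = M.arr := by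
    ext a
    rw [hM2, exec_arr (by simp [arrs])]
    rfl
  have e : exec (pullCellP c) M = exec (block [decr c (.reg 20) (.reg 24),
    incr c (.reg 21) (.reg 24), incr c (.reg 22) (.reg 24),
    .assign 23 (.minus (.reg 23) (.reg 24))]) M2 := rfl
  rw [e]
  clear_value M2
  constructor
  · simp [block, exec, Term.eval, incr, decr, Memory.setReg, Memory.setArr, e24, hr]
  · intro q
    rw [← update_sub_add_add]
    simp [block, exec, Term.eval, incr, decr, Memory.setReg, Memory.setArr, e24, hr, ha]

/-- The commodities are served greedily, each giving the minimum of its amount and the remaining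
demand. The total is therefore the minimum of the demand and the supply. -/
theorem pullP_spec [DecidableEq ι] (hnum : Function.Injective num) {l : List ι} (hl : l.Nodup)
    (M : Memory) (h0 : 0 ≤ M.reg 23) (h1 : ∀ c ∈ l, 0 ≤ M.arr (num c) (M.reg 20)) :
    ∃ y : ι → ℤ, (∀ c ∈ l, 0 ≤ y c ∧ y c ≤ M.arr (num c) (M.reg 20)) ∧
      (l.map y).sum = min (M.reg 23) (l.map fun c => M.arr (num c) (M.reg 20)).sum ∧
      (exec (pullP num l) M).reg 23 = M.reg 23 - (l.map y).sum ∧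
      ∀ c ∈ l, ∀ q, (exec (pullP num l) M).arr (num c) q = M.arr (num c) q +
        y c * ((if q = M.reg 21 then 1 else 0) + (if q = M.reg 22 then 1 else 0) -
          if q = M.reg 20 then 1 else 0) := by
  induction l generalizing M with
  | nil => exact ⟨0, by simp, by simp [h0], by simp [pullP, exec], by simp⟩
  | cons c l ih =>
    have hl' := List.nodup_cons.1 hl
    have hr : ∀ r, r ≠ 23 → r ≠ 24 → (exec (pullCellP (num c)) M).reg r = M.reg r := fun r h1 h2 =>
      exec_reg (fun h => by have := regs_pullCellP h; omega) _
    have hne : ∀ d ∈ l, num d ≠ num c := fun d hd e => hl'.1 (hnum e ▸ hd)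
    have ha : ∀ d ∈ l, (exec (pullCellP (num c)) M).arr (num d) = M.arr (num d) := fun d hd =>
      exec_arr (fun h => hne d hd (arrs_pullCellP h)) _
    obtain ⟨e23, earr⟩ := pullCellP_spec (num c) M
    have e20 := hr 20 (by norm_num) (by norm_num)
    have hc := h1 c (by simp)
    obtain ⟨y, y1, y2, y3, y4⟩ := ih hl'.2 (exec (pullCellP (num c)) M) (by rw [e23]; omega)
      (fun d hd => by rw [ha d hd, e20]; exact h1 d (by simp [hd]))
    set δ := min (M.reg 23) (M.arr (num c) (M.reg 20)) with hδ
    have hy : ∀ d ∈ l, Function.update y c δ d = y d := fun d hd =>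
      Function.update_of_ne (fun e => hl'.1 (by rwa [← e])) _ _
    have hs : (l.map (Function.update y c δ)).sum = (l.map y).sum := by
      rw [List.map_congr_left hy]
    have hn : 0 ≤ (l.map fun c => M.arr (num c) (M.reg 20)).sum :=
      List.sum_nonneg fun z hz => by
        obtain ⟨d, hd, rfl⟩ := List.mem_map.1 hz
        exact h1 d (by simp [hd])
    rw [e20] at y1 y2
    have hmap : (l.map fun d => (exec (pullCellP (num c)) M).arr (num d) (M.reg 20)) =
        l.map fun d => M.arr (num d) (M.reg 20) :=
      List.map_congr_left fun d hd => by rw [ha d hd]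
    rw [hmap, e23] at y2
    rw [e23] at y3
    refine ⟨Function.update y c δ, ?_, ?_, ?_, ?_⟩
    · intro d hd
      rcases List.mem_cons.1 hd with rfl | hd
      · rw [Function.update_self]; omega
      · rw [hy d hd]
        have := y1 d hd
        rwa [ha d hd] at this
    · simp only [List.map_cons, List.sum_cons, Function.update_self, hs, y2]
      omega
    · simp only [pullP, exec, List.map_cons, List.sum_cons, Function.update_self, hs, y3]
      ring
    · intro d hd q
      simp only [pullP, exec]
      rcases List.mem_cons.1 hd with rfl | hd
      · rw [exec_arr, earr, Function.update_self]
        intro h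
        obtain ⟨e, he, h5⟩ := arrs_pullP h
        exact hne e he h5.symm
      · rw [y4 d hd, ha d hd, hr 21 (by norm_num) (by norm_num), hr 22 (by norm_num) (by norm_num),
          e20, hy d hd]

variable {n m k K : ℕ} {Γ : Setup n m k} {S : Finset ι} {X : ι → Fin n → Fin n → ℤ}
  {Y : ι → Fin m → ℤ}

/-- The memory holds the amounts `X` and `Y` of the commodities in `S`. -/
structure RouteRep (Γ : Setup n m k) (num : ι → ℕ) (S : Finset ι) (M : Memory)
    (X : ι → Fin n → Fin n → ℤ) (Y : ι → Fin m → ℤ) : Prop where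
  cell_eq : ∀ c ∈ S, ∀ a ∈ Γ.U, ∀ b ∈ Γ.U, M.arr (num c) (Γ.off a + (b : ℕ)) = X c a b
  arc_eq : ∀ c ∈ S, ∀ e : Fin m, M.arr (num c) (e : ℕ) = Y c e

theorem RouteRep.congr {N : Memory} (h : RouteRep Γ num S M X Y)
    (ha : ∀ c ∈ S, N.arr (num c) = M.arr (num c)) : RouteRep Γ num S N X Y where
  cell_eq c hc := by rw [ha c hc]; exact h.cell_eq c hc
  arc_eq c hc := by rw [ha c hc]; exact h.arc_eq c hc

theorem Setup.off_add_eq_iff (Γ : Setup n m k) {a b x y : Fin n} (ha : a ∈ Γ.U) (hx : x ∈ Γ.U) :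
    Γ.off a + ((b : ℕ) : ℤ) = Γ.off x + (y : ℕ) ↔ a = x ∧ b = y :=
  ⟨fun h => Γ.disjoint a ha x hx b y h, by rintro ⟨rfl, rfl⟩; rfl⟩

theorem Setup.off_add_ne (Γ : Setup n m k) {a b : Fin n} (ha : a ∈ Γ.U) (e : Fin m) :
    ((e : ℕ) : ℤ) ≠ Γ.off a + (b : ℕ) := by
  have := Γ.le_off a ha
  have := e.2
  omega

theorem RouteRep.pull [DecidableEq ι] (h : RouteRep Γ num S M X Y) (hnum : Function.Injective num)
    {a b : Fin n} (ha : a ∈ Γ.U) (hb : b ∈ Γ.U) (hp : M.reg 20 = Γ.off a + (b : ℕ))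
    (h0 : 0 ≤ M.reg 23) (hX : ∀ c ∈ S, 0 ≤ X c a b) :
    ∃ y : ι → ℤ, (∀ c ∈ S, 0 ≤ y c ∧ y c ≤ X c a b) ∧
      ∑ c ∈ S, y c = min (M.reg 23) (∑ c ∈ S, X c a b) ∧
      (exec (pullP num S.toList) M).reg 23 = M.reg 23 - ∑ c ∈ S, y c ∧
      ∀ c ∈ S, ∀ q, (exec (pullP num S.toList) M).arr (num c) q = M.arr (num c) q +
        y c * ((if q = M.reg 21 then 1 else 0) + (if q = M.reg 22 then 1 else 0) -
          if q = Γ.off a + (b : ℕ) then 1 else 0) := by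
  have e : ∀ c ∈ S, M.arr (num c) (M.reg 20) = X c a b := fun c hc => by
    rw [hp]; exact h.cell_eq c hc a ha b hb
  obtain ⟨y, y1, y2, y3, y4⟩ := pullP_spec hnum S.nodup_toList M h0 (fun c hc => by
    rw [Finset.mem_toList] at hc
    rw [e c hc]; exact hX c hc)
  rw [Finset.sum_map_toList] at y2 y3
  rw [Finset.sum_map_toList, Finset.sum_congr rfl e] at y2
  refine ⟨y, fun c hc => ?_, y2, y3, fun c hc q => ?_⟩
  · rw [← e c hc]; exact y1 c (Finset.mem_toList.2 hc)
  · rw [y4 c (Finset.mem_toList.2 hc), hp]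

/-- Lead the flow between the nodes in the registers `ra` and `rb` through the node in the
register `rv` with its mate in the register `rw`. -/
noncomputable def rerouteP (K : ℕ) (num : ι → ℕ) (S : Finset ι) (ra rb rv rw : ℕ) : Program :=
  .seq (block [.assign 20 (addr K ra rb), .assign 21 (addr K ra rv), .assign 22 (addr K rw rb)])
    (pullP num S.toList)

theorem RouteRep.rerouteP [DecidableEq ι] (h : RouteRep Γ num S M X Y)
    (hnum : Function.Injective num) {ra rb rv rw : ℕ} (h1 : ra < 20) (h2 : rb < 20) (h3 : rv < 20)
    (h4 : rw < 20) (hoff : ∀ u ∈ Γ.U, M.arr (K + 6) (u : ℕ) = Γ.off u) {a b v : Fin n}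
    (ha : a ∈ Γ.U) (hb : b ∈ Γ.U) (hv : v ∈ Γ.U) (qa : M.reg ra = (a : ℕ)) (qb : M.reg rb = (b : ℕ))
    (qv : M.reg rv = (v : ℕ)) (qw : M.reg rw = (Γ.G.mateV v : ℕ))
    (h0 : 0 ≤ M.reg 23) (hX : ∀ c ∈ S, 0 ≤ X c a b) :
    ∃ y : ι → ℤ, (∀ c ∈ S, 0 ≤ y c ∧ y c ≤ X c a b) ∧
      ∑ c ∈ S, y c = min (M.reg 23) (∑ c ∈ S, X c a b) ∧
      (exec (rerouteP K num S ra rb rv rw) M).reg 23 = M.reg 23 - ∑ c ∈ S, y c ∧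
      RouteRep Γ num S (exec (rerouteP K num S ra rb rv rw) M)
        (fun c => Γ.G.reroute (X c) v a b (y c)) Y := by
  have hw := Γ.mate_mem v hv
  simp only [RAM.rerouteP, exec]
  set M1 := exec (block [.assign 20 (addr K ra rb), .assign 21 (addr K ra rv),
    .assign 22 (addr K rw rb)]) M with hM1
  have e20 : M1.reg 20 = Γ.off a + (b : ℕ) := by
    simp [hM1, block, exec, Memory.setReg, qa, qb, hoff a ha]
  have e21 : M1.reg 21 = Γ.off a + (v : ℕ) := by
    simp [hM1, block, exec, Memory.setReg, Function.update_of_ne (show ra ≠ 20 by omega),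
      Function.update_of_ne (show rv ≠ 20 by omega), qa, qv, hoff a ha]
  have e22 : M1.reg 22 = Γ.off (Γ.G.mateV v) + (b : ℕ) := by
    simp [hM1, block, exec, Memory.setReg, Function.update_of_ne (show rw ≠ 20 by omega),
      Function.update_of_ne (show rb ≠ 20 by omega), Function.update_of_ne (show rw ≠ 21 by omega),
      Function.update_of_ne (show rb ≠ 21 by omega), qb, qw, hoff _ hw]
  have e23 : M1.reg 23 = M.reg 23 := exec_reg (by simp [block, regs]) _
  have g1 : RouteRep Γ num S M1 X Y := h.congr fun _ _ => rfl
  obtain ⟨y, y1, y2, y3, y4⟩ := g1.pull hnum ha hb e20 (by rw [e23]; exact h0) hX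
  rw [e23] at y2 y3
  rw [e21, e22] at y4
  refine ⟨y, y1, y2, y3, ⟨fun c hc p hp q hq => ?_, fun c hc e => ?_⟩⟩
  · rw [y4 c hc, g1.cell_eq c hc p hp q hq]
    simp only [Γ.off_add_eq_iff hp ha, Γ.off_add_eq_iff hp hw, SkewGraph.reroute, cell]
  · rw [y4 c hc, g1.arc_eq c hc]
    simp [Γ.off_add_ne ha, Γ.off_add_ne hw]

/-- Lead the flow between the nodes in the registers `ra` and `rb` through the arc in the
register `re`. -/
noncomputable def leadP (K : ℕ) (num : ι → ℕ) (S : Finset ι) (ra rb re : ℕ) : Program :=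
  .seq (block [.assign 20 (addr K ra rb), .assign 21 (.reg re), .assign 22 (.const (-1))])
    (pullP num S.toList)

/-- A transfer always has two targets, so the second one is the unused cell `-1`. Arcs occupy the
cells below `m` and matrix rows those from `m` on, which lets one array hold both `X c` and `Y c`.
-/
theorem RouteRep.leadP [DecidableEq ι] (h : RouteRep Γ num S M X Y)
    (hnum : Function.Injective num) {ra rb re : ℕ} (h3 : re < 20)
    (hoff : ∀ u ∈ Γ.U, M.arr (K + 6) (u : ℕ) = Γ.off u) {a b : Fin n} {e : Fin m}
    (ha : a ∈ Γ.U) (hb : b ∈ Γ.U) (qa : M.reg ra = (a : ℕ)) (qb : M.reg rb = (b : ℕ))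
    (qe : M.reg re = (e : ℕ)) (h0 : 0 ≤ M.reg 23) (hX : ∀ c ∈ S, 0 ≤ X c a b) :
    ∃ y : ι → ℤ, (∀ c ∈ S, 0 ≤ y c ∧ y c ≤ X c a b) ∧
      ∑ c ∈ S, y c = min (M.reg 23) (∑ c ∈ S, X c a b) ∧
      (exec (leadP K num S ra rb re) M).reg 23 = M.reg 23 - ∑ c ∈ S, y c ∧
      RouteRep Γ num S (exec (leadP K num S ra rb re) M)
        (fun c p q => X c p q - y c * cell a b p q)
        (fun c e' => Y c e' + if e' = e then y c else 0) := by
  simp only [RAM.leadP, exec]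
  set M1 := exec (block [.assign 20 (addr K ra rb), .assign 21 (.reg re),
    .assign 22 (.const (-1))]) M with hM1
  have e20 : M1.reg 20 = Γ.off a + (b : ℕ) := by
    simp [hM1, block, exec, Memory.setReg, qa, qb, hoff a ha]
  have e21 : M1.reg 21 = (e : ℕ) := by
    simp [hM1, block, exec, Memory.setReg, Term.eval, Function.update_of_ne (show re ≠ 20 by omega),
      qe]
  have e22 : M1.reg 22 = -1 := by
    simp [hM1, block, exec, Memory.setReg, Term.eval]
  have e23 : M1.reg 23 = M.reg 23 := exec_reg (by simp [block, regs]) _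
  have g1 : RouteRep Γ num S M1 X Y := h.congr fun _ _ => rfl
  obtain ⟨y, y1, y2, y3, y4⟩ := g1.pull hnum ha hb e20 (by rw [e23]; exact h0) hX
  rw [e23] at y2 y3
  rw [e21, e22] at y4
  refine ⟨y, y1, y2, y3, ⟨fun c hc p hp q hq => ?_, fun c hc e' => ?_⟩⟩
  · have i1 : Γ.off p + ((q : ℕ) : ℤ) ≠ (e : ℕ) := (Γ.off_add_ne hp e).symm
    have i2 : Γ.off p + ((q : ℕ) : ℤ) ≠ -1 := by have := Γ.le_off p hp; omega
    rw [y4 c hc, g1.cell_eq c hc p hp q hq]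
    simp only [Γ.off_add_eq_iff hp ha, cell, if_neg i1, if_neg i2]
    ring
  · have i2 : ((e' : ℕ) : ℤ) ≠ -1 := by omega
    rw [y4 c hc, g1.arc_eq c hc, if_neg i2, if_neg (Γ.off_add_ne ha e')]
    simp only [Nat.cast_inj, ← Fin.ext_iff]
    split_ifs <;> ring

end RAM

/-! ### Undoing the records and distributing the amounts to the arcs -/

namespace RAM

open SymMatrix

variable {n m k K : ℕ} {Γ : Setup n m k} {ι : Type*} [DecidableEq ι] {num : ι → ℕ} {S : Finset ι}
  {M : Memory} {X : ι → Fin n → Fin n → ℤ} {Y : ι → Fin m → ℤ}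

theorem arrs_rerouteP {ra rb rv rw a : ℕ} (h : a ∈ arrs (rerouteP K num S ra rb rv rw)) :
    ∃ c ∈ S, a = num c := by
  simp only [rerouteP, block, arrs, Set.mem_union, Set.mem_empty_iff_false, false_or] at h
  simpa using arrs_pullP h

theorem regs_rerouteP {ra rb rv rw r : ℕ} (h : r ∈ regs (rerouteP K num S ra rb rv rw)) :
    20 ≤ r := by
  simp only [rerouteP, block, regs, Set.mem_union, Set.mem_empty_iff_false, or_false,
    Set.mem_singleton_iff] at h
  rcases h with h | h
  · omega
  · have := regs_pullP h; omega

theorem arrs_leadP {ra rb re a : ℕ} (h : a ∈ arrs (leadP K num S ra rb re)) :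
    ∃ c ∈ S, a = num c := by
  simp only [leadP, block, arrs, Set.mem_union, Set.mem_empty_iff_false, false_or] at h
  simpa using arrs_pullP h

theorem regs_leadP {ra rb re r : ℕ} (h : r ∈ regs (leadP K num S ra rb re)) : 20 ≤ r := by
  simp only [leadP, block, regs, Set.mem_union, Set.mem_empty_iff_false, or_false,
    Set.mem_singleton_iff] at h
  rcases h with h | h
  · omega
  · have := regs_pullP h; omega

/-- Fetch the latest record. -/
def fetchRecordP (K : ℕ) : Program := block [
  .assign 9 (.minus (.reg 9) (.const 1)), .assign 14 (.read (K + 14) (.reg 9)),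
  .assign 15 (.read 3 (.reg 14)), .assign 16 (.read (K + 15) (.reg 9)),
  .assign 17 (.read (K + 16) (.reg 9)), .assign 23 (.read (K + 17) (.reg 9))]

/-- Insert a closed walk, in case of a record of that kind, into the array `z`. -/
def insertWalkP (K z : ℕ) : Program :=
  .branch (.eq (.reg 16) (.read 3 (.reg 17))) (incr z (addr K 16 17) (.reg 23)) .skip

/-- Undo the latest splitting operation. -/
noncomputable def undoStepP (K : ℕ) (num : ι → ℕ) (S : Finset ι) (z : ℕ) : Program :=
  .seq (fetchRecordP K) (.seq (insertWalkP K z)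
    (.seq (rerouteP K num S 16 17 14 15) (rerouteP K num S 17 16 15 14)))

theorem loopFree_undoStepP (K : ℕ) (num : ι → ℕ) (S : Finset ι) (z : ℕ) :
    LoopFree (undoStepP K num S z) := by
  simp [undoStepP, fetchRecordP, insertWalkP, rerouteP, block, incr, LoopFree, loopFree_pullP]

theorem RouteRep.insertWalkP (h : RouteRep Γ num S M X Y) (hf : Fixed Γ K M)
    (hnum : Function.Injective num) {c0 : ι} {a b : Fin n} {δ : ℤ} (ha : a ∈ Γ.U)
    (q16 : M.reg 16 = (a : ℕ)) (q17 : M.reg 17 = (b : ℕ)) (q23 : M.reg 23 = δ) :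
    RouteRep Γ num S (exec (insertWalkP K (num c0)) M) (fun c p q => X c p q +
      if a = Γ.G.mateV b ∧ c = c0 then δ * cell a b p q else 0) Y := by
  have hiff : Test.Holds M (.eq (.reg 16) (.read 3 (.reg 17))) ↔ a = Γ.G.mateV b := by
    simp only [Test.Holds, Term.eval, q16, q17, hf.mate_eq, Fin.cast_eq_iff]
  by_cases hab : a = Γ.G.mateV b
  · simp only [RAM.insertWalkP, exec, if_pos (hiff.2 hab)]
    have e : (exec (incr (num c0) (addr K 16 17) (.reg 23)) M).arr (num c0) =
        Function.update (M.arr (num c0)) (Γ.off a + (b : ℕ))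
          (M.arr (num c0) (Γ.off a + (b : ℕ)) + δ) := by
      simp [exec, incr, Term.eval, Memory.setArr, q16, q17, q23, hf.off_eq a ha]
    have e' : ∀ c, c ≠ c0 → (exec (incr (num c0) (addr K 16 17) (.reg 23)) M).arr (num c) =
        M.arr (num c) := fun c hc => exec_arr (by
      simp only [incr, arrs, Set.mem_singleton_iff]
      exact fun h => hc (hnum h)) _
    refine ⟨fun c hc p hp q hq => ?_, fun c hc e' => ?_⟩
    · by_cases hc0 : c = c0
      · subst hc0
        rw [e, Function.update_apply, if_pos (⟨hab, rfl⟩ : a = Γ.G.mateV b ∧ c = c)]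
        by_cases h1 : p = a ∧ q = b
        · rw [if_pos ((Γ.off_add_eq_iff hp ha).2 h1), ← h1.1, ← h1.2, h.cell_eq c hc p hp q hq]
          simp [cell]
        · rw [if_neg fun h2 => h1 ((Γ.off_add_eq_iff hp ha).1 h2), h.cell_eq c hc p hp q hq]
          simp [cell, h1]
      · have := e' c hc0
        rw [this, h.cell_eq c hc p hp q hq]
        simp [hc0]
    · by_cases hc0 : c = c0
      · subst hc0
        rw [e, Function.update_of_ne (Γ.off_add_ne ha _), h.arc_eq c hc]
      · have := ‹∀ c, c ≠ c0 → _› c hc0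
        rw [this, h.arc_eq c hc]
  · simp only [RAM.insertWalkP, exec, if_neg (fun h => hab (hiff.1 h))]
    simpa [hab] using h

/-- Only arrays of commodities are written. Their numbers lie between those of the input and those
of the working arrays, so the input, the row positions and the remaining records survive. -/
theorem RouteRep.undoStepP (h : RouteRep Γ num S M X Y) (hf : Fixed Γ K M)
    (hnum : Function.Injective num) (hlo : ∀ c, 6 ≤ num c) (hhi : ∀ c, num c < K + 6)
    {src snk : ι → Fin n} {c0 : ι} (hc0 : c0 ∈ S) {r : Record (Fin n)} {l : List (Record (Fin n))}
    (hl : LogRep K M (r :: l)) (h9 : M.reg 9 = (r :: l).length) {A0 A : Fin n → Fin n → ℤ}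
    (hR : Reduces Γ.G.mateV Γ.U A0 (r :: l) A) (hX : Γ.G.Routing S src snk A X Y) :
    ∃ B X', Fixed Γ K (exec (undoStepP K num S (num c0)) M) ∧
      RouteRep Γ num S (exec (undoStepP K num S (num c0)) M) X' Y ∧
      LogRep K (exec (undoStepP K num S (num c0)) M) l ∧
      (exec (undoStepP K num S (num c0)) M).reg 9 = l.length ∧
      Reduces Γ.G.mateV Γ.U A0 l B ∧ Γ.G.Routing S src snk B X' Y := by
  obtain ⟨l14, l15, l16, l17, hl'⟩ := hl
  cases hR with
  | @cons _ B _ hR hv ha hb hδ hloop hle =>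
  obtain ⟨v, a, b, δ⟩ := r
  dsimp only at *
  have hexec : exec (RAM.undoStepP K num S (num c0)) M =
    exec (RAM.rerouteP K num S 17 16 15 14) (exec (RAM.rerouteP K num S 16 17 14 15)
      (exec (RAM.insertWalkP K (num c0)) (exec (fetchRecordP K) M))) := rfl
  have h9' : M.reg 9 - 1 = l.length := by rw [h9]; simp
  set M1 := exec (fetchRecordP K) M with hM1
  have a1 : M1.arr = M.arr := rfl
  have r1 : ∀ r, r < 9 → M1.reg r = M.reg r := fun r h =>
    exec_reg (by simp [fetchRecordP, block, regs]; omega) _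
  have q9 : M1.reg 9 = l.length := by
    simp [hM1, fetchRecordP, block, exec, Memory.setReg, Term.eval, h9']
  have q14 : M1.reg 14 = (v : ℕ) := by
    simp [hM1, fetchRecordP, block, exec, Memory.setReg, Term.eval, h9', l14]
  have q15 : M1.reg 15 = (Γ.G.mateV v : ℕ) := by
    simp [hM1, fetchRecordP, block, exec, Memory.setReg, Term.eval, h9', l14, hf.mate_eq]
  have q16 : M1.reg 16 = (a : ℕ) := by
    simp [hM1, fetchRecordP, block, exec, Memory.setReg, Term.eval, h9', l15]
  have q17 : M1.reg 17 = (b : ℕ) := by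
    simp [hM1, fetchRecordP, block, exec, Memory.setReg, Term.eval, h9', l16]
  have q23 : M1.reg 23 = δ := by
    simp [hM1, fetchRecordP, block, exec, Memory.setReg, Term.eval, h9', l17]
  have f1 : Fixed Γ K M1 := hf.congr (r1 _ (by norm_num)) (r1 _ (by norm_num)) fun _ _ => by rw [a1]
  have g1 : RouteRep Γ num S M1 X Y := h.congr fun _ _ => by rw [a1]
  have g2 := g1.insertWalkP f1 hnum (c0 := c0) ha q16 q17 q23
  set X1 : ι → Fin n → Fin n → ℤ := fun c p q => X c p q +
    if a = Γ.G.mateV b ∧ c = c0 then δ * cell a b p q else 0 with hX1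
  set M2 := exec (RAM.insertWalkP K (num c0)) M1 with hM2
  have r2 : ∀ r, M2.reg r = M1.reg r := fun r =>
    exec_reg (by simp [RAM.insertWalkP, incr, regs]) _
  have a2 : ∀ x, (∀ c, x ≠ num c) → M2.arr x = M1.arr x := fun x hx =>
    exec_arr (by simpa [RAM.insertWalkP, incr, arrs] using hx c0) _
  have n1 : ∀ c ∈ S, ∀ p q, 0 ≤ X1 c p q := by
    intro c hc p q
    have := hX.nonneg c hc p q
    have : 0 ≤ δ * cell a b p q := mul_nonneg hδ (by simp only [cell]; split_ifs <;> norm_num)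
    simp only [hX1]
    split_ifs <;> omega
  have hv' := Γ.mate_mem v hv
  obtain ⟨y, y1, y2, y3, g3⟩ := g2.rerouteP hnum (K := K) (ra := 16) (rb := 17) (rv := 14) (rw := 15)
    (by norm_num) (by norm_num) (by norm_num) (by norm_num)
    (fun u hu => by
      rw [a2 _ fun c => by have := hhi c; omega]; exact f1.off_eq u hu) ha hb hv
    (by rw [r2, q16]) (by rw [r2, q17]) (by rw [r2, q14]) (by rw [r2, q15])
    (by rw [r2, q23]; exact hδ) fun c hc => n1 c hc a b
  rw [r2, q23] at y2 y3
  set M3 := exec (RAM.rerouteP K num S 16 17 14 15) M2 with hM3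
  have r3 : ∀ r, r < 20 → M3.reg r = M2.reg r := fun r hr =>
    exec_reg (fun h => by have := regs_rerouteP h; omega) _
  have a3 : ∀ x, (∀ c, x ≠ num c) → M3.arr x = M2.arr x := fun x hx =>
    exec_arr (fun h => by obtain ⟨c, -, hc⟩ := arrs_rerouteP h; exact hx c hc) _
  have n2 : ∀ c ∈ S, ∀ p q, 0 ≤ Γ.G.reroute (X1 c) v a b (y c) p q := fun c hc =>
    SkewGraph.reroute_nonneg (n1 c hc) (y1 c hc).1 (y1 c hc).2
  -- The mated walk, with the roles of `a`, `b` and of `v` and its mate exchanged; the register 23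
  -- holds what the first transfer has left over.
  obtain ⟨z, z1, z2, -, g4⟩ := g3.rerouteP hnum (K := K) (ra := 17) (rb := 16) (rv := 15) (rw := 14)
    (by norm_num) (by norm_num) (by norm_num) (by norm_num)
    (fun u hu => by
      have : ∀ c, K + 6 ≠ num c := fun c => by have := hhi c; omega
      rw [a3 _ this, a2 _ this]; exact f1.off_eq u hu) hb ha hv'
    (by rw [r3 _ (by norm_num), r2, q17]) (by rw [r3 _ (by norm_num), r2, q16])
    (by rw [r3 _ (by norm_num), r2, q15])
    (by rw [r3 _ (by norm_num), r2, q14, Γ.G.mateV_mateV])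
    (by rw [y3, y2]; omega) fun c hc => n2 c hc b a
  rw [y3] at z2
  rw [hexec]
  set M4 := exec (RAM.rerouteP K num S 17 16 15 14) M3 with hM4
  have r4 : ∀ r, r < 20 → M4.reg r = M1.reg r := fun r hr => by
    rw [hM4, exec_reg (fun h => by have := regs_rerouteP h; omega), r3 r hr, r2]
  have a4 : ∀ x, (∀ c, x ≠ num c) → M4.arr x = M.arr x := fun x hx => by
    rw [hM4, exec_arr (fun h => by obtain ⟨c, -, hc⟩ := arrs_rerouteP h; exact hx c hc),
      a3 x hx, a2 x hx, a1]
  refine ⟨B, _, ?_, g4, ?_, ?_, hR, hX.undo hc0 hδ hloop hle (fun _ _ _ => rfl) y1 y2 z1 z2⟩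
  · refine hf.congr (by rw [r4 _ (by norm_num), r1 _ (by norm_num)])
      (by rw [r4 _ (by norm_num), r1 _ (by norm_num)]) fun x hx => a4 x fun c => ?_
    have := hlo c
    have := hhi c
    omega
  · refine hl'.congr fun x h1 h2 z hz => ?_
    rw [a4 x fun c => by have := hhi c; omega]
  · rw [r4 _ (by norm_num), q9]

/-- Undo all splitting operations. -/
noncomputable def undoP (K : ℕ) (num : ι → ℕ) (S : Finset ι) (z : ℕ) : Program :=
  .loop (.le (.const 1) (.reg 9)) (undoStepP K num S z)

theorem halts_undoP (h : RouteRep Γ num S M X Y) (hf : Fixed Γ K M)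
    (hnum : Function.Injective num) (hlo : ∀ c, 6 ≤ num c) (hhi : ∀ c, num c < K + 6)
    {src snk : ι → Fin n} {c0 : ι} (hc0 : c0 ∈ S) {l : List (Record (Fin n))}
    (hl : LogRep K M l) (h9 : M.reg 9 = l.length) {A0 A : Fin n → Fin n → ℤ}
    (hR : Reduces Γ.G.mateV Γ.U A0 l A) (hX : Γ.G.Routing S src snk A X Y) {C x w : ℝ}
    (hw : 0 ≤ w) (hC : (bound (undoStepP K num S (num c0)) : ℝ) + 10 ≤ C)
    (hx : C * (l.length + 1) + w ≤ x) :
    Halts (undoP K num S (num c0)) M x fun N y => ∃ X', Fixed Γ K N ∧ RouteRep Γ num S N X' Y ∧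
      Γ.G.Routing S src snk A0 X' Y ∧ w ≤ y := by
  have n1 : (0 : ℝ) ≤ bound (undoStepP K num S (num c0)) := Nat.cast_nonneg _
  have hcost : ((Test.le (.const 1) (.reg 9)).cost : ℝ) = 3 := by simp [Test.cost, Term.cost]
  refine Halts.loop (I := fun N y => ∃ (l : List (Record (Fin n))) (A : Fin n → Fin n → ℤ) 
    (X : ι → Fin n → Fin n → ℤ), Fixed Γ K N ∧
    RouteRep Γ num S N X Y ∧ LogRep K N l ∧ N.reg 9 = l.length ∧ Reduces Γ.G.mateV Γ.U A0 l A ∧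
    Γ.G.Routing S src snk A X Y ∧ C * (l.length + 1) + w ≤ y) ?_ ?_ ?_
    ⟨l, A, X, hf, h, hl, h9, hR, hX, hx⟩
  · rintro N y ⟨l, A, X, -, -, -, -, -, -, hy⟩
    refine le_trans ?_ hy
    have : 0 ≤ C := by linarith
    positivity
  · rintro N y ⟨l, A, X, c1, c2, c3, c4, c5, c6, hy⟩ hb
    simp only [Test.Holds, Term.eval, c4] at hb
    cases l with
    | nil => simp at hb
    | cons r l =>
      obtain ⟨B, X', d1, d2, d3, d4, d5, d6⟩ := c2.undoStepP c1 hnum hlo hhi hc0 c3 c4 c5 c6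
      refine Halts.of_loopFree (loopFree_undoStepP _ _ _ _) fun y' hy' =>
        ⟨l, B, X', d1, d2, d3, d4, d5, d6, ?_⟩
      rw [hcost] at hy'
      push_cast [List.length_cons] at hy
      linarith
  · rintro N y ⟨l, A, X, c1, c2, c3, c4, c5, c6, hy⟩ hb
    simp only [Test.Holds, Term.eval, c4] at hb
    cases l with
    | cons r l => simp at hb
    | nil =>
      cases c5
      refine ⟨X, c1, c2, c6, ?_⟩
      rw [hcost]
      simp only [List.length_nil, Nat.cast_zero] at hy
      linarith

/-- Lead the flow through the arc in the register 10 and its mate. -/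
noncomputable def leadPairP (K : ℕ) (num : ι → ℕ) (S : Finset ι) : Program :=
  .seq (block [.assign 16 (.read 0 (.reg 10)), .assign 19 (.read 2 (.reg 10)),
    .assign 17 (.read 0 (.reg 19)), .assign 23 (.read 4 (.reg 10))])
    (.seq (leadP K num S 16 17 10) (leadP K num S 17 16 19))

/-- Treat the arc in the register 10 and go to the next one. -/
noncomputable def distributeStepP (K : ℕ) (num : ι → ℕ) (S : Finset ι) : Program :=
  .seq (.branch (.le (.plus (.reg 10) (.const 1)) (.read 2 (.reg 10))) (leadPairP K num S) .skip)
    (.assign 10 (.plus (.reg 10) (.const 1)))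

theorem loopFree_distributeStepP (K : ℕ) (num : ι → ℕ) (S : Finset ι) :
    LoopFree (distributeStepP K num S) := by
  simp [distributeStepP, leadPairP, leadP, block, LoopFree, loopFree_pullP]

theorem RouteRep.leadPairP (h : RouteRep Γ num S M X Y) (hf : Fixed Γ K M)
    (hnum : Function.Injective num) (hlo : ∀ c, 6 ≤ num c) (hhi : ∀ c, num c < K + 6)
    {src snk : ι → Fin n} {e : Fin m} (h10 : M.reg 10 = (e : ℕ)) {A : Fin n → Fin n → ℤ}
    (hX : Γ.G.Routing S src snk (bump A (Γ.G.tail e) (Γ.G.tail (Γ.G.mateE e)) (Γ.f e)) X Y)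
    (hA : 0 ≤ A (Γ.G.tail e) (Γ.G.tail (Γ.G.mateE e))) :
    ∃ X' Y', Fixed Γ K (exec (leadPairP K num S) M) ∧
      RouteRep Γ num S (exec (leadPairP K num S) M) X' Y' ∧ Γ.G.Routing S src snk A X' Y' ∧
      (exec (leadPairP K num S) M).reg 10 = (e : ℕ) ∧
      ∃ y z : ι → ℤ, (∀ c ∈ S, 0 ≤ y c) ∧ (∀ c ∈ S, 0 ≤ z c) ∧
        ∑ c ∈ S, y c + ∑ c ∈ S, z c = Γ.f e ∧
        ∀ c e', Y' c e' = Y c e' + (if e' = e then y c else 0) +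
          if e' = Γ.G.mateE e then z c else 0 := by
  set a := Γ.G.tail e with ha
  set b := Γ.G.tail (Γ.G.mateE e) with hb
  have haU : a ∈ Γ.U := Γ.tail_mem e
  have hbU : b ∈ Γ.U := Γ.tail_mem _
  set P1 := block [.assign 16 (.read 0 (.reg 10)), .assign 19 (.read 2 (.reg 10)),
    .assign 17 (.read 0 (.reg 19)), .assign 23 (.read 4 (.reg 10))] with hP1
  have hexec : exec (RAM.leadPairP K num S) M =
    exec (RAM.leadP K num S 17 16 19) (exec (RAM.leadP K num S 16 17 10) (exec P1 M)) := rfl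
  have e2 : M.arr 2 (e : ℕ) = (Γ.G.mateE e : ℕ) := by
    rw [hf.input_eq 2 (by norm_num)]; exact table_apply (fun e => ((Γ.G.mateE e : ℕ) : ℤ)) e
  have e0 : ∀ e : Fin m, M.arr 0 (e : ℕ) = (Γ.G.tail e : ℕ) := fun e => by
    rw [hf.input_eq 0 (by norm_num)]; exact table_apply (fun e => ((Γ.G.tail e : ℕ) : ℤ)) e
  have e4 : M.arr 4 (e : ℕ) = Γ.f e := by
    rw [hf.input_eq 4 (by norm_num)]; exact table_apply Γ.f e
  set M1 := exec P1 M with hM1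
  have a1 : M1.arr = M.arr := rfl
  have r1 : ∀ r, r < 16 → M1.reg r = M.reg r := fun r h =>
    exec_reg (by simp [hP1, block, regs]; omega) _
  have q16 : M1.reg 16 = (a : ℕ) := by
    simp [hM1, hP1, block, exec, Memory.setReg, Term.eval, h10, e0, ha]
  have q19 : M1.reg 19 = (Γ.G.mateE e : ℕ) := by
    simp [hM1, hP1, block, exec, Memory.setReg, Term.eval, h10, e2]
  have q17 : M1.reg 17 = (b : ℕ) := by
    simp [hM1, hP1, block, exec, Memory.setReg, Term.eval, h10, e2, e0, hb]
  have q23 : M1.reg 23 = Γ.f e := by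
    simp [hM1, hP1, block, exec, Memory.setReg, Term.eval, h10, e4]
  have g1 : RouteRep Γ num S M1 X Y := h.congr fun _ _ => by rw [a1]
  obtain ⟨y, y1, y2, y3, g2⟩ := g1.leadP hnum (K := K) (ra := 16) (rb := 17) (re := 10)
    (by norm_num) (fun u hu => by rw [a1]; exact hf.off_eq u hu) haU hbU q16 q17
    (by rw [r1 _ (by norm_num), h10]) (by rw [q23]; exact Γ.flow.nonneg e)
    fun c hc => hX.nonneg c hc a b
  rw [q23] at y2 y3
  set M2 := exec (RAM.leadP K num S 16 17 10) M1 with hM2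
  have r2 : ∀ r, r < 20 → M2.reg r = M1.reg r := fun r hr =>
    exec_reg (fun h => by have := regs_leadP h; omega) _
  have a2 : ∀ x, (∀ c, x ≠ num c) → M2.arr x = M1.arr x := fun x hx =>
    exec_arr (fun h => by obtain ⟨c, -, hc⟩ := arrs_leadP h; exact hx c hc) _
  have n2 : ∀ c ∈ S, 0 ≤ X c b a - y c * cell a b b a := by
    intro c hc
    simp only [cell]
    split_ifs with h1
    · have := (y1 c hc).2
      rw [h1.1] at this ⊢
      linarith
    · have := hX.nonneg c hc b a; omega
  obtain ⟨z, z1, z2, -, g3⟩ := g2.leadP hnum (K := K) (ra := 17) (rb := 16) (re := 19)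
    (by norm_num) (fun u hu => by
      rw [a2 _ fun c => by have := hhi c; omega, a1]; exact hf.off_eq u hu) hbU haU
    (by rw [r2 _ (by norm_num), q17]) (by rw [r2 _ (by norm_num), q16])
    (by rw [r2 _ (by norm_num), q19]) (by rw [y3, y2]; omega) n2
  rw [y3] at z2
  rw [hexec]
  set M3 := exec (RAM.leadP K num S 17 16 19) M2 with hM3
  have r3 : ∀ r, r < 16 → M3.reg r = M.reg r := fun r hr => by
    rw [hM3, exec_reg (fun h => by have := regs_leadP h; omega), r2 r (by omega), r1 r hr]
  have a3 : ∀ x, (∀ c, x ≠ num c) → M3.arr x = M.arr x := fun x hx => by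
    rw [hM3, exec_arr (fun h => by obtain ⟨c, -, hc⟩ := arrs_leadP h; exact hx c hc),
      a2 x hx, a1]
  obtain ⟨i1, i2⟩ := hX.unmerge ha hb hA y1 y2 z1 z2
  refine ⟨_, _, ?_, g3, i1, by rw [r3 _ (by norm_num), h10], y, z, fun c hc => (y1 c hc).1,
    fun c hc => (z1 c hc).1, i2, fun _ _ => rfl⟩
  refine hf.congr (r3 _ (by norm_num)) (r3 _ (by norm_num)) fun x hx => a3 x fun c => ?_
  have := hlo c
  have := hhi c
  omega

/-- The amounts `Y` on the arcs up to `i` and their mates make up the flow. -/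
structure Spread (Γ : Setup n m k) (S : Finset ι) (Y : ι → Fin m → ℤ) (i : ℕ) : Prop where
  nonneg : ∀ c ∈ S, ∀ e, 0 ≤ Y c e
  sum_eq : ∀ e : Fin m, (e : ℕ) < i ∨ (Γ.G.mateE e : ℕ) < i →
    ∑ c ∈ S, (Y c e + Y c (Γ.G.mateE e)) = Γ.f e
  eq_zero : ∀ e : Fin m, i ≤ (e : ℕ) → i ≤ (Γ.G.mateE e : ℕ) → ∀ c ∈ S, Y c e = 0

/-- A pair of mated arcs is filled at its smaller number. Until then both of its arcs are empty, so
the new amounts alone make up the value of the flow. -/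
theorem Spread.step {Y' : ι → Fin m → ℤ} {e : Fin m} (h : Spread Γ S Y e)
    (he : e < Γ.G.mateE e) {y z : ι → ℤ} (hy : ∀ c ∈ S, 0 ≤ y c) (hz : ∀ c ∈ S, 0 ≤ z c)
    (hs : ∑ c ∈ S, y c + ∑ c ∈ S, z c = Γ.f e)
    (hY : ∀ c e', Y' c e' = Y c e' + (if e' = e then y c else 0) +
      if e' = Γ.G.mateE e then z c else 0) : Spread Γ S Y' (e + 1) := by
  have hne := Γ.G.mateE_ne e
  have hlt : (e : ℕ) < (Γ.G.mateE e : ℕ) := he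
  have hf : ∀ e, Γ.f (Γ.G.mateE e) = Γ.f e := fun e => congrFun Γ.flow.symmetric e
  refine ⟨fun c hc e' => ?_, fun e' he' => ?_, fun e' h1 h2 c hc => ?_⟩
  · rw [hY]
    have := h.nonneg c hc e'
    have := hy c hc
    have := hz c hc
    split_ifs <;> omega
  · have hsum : ∑ c ∈ S, (Y' c e + Y' c (Γ.G.mateE e)) = Γ.f e := by
      rw [← hs, ← Finset.sum_add_distrib]
      refine Finset.sum_congr rfl fun c hc => ?_
      rw [hY, hY, h.eq_zero e le_rfl hlt.le c hc,
        h.eq_zero (Γ.G.mateE e) hlt.le (by rw [Γ.G.mateE_mateE]) c hc]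
      simp [hne, hne.symm]
    by_cases h1 : e' = e
    · subst h1; exact hsum
    · by_cases h2 : e' = Γ.G.mateE e
      · subst h2
        rw [Γ.G.mateE_mateE, hf, ← hsum]
        exact Finset.sum_congr rfl fun c _ => add_comm _ _
      · have h3 : Γ.G.mateE e' ≠ e := fun h => h2 (by rw [← h, Γ.G.mateE_mateE])
        have h4 : Γ.G.mateE e' ≠ Γ.G.mateE e := fun h => h1 (by
          rw [← Γ.G.mateE_mateE e', h, Γ.G.mateE_mateE])
        have i1 : (e' : ℕ) ≠ e := fun h => h1 (Fin.ext h)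
        have i2 : (Γ.G.mateE e' : ℕ) ≠ e := fun h => h3 (Fin.ext h)
        rw [← h.sum_eq e' (by omega)]
        refine Finset.sum_congr rfl fun c _ => ?_
        rw [hY, hY]
        simp [h1, h2, h3, h4]
  · have i1 : e' ≠ e := by rintro rfl; omega
    have i2 : e' ≠ Γ.G.mateE e := by
      rintro rfl
      rw [Γ.G.mateE_mateE] at h2; omega
    rw [hY, h.eq_zero e' (by omega) (by omega) c hc]
    simp [i1, i2]

theorem Spread.skip {e : Fin m} (h : Spread Γ S Y e) (he : ¬ e < Γ.G.mateE e) :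
    Spread Γ S Y (e + 1) := by
  have hlt : (Γ.G.mateE e : ℕ) < e := lt_of_le_of_ne (not_lt.1 he) fun h =>
    Γ.G.mateE_ne e (Fin.ext h)
  refine ⟨h.nonneg, fun e' he' => h.sum_eq e' ?_, fun e' h1 h2 => h.eq_zero e' (by omega) (by omega)⟩
  by_cases h1 : e' = e
  · subst h1; exact Or.inr hlt
  · by_cases h2 : Γ.G.mateE e' = e
    · left
      rw [← h2, Γ.G.mateE_mateE] at hlt
      rwa [h2] at hlt
    · have i1 : (e' : ℕ) ≠ e := fun h => h1 (Fin.ext h)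
      have i2 : (Γ.G.mateE e' : ℕ) ≠ e := fun h => h2 (Fin.ext h)
      omega

theorem Setup.arcMatrix_nonneg (Γ : Setup n m k) (i : ℕ) (a b : Fin n) :
    0 ≤ Γ.G.arcMatrix Γ.f i a b :=
  Finset.sum_nonneg fun e _ => mul_nonneg (Γ.flow.nonneg e) (pair_nonneg _ _ _ _)

/-- Distribute the flow to the arcs. -/
noncomputable def distributeP (K : ℕ) (num : ι → ℕ) (S : Finset ι) : Program :=
  .loop (.le (.plus (.reg 10) (.const 1)) (.reg 1)) (distributeStepP K num S)

theorem halts_distributeP (h : RouteRep Γ num S M X fun _ _ => 0) (hf : Fixed Γ K M)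
    (hnum : Function.Injective num) (hlo : ∀ c, 6 ≤ num c) (hhi : ∀ c, num c < K + 6)
    {src snk : ι → Fin n} (h10 : M.reg 10 = 0)
    (hX : Γ.G.Routing S src snk Γ.matrix X fun _ _ => 0) {C x w : ℝ}
    (hw : 0 ≤ w) (hC : (bound (distributeStepP K num S) : ℝ) + 10 ≤ C)
    (hx : C * (m + 1) + w ≤ x) :
    Halts (distributeP K num S) M x fun N y => ∃ X' Y', RouteRep Γ num S N X' Y' ∧
      Γ.G.Routing S src snk (fun _ _ => 0) X' Y' ∧ Spread Γ S Y' m ∧ w ≤ y := by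
  have n1 : (0 : ℝ) ≤ bound (distributeStepP K num S) := Nat.cast_nonneg _
  have hcost : ((Test.le (.plus (.reg 10) (.const 1)) (.reg 1)).cost : ℝ) = 5 := by
    simp [Test.cost, Term.cost]
  refine Halts.loop (I := fun N y => ∃ (i : ℕ) (X : ι → Fin n → Fin n → ℤ) (Y : ι → Fin m → ℤ),
    Fixed Γ K N ∧ RouteRep Γ num S N X Y ∧ (N.reg 10 = i ∧ i ≤ m) ∧
    Γ.G.Routing S src snk (Γ.G.arcMatrix Γ.f i) X Y ∧ Spread Γ S Y i ∧
    C * ((m - i : ℕ) + 1) + w ≤ y) ?_ ?_ ?_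
    ⟨0, X, fun _ _ => 0, hf, h, ⟨h10, Nat.zero_le _⟩, hX, ⟨by simp, by simp, by simp⟩, hx⟩
  · rintro N y ⟨i, X, Y, -, -, -, -, -, hy⟩
    refine le_trans ?_ hy
    have : 0 ≤ C := by linarith
    positivity
  · rintro N y ⟨i, X, Y, c1, c2, ⟨c3, c3'⟩, c4, c5, hy⟩ hb
    simp only [Test.Holds, Term.eval, c3, c1.reg_one] at hb
    have hi : i < m := by omega
    set e : Fin m := ⟨i, hi⟩ with he
    have e2 : N.arr 2 i = (Γ.G.mateE e : ℕ) := by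
      rw [c1.input_eq 2 (by norm_num)]; exact table_apply (fun e => ((Γ.G.mateE e : ℕ) : ℤ)) e
    have hiff : Test.Holds N (.le (.plus (.reg 10) (.const 1)) (.read 2 (.reg 10))) ↔
        e < Γ.G.mateE e := by
      simp only [Test.Holds, Term.eval, c3, e2, Fin.lt_def]
      have : (e : ℕ) = i := rfl
      omega
    have key : ∃ (X' : ι → Fin n → Fin n → ℤ) (Y' : ι → Fin m → ℤ) (N1 : Memory),
        exec (distributeStepP K num S) N = N1.setReg 10 (N1.reg 10 + 1) ∧ Fixed Γ K N1 ∧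
        RouteRep Γ num S N1 X' Y' ∧ N1.reg 10 = i ∧
        Γ.G.Routing S src snk (Γ.G.arcMatrix Γ.f (i + 1)) X' Y' ∧ Spread Γ S Y' (i + 1) := by
      by_cases hlt : e < Γ.G.mateE e
      · have hA := Γ.G.arcMatrix_of_lt Γ.f hlt
        change Γ.G.arcMatrix Γ.f i = _ at hA
        rw [hA] at c4
        obtain ⟨X', Y', d1, d2, d3, d4, y, z, d5, d6, d7, d8⟩ := c2.leadPairP c1 hnum hlo hhi
          (e := e) c3 c4 (Γ.arcMatrix_nonneg _ _ _)
        refine ⟨X', Y', exec (leadPairP K num S) N, ?_, d1, d2, d4, d3, c5.step hlt d5 d6 d7 d8⟩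
        simp only [distributeStepP, exec, if_pos (hiff.2 hlt)]
        rfl
      · have hA := Γ.G.arcMatrix_of_not_lt Γ.f hlt
        change Γ.G.arcMatrix Γ.f i = _ at hA
        rw [hA] at c4
        refine ⟨X, Y, N, ?_, c1, c2, c3, c4, c5.skip hlt⟩
        simp only [distributeStepP, exec, if_neg fun h => hlt (hiff.1 h)]
        rfl
    obtain ⟨X', Y', N1, k1, k2, k3, k4, k5, k6⟩ := key
    refine Halts.of_loopFree (loopFree_distributeStepP _ _ _) fun y' hy' => ?_
    rw [k1]
    refine ⟨i + 1, X', Y', k2.congr (by simp [Memory.setReg]) (by simp [Memory.setReg])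
      (fun _ _ => rfl), k3.congr (fun _ _ => rfl), ⟨by simp [Memory.setReg, k4], hi⟩, k5, k6, ?_⟩
    rw [hcost] at hy'
    have : m - i = m - (i + 1) + 1 := by omega
    rw [this] at hy
    push_cast at hy
    linarith
  · rintro N y ⟨i, X, Y, c1, c2, ⟨c3, c3'⟩, c4, c5, hy⟩ hb
    simp only [Test.Holds, Term.eval, c3, c1.reg_one] at hb
    obtain rfl : i = m := by omega
    refine ⟨X, Y, c2, ?_, c5, ?_⟩
    · have : Γ.G.arcMatrix Γ.f i = fun _ _ => 0 := by
        ext a b; exact Γ.G.arcMatrix_eq_zero Γ.f a b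
      rwa [this] at c4
    · rw [hcost]
      simp only [Nat.sub_self, Nat.cast_zero] at hy
      linarith

end RAM

/-! ### Flows between terminals after the elimination, and correctness of the output -/

namespace RAM

open SymMatrix

variable {n m k K : ℕ} {Γ : Setup n m k} {M : Memory} {A : Fin n → Fin n → ℤ}
  {ℓ : Fin n → List (Fin n)} {l : List (Record (Fin n))}

/-- The array of the flow between a pair of terminals. -/
def outArr (k : ℕ) (c : Fin k × Fin k) : ℕ := 6 + ((c.1 : ℕ) * k + (c.2 : ℕ))

theorem outArr_injective (k : ℕ) : Function.Injective (outArr k) := by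
  rintro ⟨a, b⟩ ⟨c, d⟩ h
  simp only [outArr] at h
  have h' : k * a + (b : ℕ) = k * c + (d : ℕ) := by
    rw [mul_comm k, mul_comm k]; omega
  have hk : 0 < k := a.pos
  have e : (a : ℕ) = c := by
    have e1 : (k * a + (b : ℕ)) / k = a := by
      rw [Nat.mul_add_div hk, Nat.div_eq_of_lt b.2, add_zero]
    have e2 : (k * c + (d : ℕ)) / k = c := by
      rw [Nat.mul_add_div hk, Nat.div_eq_of_lt d.2, add_zero]
    rw [← e1, h', e2]
  have e' : a = c := Fin.ext e
  subst e'
  have : b = d := Fin.ext (by omega)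
  rw [this]

theorem outArr_lt (c : Fin k × Fin k) : outArr k c < k * k + 6 := by
  have h1 : (c.1 : ℕ) + 1 ≤ k := c.1.2
  have h2 := c.2.2
  have h3 : ((c.1 : ℕ) + 1) * k ≤ k * k := Nat.mul_le_mul_right _ h1
  rw [add_mul] at h3
  simp only [outArr]
  omega

/-- The pairs of terminals. -/
def terminalPairs (k : ℕ) : Finset (Fin k × Fin k) := Finset.univ.filter fun c => c.1 ≤ c.2

/-- The position of the cell of the matrix for a pair of terminals. -/
def terminalAddr (K : ℕ) (c : Fin k × Fin k) : Term :=
  .plus (.read (K + 6) (.read 5 (.const ((c.1 : ℕ) : ℤ)))) (.read 5 (.const ((c.2 : ℕ) : ℤ)))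

/-- The amount between a pair of terminals. -/
def terminalAmount (K : ℕ) (c : Fin k × Fin k) : Term :=
  if c.1 = c.2 then .half (.read (K + 8) (terminalAddr K c)) else .read (K + 8) (terminalAddr K c)

/-- Distribute the matrix to the pairs of terminals. -/
def settleP (K : ℕ) : List (Fin k × Fin k) → Program
  | [] => .skip
  | c :: l => .seq (.write (outArr k c) (terminalAddr K c) (terminalAmount K c)) (settleP K l)

theorem loopFree_settleP (K : ℕ) (l : List (Fin k × Fin k)) : LoopFree (settleP K l) := by
  induction l with
  | nil => trivial
  | cons c l ih => exact ⟨trivial, ih⟩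

theorem regs_settleP (K : ℕ) (l : List (Fin k × Fin k)) : regs (settleP K l) = ∅ := by
  induction l with
  | nil => rfl
  | cons c l ih => simp [settleP, regs, ih]

theorem arrs_settleP {l : List (Fin k × Fin k)} {a : ℕ} (h : a ∈ arrs (settleP K l)) :
    ∃ c ∈ l, a = outArr k c := by
  induction l with
  | nil => exact h.elim
  | cons c l ih =>
    rcases h with h | h
    · exact ⟨c, by simp, h⟩
    · obtain ⟨d, h1, h2⟩ := ih h
      exact ⟨d, by simp [h1], h2⟩

theorem settleP_arr (hK : k * k ≤ K) {l : List (Fin k × Fin k)} (hl : l.Nodup) (M : Memory) :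
    ∀ c ∈ l, (exec (settleP K l) M).arr (outArr k c) = Function.update (M.arr (outArr k c))
      ((terminalAddr K c).eval M) ((terminalAmount K c).eval M) := by
  induction l generalizing M with
  | nil => simp
  | cons d l ih =>
    have hl' := List.nodup_cons.1 hl
    have hd := outArr_lt d
    have hd' : 6 ≤ outArr k d := Nat.le_add_right _ _
    intro c hc
    simp only [settleP, exec]
    rcases List.mem_cons.1 hc with rfl | hc
    · rw [exec_arr fun h => ?_]
      · simp [Memory.setArr]
      · obtain ⟨e, he, h1⟩ := arrs_settleP h
        rw [← outArr_injective k h1] at he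
        exact hl'.1 he
    · have hne : outArr k c ≠ outArr k d := fun e => by
        rw [outArr_injective k e] at hc
        exact hl'.1 hc
      have e5 : outArr k d ≠ 5 := by omega
      have e6 : outArr k d ≠ K + 6 := by omega
      have e8 : outArr k d ≠ K + 8 := by omega
      rw [ih hl'.2 _ c hc]
      have i1 : ∀ z w, (terminalAddr K c).eval (M.setArr (outArr k d) z w) =
          (terminalAddr K c).eval M := fun z w => by
        simp [terminalAddr, Term.eval, Memory.setArr, Function.update_of_ne e5.symm,
          Function.update_of_ne e6.symm]
      have i2 : ∀ z w, (terminalAmount K c).eval (M.setArr (outArr k d) z w) =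
          (terminalAmount K c).eval M := fun z w => by
        unfold terminalAmount
        split_ifs <;> simp only [Term.eval, i1] <;>
          simp [Memory.setArr, Function.update_of_ne e8.symm]
      rw [i1, i2]
      simp [Memory.setArr, Function.update_of_ne hne]

/-- The amounts between pairs of terminals when the matrix is zero elsewhere. -/
def settled (s : Fin k → Fin n) (A : Fin n → Fin n → ℤ) (c : Fin k × Fin k) (a b : Fin n) : ℤ :=
  (if c.1 = c.2 then A (s c.1) (s c.2) / 2 else A (s c.1) (s c.2)) * cell (s c.1) (s c.2) a b

/-- For `i < j` the pair `(i, j)` takes the whole cell and `(j, i)` is not a commodity. For `i = j`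
it takes half, which is counted twice in the symmetrization and loses nothing as the diagonal is
even. -/
theorem routing_settled {G : SkewGraph (Fin n) (Fin m)} {s : Fin k → Fin n}
    (hs : G.IsTerminals s) {U : Finset (Fin n)} (hA : IsWeight G.mateV U A)
    (h0 : ∀ u, (∀ i, u ≠ s i) → ∀ y, A u y = 0) :
    G.Routing (terminalPairs k) (fun c => s c.1) (fun c => G.mateV (s c.2)) A (settled s A)
      fun _ _ => 0 := by
  have hnn : ∀ c : Fin k × Fin k,
      0 ≤ if c.1 = c.2 then A (s c.1) (s c.2) / 2 else A (s c.1) (s c.2) := by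
    intro c
    have := hA.nonneg (s c.1) (s c.2)
    split_ifs <;> omega
  have hex : ∀ c p, G.excess (settled s A c) (fun _ : Fin m => 0) p =
      (if c.1 = c.2 then A (s c.1) (s c.2) / 2 else A (s c.1) (s c.2)) *
        ((if p = s c.1 then 1 else 0) - if p = G.mateV (s c.2) then 1 else 0) := by
    intro c p
    rw [← G.sum_cell_sub]
    simp [SkewGraph.excess, settled, SkewGraph.div]
  refine ⟨fun c _ a b => ?_, fun a b => ?_, fun c _ => ?_, fun c _ => ?_, fun c _ p h1 h2 => ?_⟩
  · refine mul_nonneg (hnn c) ?_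
    simp only [cell]; split_ifs <;> norm_num
  · by_cases ha : ∃ i, a = s i
    · by_cases hb : ∃ j, b = s j
      · obtain ⟨i, rfl⟩ := ha
        obtain ⟨j, rfl⟩ := hb
        have key : ∀ i j : Fin k, ∑ c ∈ terminalPairs k, settled s A c (s i) (s j) =
            if i ≤ j then (if i = j then A (s i) (s j) / 2 else A (s i) (s j)) else 0 := by
          intro i j
          have e : ∀ c : Fin k × Fin k, settled s A c (s i) (s j) = if c = (i, j) then
              (if i = j then A (s i) (s j) / 2 else A (s i) (s j)) else 0 := by
            rintro ⟨p, q⟩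
            simp only [settled, cell, hs.injective.eq_iff, Prod.mk.injEq]
            by_cases h : i = p ∧ j = q
            · obtain ⟨rfl, rfl⟩ := h; simp
            · rw [if_neg h, mul_zero, if_neg (fun h' => h ⟨h'.1.symm, h'.2.symm⟩ : ¬ (p = i ∧ q = j))]
          simp only [e, Finset.sum_ite_eq', terminalPairs, Finset.mem_filter, Finset.mem_univ,
            true_and]
        rw [Finset.sum_add_distrib, key, key, hA.symm (s j) (s i)]
        have h2 := hA.even (s i)
        rcases lt_trichotomy i j with h | h | h
        · simp [h.le, h.ne, h.not_ge]
        · subst h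
          obtain ⟨r, hr⟩ := h2
          simp only [le_refl, if_true, hr]
          omega
        · simp [h.le, h.ne, h.not_ge]
      · push Not at hb
        rw [hA.symm, h0 b hb]
        refine Finset.sum_eq_zero fun c _ => ?_
        simp [settled, cell, hb]
    · push Not at ha
      rw [h0 a ha]
      refine Finset.sum_eq_zero fun c _ => ?_
      simp [settled, cell, ha]
  · rw [hex, if_pos rfl, if_neg (hs.ne_mate _ _)]
    have := hnn c
    linarith
  · rw [hex, if_pos rfl, if_neg (hs.ne_mate _ _).symm]
    have := hnn c
    linarith
  · rw [hex, if_neg h1, if_neg h2]; ring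

theorem Core.settleP (h : Core Γ K M A ℓ l ∅ ∅ ∅) (hK : k * k ≤ K)
    (h0 : ∀ a, 6 ≤ a → a < K + 6 → ∀ x, M.arr a x = 0) :
    RouteRep Γ (outArr k) (terminalPairs k)
      (exec (settleP K (terminalPairs k).toList) M) (settled Γ.s A) fun _ _ => 0 := by
  have hval : ∀ c : Fin k × Fin k,
      (terminalAddr K c).eval M = Γ.off (Γ.s c.1) + ((Γ.s c.2 : ℕ) : ℤ) := by
    intro c
    have e5 : ∀ i : Fin k, M.arr 5 (i : ℕ) = (Γ.s i : ℕ) := fun i => by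
      rw [h.fixed.input_eq 5 (by norm_num)]; exact table_apply (fun i => ((Γ.s i : ℕ) : ℤ)) i
    simp only [terminalAddr, Term.eval, e5, h.fixed.off_eq _ (Γ.terminal_mem _)]
  have hamt : ∀ c : Fin k × Fin k, (terminalAmount K c).eval M =
      if c.1 = c.2 then A (Γ.s c.1) (Γ.s c.2) / 2 else A (Γ.s c.1) (Γ.s c.2) := by
    intro c
    unfold terminalAmount
    split_ifs <;> simp only [Term.eval, hval,
      h.graph.mat _ (Γ.terminal_mem _) _ (Γ.terminal_mem _)]
  have harr : ∀ c ∈ terminalPairs k, ∀ z,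
      (exec (RAM.settleP K (terminalPairs k).toList) M).arr (outArr k c) z =
      if z = Γ.off (Γ.s c.1) + ((Γ.s c.2 : ℕ) : ℤ) then
        (if c.1 = c.2 then A (Γ.s c.1) (Γ.s c.2) / 2 else A (Γ.s c.1) (Γ.s c.2)) else 0 := by
    intro c hc z
    have := outArr_lt c
    rw [settleP_arr hK (Finset.nodup_toList _) M c (Finset.mem_toList.2 hc), hval, hamt,
      Function.update_apply, h0 (outArr k c) (Nat.le_add_right _ _) (by omega)]
  refine ⟨fun c hc a ha b hb => ?_, fun c hc e => ?_⟩
  · rw [harr c hc]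
    simp only [Γ.off_add_eq_iff ha (Γ.terminal_mem _), settled, cell, mul_ite, mul_one, mul_zero]
  · rw [harr c hc, if_neg (Γ.off_add_ne (Γ.terminal_mem _) e)]

/-- Nonnegative amounts with zero total vanish, so nothing is left in the cells and the excess is
the divergency of the amounts on the arcs. -/
theorem isSymmDecomposition_output {X : Fin k × Fin k → Fin n → Fin n → ℤ}
    {Y : Fin k × Fin k → Fin m → ℤ} (h : RouteRep Γ (outArr k) (terminalPairs k) M X Y)
    (hX : Γ.G.Routing (terminalPairs k) (fun c => Γ.s c.1) (fun c => Γ.G.mateV (Γ.s c.2))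
      (fun _ _ => 0) X Y) (hY : Spread Γ (terminalPairs k) Y m) :
    Γ.G.IsSymmDecomposition Γ.s Γ.f (output M) := by
  have mem : ∀ i j : Fin k, i ≤ j → (i, j) ∈ terminalPairs k := fun i j h => by
    simp [terminalPairs, h]
  have hout : ∀ i j, i ≤ j → output M i j = Y (i, j) := fun i j hij => by
    ext e; exact h.arc_eq (i, j) (mem i j hij) e
  have hX0 : ∀ c ∈ terminalPairs k, ∀ a b, X c a b = 0 := by
    intro c hc a b
    have h1 := hX.sum_eq a b
    have h2 := (Finset.sum_eq_zero_iff_of_nonneg fun d hd =>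
      add_nonneg (hX.nonneg d hd a b) (hX.nonneg d hd b a)).1 h1 c hc
    have h3 := hX.nonneg c hc a b
    have h4 := hX.nonneg c hc b a
    omega
  have hex : ∀ c ∈ terminalPairs k, ∀ p, Γ.G.excess (X c) (Y c) p = Γ.G.div (Y c) p := by
    intro c hc p
    simp [SkewGraph.excess, hX0 c hc]
  refine ⟨fun i j hij => ?_, ?_⟩
  · have hc := mem i j hij
    rw [hout i j hij]
    refine ⟨hY.nonneg _ hc, ?_, ?_, fun v h1 h2 => ?_⟩
    · rw [← hex _ hc]; exact hX.source _ hc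
    · rw [← hex _ hc]; exact hX.sink _ hc
    · rw [← hex _ hc]; exact hX.inner _ hc v h1 h2
  · ext e
    rw [← hY.sum_eq e (Or.inl e.2)]
    have : ∀ i : Fin k, ∑ j ∈ Finset.Ici i, (output M i j + Γ.G.symm (output M i j)) =
        ∑ j ∈ Finset.Ici i, (Y (i, j) + Γ.G.symm (Y (i, j))) := fun i =>
      Finset.sum_congr rfl fun j hj => by rw [hout i j (Finset.mem_Ici.1 hj)]
    simp only [this, Finset.sum_apply, Pi.add_apply, SkewGraph.symm]
    rw [terminalPairs, Finset.sum_filter, Fintype.sum_prod_type]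
    refine Finset.sum_congr rfl fun i _ => ?_
    rw [← Finset.sum_filter]
    refine Finset.sum_congr ?_ fun _ _ => rfl
    ext j; simp

/-- Split `log m = log (u ^ 2 / m) + 2 * log (m / u)`. The first term is at most `log (2 + x / m)`,
and `u` times the second is at most `2 * m` because `log t ≤ t`. -/
theorem mul_log_le {u m x κ : ℝ} (hu : 0 ≤ u) (hm : 0 < m) (h1 : u ≤ κ * m) (h2 : u ^ 2 ≤ x) :
    u * Real.log m ≤ (κ + 4) * (m * Real.log (2 + x / m)) := by
  have hκ : 0 ≤ κ := by by_contra h; nlinarith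
  have hx : 0 ≤ x := le_trans (sq_nonneg u) h2
  have hL : 1 / 2 ≤ Real.log (2 + x / m) := by
    have h3 : Real.log 2 ≤ Real.log (2 + x / m) :=
      Real.log_le_log (by norm_num) (by have := div_nonneg hx hm.le; linarith)
    have := Real.log_two_gt_d9
    linarith
  set L := Real.log (2 + x / m) with hLdef
  rcases hu.eq_or_lt with rfl | hu
  · rw [zero_mul]; positivity
  have ht : 0 < m / u := div_pos hm hu
  have h3 : Real.log m = Real.log (u ^ 2 / m) + 2 * Real.log (m / u) := by
    rw [Real.log_div (by positivity) hm.ne', Real.log_div hm.ne' hu.ne', Real.log_pow]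
    push_cast; ring
  have h4 : Real.log (u ^ 2 / m) ≤ L := by
    refine Real.log_le_log (by positivity) ?_
    have : u ^ 2 / m ≤ x / m := div_le_div_of_nonneg_right h2 hm.le
    linarith
  have h5 : Real.log (m / u) ≤ m / u := (Real.log_le_sub_one_of_pos ht).trans (by linarith)
  have h6 : u * Real.log m ≤ u * L + 2 * m := by
    have : u * Real.log m ≤ u * (L + 2 * (m / u)) :=
      mul_le_mul_of_nonneg_left (by rw [h3]; linarith) hu.le
    have e : u * (2 * (m / u)) = 2 * m := by field_simp
    rw [mul_add, e] at this
    exact this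
  have h7 : u * L ≤ κ * m * L := mul_le_mul_of_nonneg_right h1 (by linarith)
  have h8 : m * (1 / 2) ≤ m * L := mul_le_mul_of_nonneg_left hL hm.le
  linarith

end RAM

/-! ### The complete algorithm and its running time -/

namespace RAM

open SymMatrix

theorem counts_stepP (K : ℕ) : Counts 9 (stepP K) := by
  simp [stepP, slackP, recordP, splitP, stackP, addAt, subAt, addP, subP, dropP, push, incr, decr,
    block, Counts]

theorem counts_mainP (K : ℕ) : Counts 9 (mainP K) := by
  have := counts_stepP K
  simp [mainP, fetchP, popStackP, popQueueP, resetP, elimP, startP, scanP, popP, block, Counts,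
    this]

theorem arrs_mainP {K a : ℕ} (h : a ∈ arrs (mainP K)) : K + 8 ≤ a := by
  simp only [mainP, fetchP, popStackP, popQueueP, resetP, elimP, startP, scanP, popP, block, arrs,
    Set.mem_union, Set.mem_empty_iff_false, Set.mem_singleton_iff, false_or, or_false] at h
  rcases h with (h | h | h) | h | h | h <;> first | omega | (have := arrs_stepP h; omega)

variable {n m k K : ℕ} {Γ : Setup n m k} {M : Memory} {A : Fin n → Fin n → ℤ}
  {ℓ : Fin n → List (Fin n)}

/-- A bound on the running time of `mainP`, up to a constant factor. -/
noncomputable def mainTime (Γ : Setup n m k) : ℝ :=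
  2 * m + (Γ.U.card + Γ.U.card * Real.logb 2 ((8 + 2 * k) * m)) +
    10 * elimTime k m Γ.U.card + 6 * Γ.U.card + 1

/-- This lets terms linear in the number of arcs be absorbed into the bound. -/
theorem half_le_log {x : ℝ} (hx : 0 ≤ x) : 1 / 2 ≤ Real.log (2 + x) := by
  have h3 : Real.log 2 ≤ Real.log (2 + x) := Real.log_le_log (by norm_num) (by linarith)
  have := Real.log_two_gt_d9
  linarith

theorem mainTime_le (hm : 1 ≤ m) (Γ : Setup n m k) :
    mainTime Γ ≤ (1000 * (k + 1) ^ 2) * (m * Real.log (2 + (n : ℝ) ^ 2 / m)) := by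
  have hm1 : (1 : ℝ) ≤ m := by exact_mod_cast hm
  have hm0 : (0 : ℝ) < m := by linarith
  have hk : (0 : ℝ) ≤ k := Nat.cast_nonneg k
  have hL := half_le_log (x := (n : ℝ) ^ 2 / m) (by positivity)
  set L := Real.log (2 + (n : ℝ) ^ 2 / m) with hLdef
  set u : ℝ := (Γ.U.card : ℝ) with hu
  have u0 : 0 ≤ u := Nat.cast_nonneg _
  have un : u ≤ n := by
    have := Finset.card_le_univ Γ.U
    rw [Fintype.card_fin] at this
    rw [hu]
    exact_mod_cast this
  have um : u ≤ (2 + 2 * k) * m := by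
    have h1 : u ≤ 2 * m + 2 * k := by rw [hu]; exact_mod_cast Γ.card_le
    nlinarith
  have u2 : u ^ 2 ≤ (n : ℝ) ^ 2 := by nlinarith
  have mL : (m : ℝ) ≤ 2 * (m * L) := by nlinarith
  have uL : u ≤ (2 + 2 * k) * (2 * (m * L)) :=
    um.trans (mul_le_mul_of_nonneg_left mL (by positivity))
  have h1 := mul_log_le u0 hm0 um u2
  rw [← hLdef] at h1
  have h2 : elimTime k m u ≤ (8 + 2 * k) * (m * L) := by
    unfold elimTime
    refine mul_le_mul_of_nonneg_left ?_ (by positivity)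
    rw [← mul_sub, ← Real.log_div (by positivity) hm0.ne']
    refine mul_le_mul_of_nonneg_left (Real.log_le_log (by positivity) ?_) hm0.le
    rw [add_div, div_self hm0.ne']
    have : u ^ 2 / m ≤ (n : ℝ) ^ 2 / m := div_le_div_of_nonneg_right u2 hm0.le
    linarith
  have h3 : u * Real.logb 2 ((8 + 2 * k) * m) ≤
      2 * ((8 + 2 * k) * ((2 + 2 * k) * (2 * (m * L))) + (6 + 2 * k) * (m * L)) := by
    have e : Real.logb 2 ((8 + 2 * k) * m) ≤ 2 * (Real.log (8 + 2 * k) + Real.log m) := by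
      rw [← Real.log_mul (by positivity) hm0.ne', Real.logb, div_le_iff₀ (Real.log_pos (by norm_num))]
      have h4 : 0 ≤ Real.log ((8 + 2 * k) * m) := Real.log_nonneg (by nlinarith)
      have := Real.log_two_gt_d9
      nlinarith
    have e2 : Real.log (8 + 2 * (k : ℝ)) ≤ 8 + 2 * k :=
      (Real.log_le_sub_one_of_pos (by positivity)).trans (by linarith)
    have e3 : u * Real.log (8 + 2 * (k : ℝ)) ≤ (8 + 2 * k) * ((2 + 2 * k) * (2 * (m * L))) := by
      have a1 := mul_le_mul_of_nonneg_left e2 u0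
      have a2 := mul_le_mul_of_nonneg_left uL (show (0 : ℝ) ≤ 8 + 2 * k by positivity)
      linarith
    have e4 := mul_le_mul_of_nonneg_left e u0
    linarith
  have p0 : 0 ≤ m * L := by nlinarith
  unfold mainTime
  rw [← hu]
  have hfin : (2 * m + (u + u * Real.logb 2 ((8 + 2 * k) * m)) + 10 * elimTime k m u + 6 * u + 1 : ℝ)
      ≤ (2 * 2 + 7 * (2 * (2 + 2 * k)) + 2 * ((8 + 2 * k) * ((2 + 2 * k) * 2) + (6 + 2 * k)) +
        10 * (8 + 2 * k) + 2) * (m * L) := by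
    linarith
  refine hfin.trans (mul_le_mul_of_nonneg_right ?_ p0)
  nlinarith

/-- Find the flows between the terminals when the elimination is complete. -/
noncomputable def extractP (k z : ℕ) : Program :=
  .seq (settleP (k * k) (terminalPairs k).toList)
    (.seq (undoP (k * k) (outArr k) (terminalPairs k) z)
      (.seq (.assign 10 (.const 0)) (distributeP (k * k) (outArr k) (terminalPairs k))))

/-- The algorithm. -/
noncomputable def decomposeP (k z : ℕ) : Program :=
  .seq (initP k (k * k)) (.seq (mainP (k * k)) (extractP k z))

/-- A constant that bounds the running time of all parts of the algorithm that have no loops. -/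
noncomputable def stepBound (k z : ℕ) : ℕ :=
  bound (touchPairP (k * k) (.read 0 (.reg 10))) + bound (touchTerminalsP (k * k) k) +
    bound (buildStepP (k * k)) + bound (scanP (k * k)) + (scanTest (k * k)).cost +
    bound (startP (k * k)) + bound (fetchP (k * k)) + (lowTest (k * k)).cost +
    bound (settleP (k * k) (terminalPairs k).toList) +
    bound (undoStepP (k * k) (outArr k) (terminalPairs k) z) +
    bound (distributeStepP (k * k) (outArr k) (terminalPairs k)) + 10

/-- The commodity `c0` receives all closed walks. The time is linear in the number of records and
arcs. -/
theorem halts_extract (c0 : Fin k × Fin k) (hc0 : c0 ∈ terminalPairs k)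
    {l : List (Record (Fin n))} (h : Core Γ (k * k) M A ℓ l ∅ ∅ ∅)
    (h0 : ∀ a, 6 ≤ a → a < k * k + 6 → ∀ x, M.arr a x = 0) {x : ℝ}
    (hx : (stepBound k (outArr k c0) : ℝ) * (l.length + m + 4) ≤ x) :
    Halts (extractP k (outArr k c0)) M x fun N y =>
      Γ.G.IsSymmDecomposition Γ.s Γ.f (output N) ∧ 0 ≤ y := by
  set C : ℝ := (stepBound k (outArr k c0) : ℝ) with hC
  simp only [stepBound] at hC
  push_cast at hC
  have hlo : ∀ c : Fin k × Fin k, 6 ≤ outArr k c := fun c => Nat.le_add_right _ _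
  have hhi : ∀ c : Fin k × Fin k, outArr k c < k * k + 6 := outArr_lt
  have hlow : bound (settleP (k * k) (terminalPairs k).toList) + 10 ≤ C ∧
      bound (undoStepP (k * k) (outArr k) (terminalPairs k) (outArr k c0)) + 10 ≤ C ∧
      bound (distributeStepP (k * k) (outArr k) (terminalPairs k)) + 10 ≤ C := by
    rw [hC]
    refine ⟨?_, ?_, ?_⟩ <;> norm_cast <;> omega
  obtain ⟨b1, b2, b3⟩ := hlow
  have b0 : (0 : ℝ) ≤ bound (settleP (k * k) (terminalPairs k).toList) := Nat.cast_nonneg _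
  clear_value C
  clear hC
  have hC0 : 10 ≤ C := by linarith
  refine Halts.seq (Halts.of_loopFree (loopFree_settleP _ _) fun y hy => ?_)
  have g := h.settleP le_rfl h0
  have hR := routing_settled Γ.terminals h.weight fun u hu => h.zero u (by simp) (by simp) hu
  set M1 := exec (settleP (k * k) (terminalPairs k).toList) M
  have r1 : ∀ r, M1.reg r = M.reg r := fun r => exec_reg (by simp [regs_settleP]) _
  have a1 : ∀ a, (∀ c, a ≠ outArr k c) → M1.arr a = M.arr a := fun a ha =>
    exec_arr (fun h => by obtain ⟨c, -, hc⟩ := arrs_settleP h; exact ha c hc) _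
  refine Halts.seq ((halts_undoP (C := C) (w := C * (m + 2)) (c0 := c0) g
    (h.fixed.congr (r1 _) (r1 _) fun a ha => a1 a fun c => ?_)
    (outArr_injective k) hlo hhi hc0 (h.log.congr fun a h1 h2 z _ => ?_)
    (by rw [r1]; exact h.log_length) h.reduces hR (by positivity) b2 (by linarith)).mono ?_)
  · have := hlo c
    have := hhi c
    omega
  · rw [a1 a fun c => by have := hhi c; omega]
  · rintro N z ⟨X', f1, g1, hR1, hz⟩
    refine Halts.seq (Halts.of_loopFree trivial fun z1 hz1 => ?_)
    simp only [bound, Term.cost] at hz1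
    push_cast at hz1
    set N1 := exec (.assign 10 (.const 0)) N with hN1
    have r2 : ∀ r, r ≠ 10 → N1.reg r = N.reg r := fun r h => exec_reg (by simp [regs, h]) _
    refine (halts_distributeP (M := N1) (C := C) (w := 0) (g1.congr fun _ _ => rfl)
      (f1.congr (r2 _ (by norm_num)) (r2 _ (by norm_num)) fun _ _ => rfl) (outArr_injective k)
      hlo hhi (by simp [hN1, exec, Memory.setReg, Term.eval]) hR1 le_rfl b3 (by linarith)).mono ?_
    rintro N2 y2 ⟨X2, Y2, g2, hR2, hs, hy2⟩
    exact ⟨isSymmDecomposition_output g2 hR2 hs, hy2⟩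

theorem stepBound_ge (k z : ℕ) :
    (bound (touchPairP (k * k) (.read 0 (.reg 10))) : ℝ) + bound (touchTerminalsP (k * k) k) +
      bound (buildStepP (k * k)) + 10 ≤ stepBound k z ∧
    (bound (scanP (k * k)) : ℝ) + (scanTest (k * k)).cost + bound (startP (k * k)) +
      bound (fetchP (k * k)) + (lowTest (k * k)).cost + 10 ≤ stepBound k z := by
  unfold stepBound
  generalize bound (touchPairP (k * k) (.read 0 (.reg 10))) = a1
  generalize bound (touchTerminalsP (k * k) k) = a2
  generalize bound (buildStepP (k * k)) = a3
  generalize bound (scanP (k * k)) = a4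
  generalize (scanTest (k * k)).cost = a5
  generalize bound (startP (k * k)) = a6
  generalize bound (fetchP (k * k)) = a7
  generalize (lowTest (k * k)).cost = a8
  constructor <;> norm_cast <;> omega

theorem exists_halts_decomposeP (k : ℕ) (hk : 1 ≤ k) : ∃ (P : Program) (C : ℝ), ∀ (n m : ℕ), 1 ≤ m →
    ∀ (G : SkewGraph (Fin n) (Fin m)) (s : Fin k → Fin n) (f : Fin m → ℤ),
      G.IsTerminals s → G.IsSymmFlow s f → Halts P (input G s f)
        (C * (m * Real.log (2 + (n : ℝ) ^ 2 / m))) fun N y =>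
          G.IsSymmDecomposition s f (output N) ∧ 0 ≤ y := by
  set c0 : Fin k × Fin k := (⟨0, hk⟩, ⟨0, hk⟩)
  have hc0 : c0 ∈ terminalPairs k := by simp [terminalPairs, c0]
  have hK : 1 ≤ k * k := Nat.mul_pos hk hk
  obtain ⟨C, hC⟩ : ∃ C : ℝ, C = stepBound k (outArr k c0) := ⟨_, rfl⟩
  obtain ⟨hC1, hC2⟩ := stepBound_ge k (outArr k c0)
  rw [← hC] at hC1 hC2
  have hC0 : 10 ≤ C := by
    refine le_trans ?_ hC1
    have := Nat.cast_nonneg (α := ℝ) (bound (touchPairP (k * k) (.read 0 (.reg 10))))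
    have := Nat.cast_nonneg (α := ℝ) (bound (touchTerminalsP (k * k) k))
    have := Nat.cast_nonneg (α := ℝ) (bound (buildStepP (k * k)))
    linarith
  set D : ℝ := 1000 * (k + 1) ^ 2 with hD
  -- The elimination costs at most `x1 = C * (D * (m * L))`, extraction `C * (x1 + m + 4)` and
  -- initialization `C * (2 * m + 5)`. The 14 comes from `2 * m + 5 ≤ 7 * m ≤ 14 * (m * L)`.
  refine ⟨decomposeP k (outArr k c0), C * (C + 1) * (D + 14) + C * 14, ?_⟩
  intro n m hm G s f hs hf
  have hm1 : (1 : ℝ) ≤ m := by exact_mod_cast hm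
  have hL := half_le_log (x := (n : ℝ) ^ 2 / m) (by positivity)
  set L := Real.log (2 + (n : ℝ) ^ 2 / m) with hLdef
  have mL : (m : ℝ) ≤ 2 * (m * L) := by nlinarith
  have m0 : (0 : ℝ) ≤ m * L := by linarith
  set x1 := C * (D * (m * L)) with hx1
  have hD0 : 0 ≤ D := by positivity
  have hx10 : 0 ≤ x1 := by positivity
  refine Halts.seq ((halts_initP hs hf hK hm (C := C) (w := x1 + C * (x1 + m + 4))
    (by positivity) hC1 ?_).mono ?_)
  · have e1 : 2 * (m : ℝ) + 5 ≤ 14 * (m * L) := by linarith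
    have e2 : (m : ℝ) + 4 ≤ 14 * (m * L) := by linarith
    have e3 := mul_le_mul_of_nonneg_left e1 (by linarith : (0 : ℝ) ≤ C)
    have e4 := mul_le_mul_of_nonneg_left e2 (by linarith : (0 : ℝ) ≤ C)
    have e5 : 0 ≤ C * C * (14 * (m * L)) := by positivity
    rw [hx1]
    nlinarith
  · rintro N y ⟨Γ, ℓ, ⟨hG, hs', hf'⟩, c, hlen, ⟨r6, r7, r8⟩, h0, hy⟩
    subst hG hs' hf'
    have hlen' : (∑ a, ((ℓ a).length : ℝ)) ≤ 2 * m := by exact_mod_cast hlen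
    have hmain : C * (∑ a, ((ℓ a).length : ℝ) + load Γ N + 10 * elimTime k m Γ.U.card +
        6 * Γ.U.card + 1) ≤ x1 := by
      refine mul_le_mul_of_nonneg_left (le_trans ?_ (mainTime_le hm Γ)) (by linarith)
      unfold mainTime load
      rw [r6, r7, r8]
      simp only [Int.cast_zero, Int.cast_one, div_one]
      linarith
    have hcard : (Γ.U.card : ℤ) ≤ (8 + 2 * k) * m := by
      have h1 : (Γ.U.card : ℤ) ≤ 2 * m + 2 * k := by exact_mod_cast Γ.card_le
      have h2 : (1 : ℤ) ≤ m := by exact_mod_cast hm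
      have h3 : (0 : ℤ) ≤ k := by positivity
      nlinarith
    have hB : Bounded k m Γ.U (N.reg 8) := by
      rw [r8]
      refine ⟨le_rfl, by rw [one_mul]; exact hcard, ?_⟩
      have h2 : (1 : ℤ) ≤ m := by exact_mod_cast hm
      have h3 : (0 : ℤ) ≤ k := by positivity
      nlinarith
    have r9 := c.log_length
    have hw : 0 ≤ C * (x1 + m + 4) := by positivity
    -- All credit except `x1` is passed through, so at most `x1` is spent, and the frame rule bounds
    -- the number of records by `x1` as well.
    refine Halts.seq (((halts_mainP hm c hB (C := C) (x := y) (w := y - x1) (by linarith) hC2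
      (by linarith)).frame (counts_mainP _)).mono ?_)
    rintro N1 y1 ⟨⟨A', ℓ', l', c1, hy1⟩, ha, hcount⟩
    rw [c1.log_length, r9] at hcount
    push_cast [List.length_nil] at hcount
    rw [hC] at hw hy
    refine halts_extract c0 hc0 c1 (fun a i1 i2 z => ?_) ?_
    · rw [ha a fun h => by have := arrs_mainP h; omega]
      exact h0 a i1 (by omega) z
    · have e1 : (l'.length : ℝ) + m + 4 ≤ x1 + m + 4 := by linarith
      have e2 := mul_le_mul_of_nonneg_left e1 (Nat.cast_nonneg (α := ℝ) (stepBound k (outArr k c0)))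
      linarith

end RAM

/-! ### Renaming nodes and arcs -/

namespace SkewGraph

variable {V E V' E' : Type*}

/-- The graph with the names of nodes and arcs changed. -/
def transfer (G : SkewGraph V E) (v : V ≃ V') (e : E ≃ E') : SkewGraph V' E' where
  tail x := v (G.tail (e.symm x))
  head x := v (G.head (e.symm x))
  tail_ne_head x h := G.tail_ne_head _ (v.injective h)
  mateV x := v (G.mateV (v.symm x))
  mateV_ne x h := G.mateV_ne (v.symm x) (by rw [Equiv.eq_symm_apply]; exact h)
  mateV_mateV x := by simp [G.mateV_mateV]
  mateE x := e (G.mateE (e.symm x))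
  mateE_ne x h := G.mateE_ne (e.symm x) (by rw [Equiv.eq_symm_apply]; exact h)
  mateE_mateE x := by simp [G.mateE_mateE]
  tail_mateE x := by simp [G.tail_mateE]
  head_mateE x := by simp [G.head_mateE]

variable [Fintype E] [Fintype E'] [DecidableEq V] [DecidableEq V'] (G : SkewGraph V E) (v : V ≃ V')
  (e : E ≃ E')

theorem div_transfer (h : E' → ℤ) (x : V') :
    (G.transfer v e).div h x = G.div (fun y => h (e y)) (v.symm x) := by
  simp only [div, Finset.sum_filter]
  congr 1
  · exact Fintype.sum_equiv e.symm _ _ fun y => by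
      simp only [transfer, Equiv.eq_symm_apply, e.apply_symm_apply]
      congr
  · exact Fintype.sum_equiv e.symm _ _ fun y => by
      simp only [transfer, Equiv.eq_symm_apply, e.apply_symm_apply]
      congr

theorem IsTerminals.transfer {G : SkewGraph V E} {k : ℕ} {s : Fin k → V} (h : G.IsTerminals s)
    (v : V ≃ V') (e : E ≃ E') : (G.transfer v e).IsTerminals fun i => v (s i) where
  injective := v.injective.comp h.injective
  ne_mate i j hij := h.ne_mate i j (v.injective (by simpa [SkewGraph.transfer] using hij))

theorem IsSymmFlow.transfer {G : SkewGraph V E} {k : ℕ} {s : Fin k → V} {f : E → ℤ}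
    (h : G.IsSymmFlow s f) (v : V ≃ V') (e : E ≃ E') :
    (G.transfer v e).IsSymmFlow (fun i => v (s i)) fun y => f (e.symm y) where
  nonneg y := h.nonneg _
  symmetric := by
    ext y
    simpa [SkewGraph.transfer, symm] using congrFun h.symmetric (e.symm y)
  div_source i := by
    rw [div_transfer]
    simpa using h.div_source i
  div_inner x h1 h2 := by
    rw [div_transfer]
    simp only [Equiv.symm_apply_apply]
    refine h.div_inner _ (fun i hi => h1 i ?_) fun i hi => h2 i ?_
    · rw [← hi]; simp
    · simp [SkewGraph.transfer, ← hi]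

theorem IsSymmDecomposition.of_transfer {k : ℕ} {s : Fin k → V} {f : E → ℤ}
    {F : Fin k → Fin k → E' → ℤ}
    (h : (G.transfer v e).IsSymmDecomposition (fun i => v (s i)) (fun y => f (e.symm y)) F) :
    G.IsSymmDecomposition s f fun i j y => F i j (e y) where
  isFlow i j hij := by
    have h1 := h.isFlow i j hij
    refine ⟨fun y => h1.nonneg _, ?_, ?_, fun x h2 h3 => ?_⟩
    · simpa [div_transfer] using h1.div_source
    · have h2 := h1.div_sink
      rw [div_transfer] at h2
      simpa [SkewGraph.transfer] using h2
    · have := h1.div_inner (v x) (fun h4 => h2 (v.injective h4))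
        (fun h4 => h3 (v.injective (by simpa [SkewGraph.transfer] using h4)))
      simpa [div_transfer] using this
  sum_eq := by
    ext y
    have := congrFun h.sum_eq (e y)
    simpa [SkewGraph.transfer, symm] using this

end SkewGraph

theorem theorem5 (k : ℕ) (hk : 1 ≤ k) :
    (∀ (V : Type*) (E : Type*) [Fintype V] [Fintype E] [DecidableEq V] (G : SkewGraph V E)
        (s : Fin k → V) (f : E → ℤ), G.IsTerminals s → G.IsSymmFlow s f →
        ∃ F : Fin k → Fin k → E → ℤ, G.IsSymmDecomposition s f F) ∧
    ∃ (P : RAM.Program) (C : ℝ), ∀ (n m : ℕ), 1 ≤ m →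
      ∀ (G : SkewGraph (Fin n) (Fin m)) (s : Fin k → Fin n) (f : Fin m → ℤ),
        G.IsTerminals s → G.IsSymmFlow s f →
        ∃ (t : ℕ) (M : RAM.Memory), RAM.Runs P (RAM.input G s f) t M ∧
          (t : ℝ) ≤ C * ((m : ℝ) * Real.log (2 + (n : ℝ) ^ 2 / (m : ℝ))) ∧
          G.IsSymmDecomposition s f (RAM.output M) := by
  obtain ⟨P, C, hP⟩ := RAM.exists_halts_decomposeP k hk
  constructor
  · intro V E _ _ _ G s f hs hf
    -- The algorithm needs at least one arc; without arcs zero flows do.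
    rcases isEmpty_or_nonempty E with hE | hE
    · exact ⟨fun _ _ _ => 0, fun i j _ => ⟨fun _ => le_rfl, by simp [SkewGraph.div],
        by simp [SkewGraph.div], by simp [SkewGraph.div]⟩, Subsingleton.elim _ _⟩
    · set v := Fintype.equivFin V
      set e := Fintype.equivFin E
      obtain ⟨t, M, -, h, -⟩ := hP _ _ Fintype.card_pos (G.transfer v e) _ _ (hs.transfer v e)
        (hf.transfer v e)
      exact ⟨_, h.of_transfer⟩
  · refine ⟨P, C, fun n m hm G s f hs hf => ?_⟩
    obtain ⟨t, M, h1, h2, h3⟩ := hP n m hm G s f hs hf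
    exact ⟨t, M, h1, by linarith, h2⟩
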